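/- For a positive integer $n$ let $E_{n,\pi/3}$ be the elliptic curve $y^2=x^3+2nx^2-3n^2x$ over $\mathbb{Q}$, that is, the curve $E_{n,\theta}: y^2=x^3+2snx^2-(r^2-s^2)n^2x$ attached to an angle $0<\theta<\pi$ with $\cos\theta=s/r$, $0\le |s|<r$, $\gcd(r,s)=1$, for $\theta=\pi/3$ (so $r=2$, $s=1$). Let $r^g_{\pi/3}(n)$ denote its Mordell–Weil rank, i.e. the rank of the abelian group $E_{n,\pi/3}(\mathbb{Q})$. (1) The integer $n=11229594411$ is square-free, and the curve $$E_{11229594411,\pi/3}:\; y^2=x^3+22459188822\,x^2-378311371906687310763\,x$$ has Mordell–Weil rank exactly $6$. The six points $$P_1=\left(\tfrac{904103532759}{25},\,-\tfrac{992069570757491352}{125}\right),\quad P_2=\left(\tfrac{1541731888897}{16},\,\tfrac{2090318638263775025}{64}\right),$$ $$P_3=\left(\tfrac{265444083202036}{2025},\,\tfrac{4636387440736982658134}{91125}\right),\quad P_4=\left(\tfrac{719501508201}{64},\,\tfrac{40873417425022581}{512}\right),$$ $$P_5=\left(\tfrac{13006760076899764}{269361},\,\tfrac{1693181585331404000267498}{139798359}\right),\quad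 P_6=\left(\tfrac{50286669020153449}{278784},\,\tfrac{11896090671289659453790795}{147197952}\right)$$ are rational points of this curve, are linearly independent over $\mathbb{Z}$, and together with the torsion subgroup generate $E_{11229594411,\pi/3}(\mathbb{Q})$; that is, they form a minimal set of generators of the Mordell–Weil group modulo torsion. (2) Each of the eight integers $$167514827545,\ 198606002595,\ 271314827665,\ 3302971161265,\ 3492293850595,\ 6634009064865,\ 40582123000419,\ 45563330326345$$ is square-free and satisfies $r^g_{\pi/3}(n)=6$. -/

import Mathlib

/-- `r, s` are the integers attached to an angle `θ` with rational cosine: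
`0 < θ < π` and `cos θ = s / r` with `0 ≤ |s| < r` and `gcd (r, s) = 1`. -/
def IsAngleParams (θ : ℝ) (r s : ℤ) : Prop :=
  0 < θ ∧ θ < Real.pi ∧ |s| < r ∧ Int.gcd r s = 1 ∧ Real.cos θ = (s : ℝ) / (r : ℝ)

/-- The `θ`-congruent number elliptic curve over `ℚ`, for `cos θ = s / r`:
`E_{n,θ} : y² = x³ + 2 s n x² - (r² - s²) n² x`. -/
def thetaCurve (r s : ℤ) (n : ℕ) : WeierstrassCurve ℚ where
  a₁ := 0
  a₂ := 2 * (s : ℚ) * (n : ℚ)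
  a₃ := 0
  a₄ := -(((r : ℚ) ^ 2 - (s : ℚ) ^ 2) * (n : ℚ) ^ 2)
  a₆ := 0

/-- The integers attached to `θ = π / 3` are `r = 2`, `s = 1`. -/
theorem isAngleParams_pi_div_three : IsAngleParams (Real.pi / 3) 2 1 := by
  refine ⟨by positivity, by linarith [Real.pi_pos], by norm_num, by norm_num, ?_⟩
  rw [Real.cos_pi_div_three]
  norm_num

/-- The curve `E_{n,π/3}`. -/
def piThirdCurve (n : ℕ) : WeierstrassCurve ℚ := thetaCurve 2 1 n

/-- `E_{n,π/3}` is an elliptic curve for every positive integer `n`. -/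
theorem piThirdCurve_isElliptic (n : ℕ) (hn : n ≠ 0) : (piThirdCurve n).IsElliptic := by
  have h : (piThirdCurve n).Δ = 2304 * (n : ℚ) ^ 6 := by
    simp only [piThirdCurve, thetaCurve, WeierstrassCurve.Δ, WeierstrassCurve.b₂,
      WeierstrassCurve.b₄, WeierstrassCurve.b₆, WeierstrassCurve.b₈]
    push_cast
    ring
  refine ⟨?_⟩
  rw [h, isUnit_iff_ne_zero]
  have : (n : ℚ) ≠ 0 := by exact_mod_cast hn
  positivity

/-- The Mordell–Weil rank of a curve over `ℚ`: the rank of its group of rational points,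
that is, the maximal number of `ℤ`-linearly independent rational points. -/
noncomputable def mordellWeilRank (W : WeierstrassCurve ℚ) : ℕ :=
  Module.finrank ℤ W.toAffine.Point

/-- The `x`-coordinates of the six listed points. -/
def genX : Fin 6 → ℚ :=
  ![904103532759 / 25,
    1541731888897 / 16,
    265444083202036 / 2025,
    719501508201 / 64,
    13006760076899764 / 269361,
    50286669020153449 / 278784]

/-- The `y`-coordinates of the six listed points. -/
def genY : Fin 6 → ℚ :=
  ![-992069570757491352 / 125,
    2090318638263775025 / 64,
    4636387440736982658134 / 91125,
    40873417425022581 / 512,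
    1693181585331404000267498 / 139798359,
    11896090671289659453790795 / 147197952]

/-- The eight further integers. -/
def otherRankSix : List ℕ :=
  [167514827545, 198606002595, 271314827665, 3302971161265,
    3492293850595, 6634009064865, 40582123000419, 45563330326345]

open WeierstrassCurve.Affine

variable {n : ℕ}

/-! The curve is y² = x(x − n)(x + 3n), with all its two-torsion rational, and the rank comes from a
complete 2-descent. Modulo squares, x and x − n extend to homomorphisms on the points
(`isSquare_descentMap_mul_add`), and a point killed by both is a double up to two-torsion
(`exists_two_nsmul_eq`). Writing x = nu/w in lowest terms gives n z² = u w (u − w)(u + 3w). This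
equation confines the square classes to −1, 2, 3 and the primes dividing n, and imposes linear
conditions over 𝔽₂ at the real place, at 2, at 3 and at each p ≥ 5 dividing n
(`localCondition_sum`).

The upper bound is certified by writing the identity matrix as a sum of terms "condition times
correction vector" and "dual functional times class of a known point". A vector satisfying the
conditions is then a combination of the classes of six points and two torsion points
(`classVec_eq_sum`). The dual functionals also make these eight classes independent, whence the six
points are independent over ℤ (`linearIndependent_of_dual`). To read off the rank one needs finite
generation, which follows from a naive height (`fg_of_finite_reps`), and then a Nakayama argument
(`finrank_eq_of_generates_mod_two`).

Spanning modulo doubles still allows a proper subgroup G of odd index, so generation needs explicit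
heights. The height of x/n = a/b is a² + 3b². This norm form is multiplicative, its square is the
numerator in the duplication formula, and translation by (0,0) or (n,0) multiplies it by 3 or 4
before cancellation. Hence H(P+Q)H(P−Q) ≤ 4(H(P)H(Q))² for P ≠ ±Q
(`ptHeight_add_mul_ptHeight_sub_le`), and for n ≡ 3 mod 8 some two-torsion translate satisfies
H(P+T)⁴ ≤ H(2P) with no loss (`exists_translate`). If Q were a point of least height outside G and g
∈ G represented its class modulo doubles and two-torsion, a translate of Q congruent to g modulo
doubles would have height at most the cube root of 41472·H(g).

Such small points are excluded class by class (`eq_top_of_reps`). The class fixes the square classes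
of u, w, u − w and u + 3w (`IsIntRep.isSquare_mul`), so a candidate is a pair of bounded square
roots making two further linear forms square multiples: a short finite search
(`ChainEntry.lt_ptHeight`). Representatives of the 63 nonzero classes inside G are produced by a
chain of collinear triples (`valid_of_runChain`). -/

/-! ### The curve and its chords and tangents. -/

theorem piThirdCurve_equation_iff {x y : ℚ} :
    (piThirdCurve n).toAffine.Equation x y ↔ y ^ 2 = x * (x - n) * (x + 3 * n) := by
  rw [WeierstrassCurve.Affine.equation_iff]
  simp only [piThirdCurve, thetaCurve]
  push_cast
  constructor <;> intro h <;> linear_combination h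

theorem piThirdCurve_nonsingular_iff (hn : n ≠ 0) {x y : ℚ} :
    (piThirdCurve n).toAffine.Nonsingular x y ↔ y ^ 2 = x * (x - n) * (x + 3 * n) := by
  have := piThirdCurve_isElliptic n hn
  rw [← WeierstrassCurve.Affine.equation_iff_nonsingular, piThirdCurve_equation_iff]

theorem piThirdCurve_negY (x y : ℚ) : (piThirdCurve n).toAffine.negY x y = -y := by
  simp [WeierstrassCurve.Affine.negY, piThirdCurve, thetaCurve]

/-- The sum of two points that are not opposite, together with the line through them. -/
theorem exists_line {x₁ y₁ x₂ y₂ : ℚ} (h₁ : (piThirdCurve n).toAffine.Nonsingular x₁ y₁)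
    (h₂ : (piThirdCurve n).toAffine.Nonsingular x₂ y₂) (hxy : ¬(x₁ = x₂ ∧ y₁ = -y₂)) :
    ∃ (l x₃ y₃ : ℚ) (h₃ : (piThirdCurve n).toAffine.Nonsingular x₃ y₃),
      Point.some x₁ y₁ h₁ + Point.some x₂ y₂ h₂ = Point.some x₃ y₃ h₃ ∧
      y₃ = -(l * (x₃ - x₁) + y₁) ∧
      (∀ x, x * (x - n) * (x + 3 * n) - (l * (x - x₁) + y₁) ^ 2 =
        (x - x₁) * (x - x₂) * (x - x₃)) ∧
      (x₁ ≠ x₂ → l = (y₁ - y₂) / (x₁ - x₂)) := by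
  have hxy' : ¬(x₁ = x₂ ∧ y₁ = (piThirdCurve n).toAffine.negY x₂ y₂) := by
    rwa [piThirdCurve_negY]
  refine ⟨(piThirdCurve n).toAffine.slope x₁ x₂ y₁ y₂, _, _,
    WeierstrassCurve.Affine.nonsingular_add h₁ h₂ hxy', Point.add_some hxy', ?_, ?_, ?_⟩
  · rw [WeierstrassCurve.Affine.addY, piThirdCurve_negY, WeierstrassCurve.Affine.negAddY]
  · intro x
    have h := WeierstrassCurve.Affine.addPolynomial_slope h₁.1 h₂.1 hxy'
    have h' := congrArg (Polynomial.eval x) h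
    rw [WeierstrassCurve.Affine.addPolynomial_eq] at h'
    simp only [Cubic.toPoly, piThirdCurve, thetaCurve, Polynomial.eval_neg, Polynomial.eval_add,
      Polynomial.eval_mul, Polynomial.eval_C, Polynomial.eval_pow, Polynomial.eval_X,
      Polynomial.eval_sub] at h'
    simp only [piThirdCurve, thetaCurve]
    push_cast at h' ⊢
    linear_combination -h'
  · intro hx
    exact WeierstrassCurve.Affine.slope_of_X_ne hx

/-! ### The two descent maps and halving. -/

/-- The map `x - e` on points, with value `c` at the root `e` and `1` at infinity. -/
noncomputable def descentMap (e c : ℚ) : (piThirdCurve n).toAffine.Point → ℚ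
  | .zero => 1
  | .some x _ _ => if x = e then c else x - e

/-- `e` is a root of the cubic and `c` is the derivative there. -/
def IsRootDatum (n : ℕ) (e c : ℚ) : Prop :=
  c ≠ 0 ∧ ∃ a : ℚ, ∀ x : ℚ, x * (x - n) * (x + 3 * n) = (x - e) * ((x - e) ^ 2 + a * (x - e) + c)

theorem isRootDatum_zero (hn : n ≠ 0) : IsRootDatum n 0 (-3 * (n : ℚ) ^ 2) := by
  have : (n : ℚ) ≠ 0 := by exact_mod_cast hn
  exact ⟨by simpa using this, 2 * n, fun x => by ring⟩

theorem isRootDatum_self (hn : n ≠ 0) : IsRootDatum n n (4 * (n : ℚ) ^ 2) := by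
  have : (n : ℚ) ≠ 0 := by exact_mod_cast hn
  exact ⟨by simpa using this, 5 * n, fun x => by ring⟩

theorem descentMap_ne_zero {e c : ℚ} (h : IsRootDatum n e c)
    (P : (piThirdCurve n).toAffine.Point) : descentMap e c P ≠ 0 := by
  cases P with
  | zero => simp [descentMap]
  | some x y hP =>
    simp only [descentMap]
    split_ifs with hx
    · exact h.1
    · exact sub_ne_zero.mpr hx

theorem isSquare_descentMap_mul_add {e c : ℚ} (h : IsRootDatum n e c)
    (P Q : (piThirdCurve n).toAffine.Point) :
    IsSquare (descentMap e c P * descentMap e c Q * descentMap e c (P + Q)) := by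
  obtain ⟨hc, a, ha⟩ := h
  cases P with
  | zero =>
    rw [← Point.zero_def, zero_add]
    exact ⟨descentMap e c Q, by simp [descentMap]⟩
  | some x₁ y₁ h₁ =>
  cases Q with
  | zero =>
    rw [← Point.zero_def, add_zero]
    exact ⟨descentMap e c (.some x₁ y₁ h₁), by simp [descentMap]⟩
  | some x₂ y₂ h₂ =>
  by_cases hxy : x₁ = x₂ ∧ y₁ = -y₂
  · rw [Point.add_of_Y_eq hxy.1 (by rw [piThirdCurve_negY]; exact hxy.2)]
    obtain ⟨rfl, -⟩ := hxy
    exact ⟨descentMap e c (.some x₁ y₁ h₁), by simp [descentMap]⟩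
  obtain ⟨l, x₃, y₃, h₃, hadd, -, hl, -⟩ := exists_line h₁ h₂ hxy
  rw [hadd]
  set m := l * (e - x₁) + y₁ with hm
  -- The origin is moved to the root e, where the line takes the value m; evaluating at t = 0, 1, −1
  -- isolates the constant and linear coefficients.
  have key (t : ℚ) : t * (t ^ 2 + a * t + c) - (l * t + m) ^ 2 =
      (t + e - x₁) * (t + e - x₂) * (t + e - x₃) := by
    rw [← hl (t + e), ha]; ring
  have k0 := key 0
  have k1 := key 1
  have k2 := key (-1)
  have e3 : (x₁ - e) * (x₂ - e) * (x₃ - e) = m ^ 2 := by linear_combination k0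
  have e2 : (x₁ - e) * (x₂ - e) + (x₁ - e) * (x₃ - e) + (x₂ - e) * (x₃ - e) = c - 2 * l * m := by
    linear_combination -(k1 - k2) / 2
  -- If no abscissa is e, the product is m². If exactly one is, then m = 0 and the linear
  -- coefficient says that the other two factors multiply to c. Two or more would force c = 0.
  simp only [descentMap]
  by_cases h1 : x₁ = e <;> by_cases h2 : x₂ = e <;> by_cases h3 : x₃ = e <;>
    simp only [h1, h2, h3, if_true, if_false] <;>
    try simp only [h1, h2, h3, sub_self, zero_mul, mul_zero, add_zero, zero_add] at e2 e3
  all_goals first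
    | exact ⟨m, by rw [e3]; ring⟩
    | (have hm0 : m = 0 := by simpa using e3.symm
       rw [hm0, mul_zero, sub_zero] at e2
       first
        | exact absurd e2.symm hc
        | exact ⟨c, by linear_combination c * e2⟩)

/-- Halving a point all of whose three differences with the roots are squares. -/
theorem exists_two_nsmul_eq (hn : n ≠ 0) {x y : ℚ} (h : (piThirdCurve n).toAffine.Nonsingular x y)
    (h0 : IsSquare x) (h1 : IsSquare (x - n)) (h2 : IsSquare (x + 3 * n)) :
    ∃ R : (piThirdCurve n).toAffine.Point, Point.some x y h = 2 • R := by
  have hn' : (n : ℚ) ≠ 0 := by exact_mod_cast hn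
  obtain ⟨r, hr⟩ := h0
  obtain ⟨s, hs⟩ := h1
  obtain ⟨t, ht⟩ := h2
  have heq := (piThirdCurve_nonsingular_iff hn).mp h
  -- The sign of the third square root is chosen so that the ordinate is exactly the product of the
  -- three roots.
  obtain ⟨u, hu, hy⟩ : ∃ u : ℚ, x + 3 * n = u * u ∧ y = r * s * u := by
    have : (y - r * s * t) * (y + r * s * t) = 0 := by
      rw [hs, ht] at heq
      have hr' := hr
      rw [hr] at heq
      linear_combination heq
    rcases mul_eq_zero.mp this with h | h
    · exact ⟨t, ht, by linear_combination h⟩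
    · exact ⟨-t, by linear_combination ht, by linear_combination h⟩
  have a1 : (r + s) * (r - s) = n := by linear_combination hs - hr
  have a2 : (r + u) * (u - r) = 3 * n := by linear_combination hr - hu
  have a3 : (s + u) * (u - s) = 4 * n := by linear_combination hs - hu
  have b1 : r + s ≠ 0 := fun h => hn' (by rw [← a1, h, zero_mul])
  have b2 : r + u ≠ 0 := fun h => hn' (by
    have : (3 : ℚ) * n = 0 := by rw [← a2, h, zero_mul]
    linarith)
  have b3 : s + u ≠ 0 := fun h => hn' (by
    have : (4 : ℚ) * n = 0 := by rw [← a3, h, zero_mul]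
    linarith)
  -- The classical halving formula: the differences of x₀ with the three roots are the pairwise
  -- products of r+s, r+u, s+u, and the tangent there has slope r+s+u.
  set x₀ := x + r * s + r * u + s * u with hx₀
  set y₀ := (r + s) * (r + u) * (s + u) with hy₀
  have c0 : x₀ = (r + s) * (r + u) := by rw [hx₀, hr]; ring
  have c1 : x₀ - n = (r + s) * (s + u) := by linear_combination hx₀ + hs
  have c2 : x₀ + 3 * n = (r + u) * (s + u) := by linear_combination hx₀ + hu
  have hR : (piThirdCurve n).toAffine.Nonsingular x₀ y₀ := by
    rw [piThirdCurve_nonsingular_iff hn, c1, c2, c0, hy₀]; ring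
  have hy0 : y₀ ≠ 0 := mul_ne_zero (mul_ne_zero b1 b2) b3
  have hne : ¬(x₀ = x₀ ∧ y₀ = -y₀) := fun h => hy0 (by linarith [h.2])
  obtain ⟨l, x₃, y₃, h₃, hadd, hy₃, hl, -⟩ := exists_line hR hR hne
  refine ⟨.some x₀ y₀ hR, ?_⟩
  rw [two_nsmul, hadd]
  have k0 := hl (x₀ + 1)
  have k1 := hl (x₀ - 1)
  have hl' : l = r + s + u := by
    have : 2 * y₀ * (l - (r + s + u)) = 0 := by
      have e1 : (3 * x₀ ^ 2 + 4 * n * x₀ - 3 * n ^ 2) = 2 * y₀ * l := by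
        have k2 := hl x₀
        linear_combination (k0 - k1) / 2
      have e2 : (3 * x₀ ^ 2 + 4 * n * x₀ - 3 * n ^ 2) = 2 * y₀ * (r + s + u) := by
        have : (3 * x₀ ^ 2 + 4 * n * x₀ - 3 * n ^ 2) = x₀ * (x₀ - n) + x₀ * (x₀ + 3 * n) +
          (x₀ - n) * (x₀ + 3 * n) := by ring
        rw [this, c1, c2, c0, hy₀]; ring
      linear_combination e2 - e1
    rcases mul_eq_zero.mp this with h | h
    · exact absurd h (by simpa using hy0)
    · linarith
  have hx3 : x₃ = x := by
    have e1 : x₃ = l ^ 2 - 2 * n - 2 * x₀ := by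
      have k2 := hl x₀
      linear_combination (k0 + k1 - 2 * k2) / 2
    rw [e1, hl']
    linear_combination (-2) * hx₀ - hr - hs - hu
  have hy3 : y₃ = y := by
    rw [hy₃, hx3, hl', hy, hx₀, hy₀]; ring
  subst hx3 hy3
  rfl

/-- Three points with pairwise distinct abscissas on a line add up to zero. -/
theorem add_eq_neg_of_collinear {x₁ y₁ x₂ y₂ x₃ y₃ : ℚ}
    (h₁ : (piThirdCurve n).toAffine.Nonsingular x₁ y₁)
    (h₂ : (piThirdCurve n).toAffine.Nonsingular x₂ y₂)
    (h₃ : (piThirdCurve n).toAffine.Nonsingular x₃ y₃)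
    (h12 : x₁ ≠ x₂) (h13 : x₁ ≠ x₃) (h23 : x₂ ≠ x₃)
    (hdet : (y₁ - y₂) * (x₃ - x₁) = (y₃ - y₁) * (x₁ - x₂)) :
    Point.some x₁ y₁ h₁ + Point.some x₂ y₂ h₂ = -Point.some x₃ y₃ h₃ := by
  obtain ⟨l, x, y, h, hadd, hy, hl, hlx⟩ := exists_line h₁ h₂ (fun h => h12 h.1)
  have hlx := hlx h12
  have h12' := sub_ne_zero.mpr h12
  have hy3 : y₃ = l * (x₃ - x₁) + y₁ := by
    rw [hlx]; field_simp; linear_combination -hdet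
  have k := hl x₃
  rw [← hy3, ← piThirdCurve_equation_iff.mp h₃.1, sub_self] at k
  have hx : x = x₃ := by
    rcases mul_eq_zero.mp k.symm with h | h
    · rcases mul_eq_zero.mp h with h | h
      · exact absurd (sub_eq_zero.mp h).symm h13
      · exact absurd (sub_eq_zero.mp h).symm h23
    · exact (sub_eq_zero.mp h).symm
  subst hx
  have hyy : y = -y₃ := by rw [hy, hy3]
  subst hyy
  rw [hadd, Point.neg_some]
  congr 1
  rw [piThirdCurve_negY]

/-! ### Characters of square classes. -/

/-- A homomorphism from the nonzero integers to `ZMod 2`. -/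
def IsMulChar (f : ℤ → ZMod 2) : Prop :=
  ∀ a b : ℤ, a ≠ 0 → b ≠ 0 → f (a * b) = f a + f b

theorem IsMulChar.mul_self {f : ℤ → ZMod 2} (hf : IsMulChar f) {a : ℤ} (ha : a ≠ 0) :
    f (a * a) = 0 := by
  rw [hf a a ha ha, CharTwo.add_self_eq_zero]

theorem IsMulChar.sq {f : ℤ → ZMod 2} (hf : IsMulChar f) {a : ℤ} (ha : a ≠ 0) :
    f (a ^ 2) = 0 := by
  rw [_root_.sq, hf.mul_self ha]

theorem IsMulChar.one {f : ℤ → ZMod 2} (hf : IsMulChar f) : f 1 = 0 := by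
  simpa using hf.mul_self one_ne_zero

/-- The extension of a character to the rationals. -/
def ratChar (f : ℤ → ZMod 2) (q : ℚ) : ZMod 2 := f q.num + f q.den

/-- The fraction need not be reduced: cross-multiplication relates it to its lowest terms, and in
`ZMod 2` dividing and multiplying have the same effect. -/
theorem ratChar_div {f : ℤ → ZMod 2} (hf : IsMulChar f) {a b : ℤ} (ha : a ≠ 0) (hb : b ≠ 0) :
    ratChar f (a / b) = f (a * b) := by
  set q : ℚ := a / b with hq
  have hq0 : q.num ≠ 0 := by
    rw [Rat.num_ne_zero, hq]
    exact div_ne_zero (by exact_mod_cast ha) (by exact_mod_cast hb)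
  have hd : (q.den : ℤ) ≠ 0 := by exact_mod_cast q.den_nz
  have h : a * q.den = q.num * b := by
    have : (a : ℚ) * q.den = q.num * b := by
      have h1 := Rat.num_div_den q
      have h2 : (q.den : ℚ) ≠ 0 := by exact_mod_cast q.den_nz
      have h3 : (b : ℚ) ≠ 0 := by exact_mod_cast hb
      rw [hq] at h1
      field_simp at h1
      rw [← hq] at h1
      linarith
    exact_mod_cast this
  have h' := congrArg f h
  rw [hf _ _ ha hd, hf _ _ hq0 hb] at h'
  rw [ratChar, hf _ _ ha hb]
  generalize f a = s at *
  generalize f b = t at *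
  generalize f q.num = u at *
  generalize f q.den = v at *
  revert s t u v
  decide

theorem ratChar_mul {f : ℤ → ZMod 2} (hf : IsMulChar f) {q r : ℚ} (hq : q ≠ 0) (hr : r ≠ 0) :
    ratChar f (q * r) = ratChar f q + ratChar f r := by
  have h1 : (q.den : ℤ) ≠ 0 := by exact_mod_cast q.den_nz
  have h2 : (r.den : ℤ) ≠ 0 := by exact_mod_cast r.den_nz
  have h3 := Rat.num_ne_zero.mpr hq
  have h4 := Rat.num_ne_zero.mpr hr
  have h : q * r = ((q.num * r.num : ℤ) : ℚ) / ((q.den * r.den : ℤ) : ℚ) := by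
    push_cast
    rw [mul_div_mul_comm, Rat.num_div_den, Rat.num_div_den]
  rw [h, ratChar_div hf (mul_ne_zero h3 h4) (mul_ne_zero h1 h2),
    hf _ _ (mul_ne_zero h3 h4) (mul_ne_zero h1 h2), hf _ _ h3 h4, hf _ _ h1 h2, ratChar, ratChar]
  ring

theorem ratChar_isSquare {f : ℤ → ZMod 2} (hf : IsMulChar f) {q : ℚ} (hq : q ≠ 0)
    (h : IsSquare q) : ratChar f q = 0 := by
  obtain ⟨r, rfl⟩ := h
  have hr : r ≠ 0 := fun h => hq (by simp [h])
  rw [ratChar_mul hf hr hr, CharTwo.add_self_eq_zero]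

/-- A character of the square classes of the values of a descent map. -/
noncomputable def descentHom (f : ℤ → ZMod 2) (hf : IsMulChar f) {e c : ℚ}
    (h : IsRootDatum n e c) : (piThirdCurve n).toAffine.Point →+ ZMod 2 :=
  AddMonoidHom.mk' (fun P => ratChar f (descentMap e c P)) fun P Q => by
    have hP := descentMap_ne_zero h P
    have hQ := descentMap_ne_zero h Q
    have hPQ := descentMap_ne_zero h (P + Q)
    have := ratChar_isSquare hf (mul_ne_zero (mul_ne_zero hP hQ) hPQ)
      (isSquare_descentMap_mul_add h P Q)
    rw [ratChar_mul hf (mul_ne_zero hP hQ) hPQ, ratChar_mul hf hP hQ] at this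
    exact (CharTwo.add_eq_zero.mp this).symm

theorem descentHom_apply (f : ℤ → ZMod 2) (hf : IsMulChar f) {e c : ℚ} (h : IsRootDatum n e c)
    (P : (piThirdCurve n).toAffine.Point) :
    descentHom f hf h P = ratChar f (descentMap e c P) := rfl

/-! ### Integral coordinates of points. -/

/-- Integers `u, w, z` describing the point `(n u / w, n² z / w²)` with nonzero ordinate. -/
structure IsIntRep (n : ℕ) (u w z : ℤ) : Prop where
  coprime : IsCoprime u w
  pos : 0 < w
  eq : n * z ^ 2 = u * w * (u - w) * (u + 3 * w)
  ne : z ≠ 0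

namespace IsIntRep

variable {u w z : ℤ}

theorem prod_ne (hn : n ≠ 0) (h : IsIntRep n u w z) : u * w * (u - w) * (u + 3 * w) ≠ 0 := by
  rw [← h.eq]
  exact mul_ne_zero (by exact_mod_cast hn) (pow_ne_zero _ h.ne)

theorem ne_u (hn : n ≠ 0) (h : IsIntRep n u w z) : u ≠ 0 := by
  have := h.prod_ne hn; simp_all

theorem ne_w (h : IsIntRep n u w z) : w ≠ 0 := h.pos.ne'

theorem ne_sub (hn : n ≠ 0) (h : IsIntRep n u w z) : u - w ≠ 0 := by
  have := h.prod_ne hn; simp_all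

theorem ne_add (hn : n ≠ 0) (h : IsIntRep n u w z) : u + 3 * w ≠ 0 := by
  have := h.prod_ne hn; simp_all

theorem nonsingular (hn : n ≠ 0) (h : IsIntRep n u w z) :
    (piThirdCurve n).toAffine.Nonsingular ((n * u : ℤ) / (w : ℤ) : ℚ)
      ((n ^ 2 * z : ℤ) / (w ^ 2 : ℤ) : ℚ) := by
  rw [piThirdCurve_nonsingular_iff hn]
  have hw : (w : ℚ) ≠ 0 := by exact_mod_cast h.ne_w
  have he : (n : ℚ) * z ^ 2 = u * w * (u - w) * (u + 3 * w) := by exact_mod_cast h.eq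
  push_cast
  field_simp
  linear_combination he

/-- The point described by integers `u, w, z`. -/
noncomputable def point (hn : n ≠ 0) (h : IsIntRep n u w z) : (piThirdCurve n).toAffine.Point :=
  .some _ _ (h.nonsingular hn)

theorem ratChar_zero (hn : n ≠ 0) (h : IsIntRep n u w z) {f : ℤ → ZMod 2} (hf : IsMulChar f) :
    ratChar f (descentMap 0 (-3 * (n : ℚ) ^ 2) (h.point hn)) = f (n * u * w) := by
  have hu := h.ne_u hn
  have hn' : (n : ℤ) ≠ 0 := by exact_mod_cast hn
  have hw := h.ne_w
  have h0 : ((n * u : ℤ) / (w : ℤ) : ℚ) ≠ 0 :=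
    div_ne_zero (by exact_mod_cast mul_ne_zero hn' hu) (by exact_mod_cast hw)
  rw [point, descentMap, if_neg h0, sub_zero, ratChar_div hf (mul_ne_zero hn' hu) hw]

theorem ratChar_self (hn : n ≠ 0) (h : IsIntRep n u w z) {f : ℤ → ZMod 2} (hf : IsMulChar f) :
    ratChar f (descentMap n (4 * (n : ℚ) ^ 2) (h.point hn)) = f (n * (u - w) * w) := by
  have hu := h.ne_sub hn
  have hn' : (n : ℤ) ≠ 0 := by exact_mod_cast hn
  have hw := h.ne_w
  have hw' : (w : ℚ) ≠ 0 := by exact_mod_cast hw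
  have h0 : ((n * u : ℤ) / (w : ℤ) : ℚ) - n = ((n * (u - w) : ℤ) / (w : ℤ) : ℚ) := by
    push_cast; field_simp
  have h1 : ((n * u : ℤ) / (w : ℤ) : ℚ) ≠ n := by
    rw [← sub_ne_zero, h0]
    exact div_ne_zero (by exact_mod_cast mul_ne_zero hn' hu) (by exact_mod_cast hw)
  rw [point, descentMap, if_neg h1, h0, ratChar_div hf (mul_ne_zero hn' hu) hw]

end IsIntRep

/-- Every point with nonzero ordinate is described by integers. -/
theorem exists_isIntRep (hn : Squarefree n) {x y : ℚ}
    (h : (piThirdCurve n).toAffine.Nonsingular x y) (hy : y ≠ 0) :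
    ∃ (z : ℤ) (hr : IsIntRep n (x / n).num (x / n).den z),
      Point.some x y h = hr.point hn.ne_zero := by
  have hn0 := hn.ne_zero
  have hnq : (n : ℚ) ≠ 0 := by exact_mod_cast hn0
  set X := x / n with hX
  set u := X.num with hu
  set w : ℤ := (X.den : ℤ) with hw
  have hw0 : 0 < w := by rw [hw]; exact_mod_cast X.den_pos
  have hwq : (w : ℚ) ≠ 0 := by exact_mod_cast hw0.ne'
  have hx : x = n * u / w := by
    have h1 : X = u / w := by rw [hu, hw]; exact_mod_cast (Rat.num_div_den X).symm
    have h2 : x = n * X := by rw [hX]; field_simp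
    rw [h2, h1]; ring
  have heq := (piThirdCurve_nonsingular_iff hn0).mp h
  have h1 : (y * w ^ 2 / n) ^ 2 = ((n * (u * w * (u - w) * (u + 3 * w)) : ℤ) : ℚ) := by
    rw [div_pow, mul_pow, heq, hx]
    push_cast
    field_simp
  have h2 : IsSquare (n * (u * w * (u - w) * (u + 3 * w)) : ℤ) := by
    rw [← Rat.isSquare_intCast_iff, ← h1]
    exact IsSquare.sq _
  obtain ⟨Z, hZ⟩ := h2
  -- Squarefreeness of n is what lets the factor n be taken out of the ordinate.
  have h3 : (n : ℤ) ∣ Z := by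
    have hsq : Squarefree (n : ℤ) := Int.squarefree_natCast.mpr hn
    rw [← hsq.dvd_pow_iff_dvd two_ne_zero]
    exact ⟨u * w * (u - w) * (u + 3 * w), by rw [sq, ← hZ]⟩
  have h4 : y * w ^ 2 / n = Z ∨ y * w ^ 2 / n = -Z := by
    rw [← sq_eq_sq_iff_eq_or_eq_neg, h1, hZ]; push_cast; ring
  obtain ⟨t, ht, hyt⟩ : ∃ t : ℤ, t ^ 2 * n = u * w * (u - w) * (u + 3 * w) ∧
      y * w ^ 2 / n = n * t := by
    obtain ⟨t, rfl⟩ := h3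
    have hni : (n : ℤ) ≠ 0 := by exact_mod_cast hn0
    have : t ^ 2 * n = u * w * (u - w) * (u + 3 * w) :=
      mul_left_cancel₀ hni (by linear_combination -hZ)
    rcases h4 with h4 | h4
    · exact ⟨t, this, by rw [h4]; push_cast; ring⟩
    · exact ⟨-t, by rw [← this]; ring, by rw [h4]; push_cast; ring⟩
  have hyy : y = n ^ 2 * t / w ^ 2 := by field_simp at hyt ⊢; linear_combination hyt
  have ht0 : t ≠ 0 := by
    rintro rfl
    exact hy (by rw [hyy]; simp)
  have hr : IsIntRep n u w t :=
    ⟨Rat.isCoprime_num_den X, hw0, by rw [← ht]; ring, ht0⟩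
  refine ⟨t, hr, ?_⟩
  unfold IsIntRep.point
  congr 1
  · rw [hx]; push_cast; rfl
  · rw [hyy]; push_cast; rfl

/-! ### Sign, valuation and residue characters. -/

/-- The sign of an integer. -/
def signChar (m : ℤ) : ZMod 2 := if m < 0 then 1 else 0

/-- The parity of the `p`-adic valuation of an integer. -/
def valChar (p : ℕ) (m : ℤ) : ZMod 2 := (padicValInt p m : ZMod 2)

/-- The quadratic residue symbol, written additively. -/
def legBit (p : ℕ) [Fact p.Prime] (a : ℤ) : ZMod 2 := if legendreSym p a = 1 then 0 else 1

/-- The quadratic residue symbol of the prime-to-`p` part, with prescribed value `ε` at `p`. -/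
def locChar (p : ℕ) [Fact p.Prime] (ε : ZMod 2) (m : ℤ) : ZMod 2 :=
  legBit p (m / p ^ padicValInt p m) + ε * valChar p m

theorem isMulChar_signChar : IsMulChar signChar := by
  intro a b ha hb
  rcases ha.lt_or_gt with ha | ha <;> rcases hb.lt_or_gt with hb | hb
  · simp [signChar, ha, hb, (mul_pos_of_neg_of_neg ha hb).not_gt, CharTwo.add_self_eq_zero]
  · simp [signChar, ha, hb.not_gt, mul_neg_of_neg_of_pos ha hb]
  · simp [signChar, ha.not_gt, hb, mul_neg_of_pos_of_neg ha hb]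
  · simp [signChar, ha.not_gt, hb.not_gt, (mul_pos ha hb).not_gt]

theorem valChar_of_not_dvd (p : ℕ) {m : ℤ} (h : ¬(p : ℤ) ∣ m) : valChar p m = 0 := by
  simp [valChar, padicValInt.eq_zero_of_not_dvd h]

section local_

variable (p : ℕ) [hp : Fact p.Prime]

theorem isMulChar_valChar : IsMulChar (valChar p) := by
  intro a b ha hb
  simp [valChar, padicValInt.mul ha hb]

theorem cast_ne_zero_of_not_dvd {a : ℤ} (ha : ¬(p : ℤ) ∣ a) : (a : ZMod p) ≠ 0 := by
  rwa [Ne, ZMod.intCast_zmod_eq_zero_iff_dvd]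

theorem legBit_mul {a b : ℤ} (ha : ¬(p : ℤ) ∣ a) (hb : ¬(p : ℤ) ∣ b) :
    legBit p (a * b) = legBit p a + legBit p b := by
  simp only [legBit, legendreSym.mul]
  rcases legendreSym.eq_one_or_neg_one p (cast_ne_zero_of_not_dvd p ha) with h | h <;>
  rcases legendreSym.eq_one_or_neg_one p (cast_ne_zero_of_not_dvd p hb) with h' | h' <;>
  simp [h, h', CharTwo.add_self_eq_zero]

theorem unit_spec {m : ℤ} (hm : m ≠ 0) :
    m = p ^ padicValInt p m * (m / p ^ padicValInt p m) ∧ ¬(p : ℤ) ∣ m / p ^ padicValInt p m := by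
  have h := (Int.mul_ediv_cancel' (padicValInt_dvd (p := p) m)).symm
  refine ⟨h, fun ⟨c, hc⟩ => ?_⟩
  have h2 : (p : ℤ) ^ (padicValInt p m + 1) ∣ m := ⟨c, by
    conv_lhs => rw [h, hc]
    ring⟩
  rw [padicValInt_dvd_iff] at h2
  rcases h2 with h2 | h2
  · exact hm h2
  · omega

theorem isMulChar_locChar (ε : ZMod 2) : IsMulChar (locChar p ε) := by
  intro a b ha hb
  obtain ⟨ha1, ha2⟩ := unit_spec p ha
  obtain ⟨hb1, hb2⟩ := unit_spec p hb
  have h : a * b / p ^ padicValInt p (a * b) =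
      (a / p ^ padicValInt p a) * (b / p ^ padicValInt p b) := by
    have hp0 : (p : ℤ) ≠ 0 := by exact_mod_cast hp.out.ne_zero
    refine Int.ediv_eq_of_eq_mul_right (pow_ne_zero _ hp0) ?_
    conv_lhs => rw [ha1, hb1]
    rw [padicValInt.mul ha hb, pow_add]
    ring
  simp only [locChar, h, legBit_mul p ha2 hb2, isMulChar_valChar p a b ha hb]
  ring

theorem locChar_of_not_dvd (ε : ZMod 2) {m : ℤ} (h : ¬(p : ℤ) ∣ m) :
    locChar p ε m = legBit p m := by
  simp [locChar, valChar, padicValInt.eq_zero_of_not_dvd h]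

theorem valChar_self : valChar p p = 1 := by
  simp [valChar]

theorem locChar_eq (ε : ZMod 2) (m : ℤ) : locChar p ε m = locChar p 0 m + ε * valChar p m := by
  simp [locChar]

theorem legBit_congr {a b : ℤ} (h : (p : ℤ) ∣ a - b) : legBit p a = legBit p b := by
  have : (a : ZMod p) = b := by
    rw [← sub_eq_zero, ← Int.cast_sub, ZMod.intCast_zmod_eq_zero_iff_dvd]; exact h
  simp [legBit, legendreSym, this]

theorem locChar_congr (ε : ZMod 2) {a b : ℤ} (ha : ¬(p : ℤ) ∣ a) (h : (p : ℤ) ∣ a - b) :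
    locChar p ε a = locChar p ε b := by
  have hb : ¬(p : ℤ) ∣ b := fun hb => ha (by simpa using dvd_add h hb)
  rw [locChar_of_not_dvd p ε ha, locChar_of_not_dvd p ε hb, legBit_congr p h]

theorem locChar_self : locChar p 0 p = 0 := by
  have : (p : ℤ) / (p : ℤ) = 1 := Int.ediv_self (by exact_mod_cast hp.out.ne_zero)
  simp [locChar, this, legBit]

end local_

/-! ### Local conditions on the square classes of a point. -/

namespace IsIntRep

variable {u w z : ℤ}

theorem char_sum (hn : n ≠ 0) (h : IsIntRep n u w z) {f : ℤ → ZMod 2} (hf : IsMulChar f) :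
    f n = f u + f w + f (u - w) + f (u + 3 * w) := by
  have hn' : (n : ℤ) ≠ 0 := by exact_mod_cast hn
  have h1 := h.ne_u hn
  have h2 := h.ne_w
  have h3 := h.ne_sub hn
  have h4 := h.ne_add hn
  have := congrArg f h.eq
  rwa [hf _ _ hn' (pow_ne_zero 2 h.ne), hf.sq h.ne, add_zero,
    hf _ _ (mul_ne_zero (mul_ne_zero h1 h2) h3) h4, hf _ _ (mul_ne_zero h1 h2) h3,
    hf _ _ h1 h2] at this

theorem char_zero (hn : n ≠ 0) (h : IsIntRep n u w z) {f : ℤ → ZMod 2} (hf : IsMulChar f) :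
    f (n * u * w) = f n + f u + f w := by
  have hn' : (n : ℤ) ≠ 0 := by exact_mod_cast hn
  rw [hf _ _ (mul_ne_zero hn' (h.ne_u hn)) h.ne_w, hf _ _ hn' (h.ne_u hn)]

theorem char_self (hn : n ≠ 0) (h : IsIntRep n u w z) {f : ℤ → ZMod 2} (hf : IsMulChar f) :
    f (n * (u - w) * w) = f n + f (u - w) + f w := by
  have hn' : (n : ℤ) ≠ 0 := by exact_mod_cast hn
  rw [hf _ _ (mul_ne_zero hn' (h.ne_sub hn)) h.ne_w, hf _ _ hn' (h.ne_sub hn)]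

/-- The cubic is positive only on (−3n, 0) and (n, ∞), and on each of these x and x − n have the
same sign. -/
theorem signChar_eq (hn : n ≠ 0) (h : IsIntRep n u w z) :
    signChar (n * u * w) = signChar (n * (u - w) * w) := by
  rw [h.char_zero hn isMulChar_signChar, h.char_self hn isMulChar_signChar]
  have hw := h.pos
  have hpos : 0 < u * w * (u - w) * (u + 3 * w) := by
    rw [← h.eq]
    have := h.ne
    positivity
  have : u < 0 ↔ u - w < 0 := by
    constructor
    · intro hu; omega
    · intro hu
      by_contra hu'
      have h1 : 0 ≤ u * w := by nlinarith
      have h2 : 0 < u + 3 * w := by omega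
      nlinarith [mul_nonneg h1 (by linarith : (0 : ℤ) ≤ -(u - w)),
        mul_nonneg (mul_nonneg h1 (by linarith : (0 : ℤ) ≤ -(u - w))) h2.le]
  simp [signChar, this]

section local_

variable (p : ℕ) [hp : Fact p.Prime]

theorem not_dvd_of_coprime (h : IsIntRep n u w z) (hu : (p : ℤ) ∣ u) : ¬(p : ℤ) ∣ w := by
  intro hw
  have := (h.coprime.isUnit_of_dvd' hu hw)
  exact (Nat.prime_iff_prime_int.mp hp.out).not_isUnit this

theorem not_dvd_natCast {q : ℕ} (hq : q.Prime) (h : p ≠ q) : ¬(p : ℤ) ∣ (q : ℤ) := by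
  rw [Int.natCast_dvd_natCast]
  exact fun hd => h ((Nat.prime_dvd_prime_iff_eq hp.out hq).mp hd)

/-- For a prime `p ≥ 5`, at most one of the four factors is divisible by `p`. -/
theorem dvd_cases (h : IsIntRep n u w z) (h2 : p ≠ 2) (h3 : p ≠ 3) :
    ((p : ℤ) ∣ u ∧ ¬(p : ℤ) ∣ w ∧ ¬(p : ℤ) ∣ u - w ∧ ¬(p : ℤ) ∣ u + 3 * w) ∨
    (¬(p : ℤ) ∣ u ∧ (p : ℤ) ∣ w ∧ ¬(p : ℤ) ∣ u - w ∧ ¬(p : ℤ) ∣ u + 3 * w) ∨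
    (¬(p : ℤ) ∣ u ∧ ¬(p : ℤ) ∣ w ∧ (p : ℤ) ∣ u - w ∧ ¬(p : ℤ) ∣ u + 3 * w) ∨
    (¬(p : ℤ) ∣ u ∧ ¬(p : ℤ) ∣ w ∧ ¬(p : ℤ) ∣ u - w ∧ (p : ℤ) ∣ u + 3 * w) ∨
    (¬(p : ℤ) ∣ u ∧ ¬(p : ℤ) ∣ w ∧ ¬(p : ℤ) ∣ u - w ∧ ¬(p : ℤ) ∣ u + 3 * w) := by
  have hpr := Nat.prime_iff_prime_int.mp hp.out
  have k2 : ¬(p : ℤ) ∣ 2 := by exact_mod_cast not_dvd_natCast p Nat.prime_two h2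
  have k3 : ¬(p : ℤ) ∣ 3 := by exact_mod_cast not_dvd_natCast p Nat.prime_three h3
  have k4 : ∀ {a : ℤ}, (p : ℤ) ∣ 3 * a → (p : ℤ) ∣ a := fun h => (hpr.dvd_or_dvd h).resolve_left k3
  have k5 : ∀ {a : ℤ}, (p : ℤ) ∣ 2 * a → (p : ℤ) ∣ a := fun h => (hpr.dvd_or_dvd h).resolve_left k2
  have huw := h.not_dvd_of_coprime p
  by_cases d1 : (p : ℤ) ∣ u
  · have hw := huw d1
    refine .inl ⟨d1, hw, fun hd => hw ?_, fun hd => hw (k4 ?_)⟩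
    · simpa using dvd_sub d1 hd
    · simpa using dvd_sub hd d1
  · by_cases d2 : (p : ℤ) ∣ w
    · refine .inr (.inl ⟨d1, d2, fun hd => d1 ?_, fun hd => d1 ?_⟩)
      · simpa using dvd_add hd d2
      · simpa using dvd_sub hd (d2.mul_left 3)
    · by_cases d3 : (p : ℤ) ∣ u - w
      · refine .inr (.inr (.inl ⟨d1, d2, d3, fun hd => d2 (k5 (k5 ?_))⟩))
        have := dvd_sub hd d3
        ring_nf at this ⊢
        exact this
      · by_cases d4 : (p : ℤ) ∣ u + 3 * w
        · exact .inr (.inr (.inr (.inl ⟨d1, d2, d3, d4⟩)))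
        · exact .inr (.inr (.inr (.inr ⟨d1, d2, d3, d4⟩)))

/-- At most one factor is divisible by p, and the four valuations have even sum, so each is even. -/
theorem valChar_good (hn : n ≠ 0) (h : IsIntRep n u w z) (h2 : p ≠ 2) (h3 : p ≠ 3)
    (hpn : ¬p ∣ n) : valChar p u = 0 ∧ valChar p w = 0 ∧ valChar p (u - w) = 0 ∧
      valChar p (u + 3 * w) = 0 := by
  have hs := h.char_sum hn (isMulChar_valChar p)
  have hpn' : ¬(p : ℤ) ∣ n := by rwa [Int.natCast_dvd_natCast]
  have hv : ∀ m : ℤ, ¬(p : ℤ) ∣ m → valChar p m = 0 := fun m => valChar_of_not_dvd p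
  have hvn := hv _ hpn'
  rcases h.dvd_cases p h2 h3 with ⟨d1, d2, d3, d4⟩ | ⟨d1, d2, d3, d4⟩ | ⟨d1, d2, d3, d4⟩ |
    ⟨d1, d2, d3, d4⟩ | ⟨d1, d2, d3, d4⟩ <;> grind

/-- Both functionals are built to vanish on the classes (−3, −n) and (n, 1) of (0,0) and (n,0).
Since n has odd valuation, p divides exactly one of the four factors. Modulo p the other three are
proportional with ratios among ±1, −3 and 4, and the residue symbol of the remaining one is
recovered from n z² = u w (u − w)(u + 3w). -/
theorem locChar_bad (hn : n ≠ 0) (h : IsIntRep n u w z) (h2 : p ≠ 2) (h3 : p ≠ 3)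
    (hv : valChar p n = 1) :
    locChar p (locChar p 0 n) (n * u * w) + legBit p (-3) * valChar p (n * (u - w) * w) = 0 ∧
    locChar p (legBit p (-1) + locChar p 0 n) (n * (u - w) * w) = 0 := by
  have hpr := Nat.prime_iff_prime_int.mp hp.out
  have k2 : ¬(p : ℤ) ∣ 2 := by exact_mod_cast not_dvd_natCast p Nat.prime_two h2
  have k3 : ¬(p : ℤ) ∣ 3 := by exact_mod_cast not_dvd_natCast p Nat.prime_three h3
  have kk : ¬(p : ℤ) ∣ -1 := by rw [dvd_neg]; exact fun h => hpr.not_isUnit (isUnit_of_dvd_one h)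
  have kk3 : ¬(p : ℤ) ∣ -3 := by rwa [dvd_neg]
  have s0 := h.char_sum hn (isMulChar_valChar p)
  have s1 := h.char_sum hn (isMulChar_locChar p 0)
  have v0 : ∀ m : ℤ, ¬(p : ℤ) ∣ m → valChar p m = 0 := fun m => valChar_of_not_dvd p
  have hc : ∀ a b : ℤ, ¬(p : ℤ) ∣ a → (p : ℤ) ∣ a - b → locChar p 0 a = locChar p 0 b :=
    fun a b => locChar_congr p 0
  have hm : ∀ {a b : ℤ}, ¬(p : ℤ) ∣ a → ¬(p : ℤ) ∣ b →
      locChar p 0 (a * b) = locChar p 0 a + locChar p 0 b := fun {a b} ha hb =>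
    isMulChar_locChar p 0 a b (fun h => ha (by simp [h])) (fun h => hb (by simp [h]))
  rw [locChar_eq p (locChar p 0 n), locChar_eq p (_ + _), ← locChar_of_not_dvd p 0 kk3,
    ← locChar_of_not_dvd p 0 kk]
  rw [h.char_zero hn (isMulChar_locChar p 0), h.char_zero hn (isMulChar_valChar p),
    h.char_self hn (isMulChar_locChar p 0), h.char_self hn (isMulChar_valChar p), hv]
  rcases h.dvd_cases p h2 h3 with ⟨d1, d2, d3, d4⟩ | ⟨d1, d2, d3, d4⟩ | ⟨d1, d2, d3, d4⟩ |
    ⟨d1, d2, d3, d4⟩ | ⟨d1, d2, d3, d4⟩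
  · have e1 := hc (u - w) (-1 * w) d3 (by simpa using d1)
    have e2 := hc (u + 3 * w) (-1 * (-3 * w)) d4 (by simpa using d1)
    have kw : ¬(p : ℤ) ∣ -3 * w := fun hd => (hpr.dvd_or_dvd hd).elim kk3 d2
    rw [hm kk d2] at e1
    rw [hm kk kw, hm kk3 d2] at e2
    rw [e1, e2] at s1
    rw [v0 _ d2, v0 _ d3, v0 _ d4, hv] at s0
    rw [v0 _ d2, v0 _ d3, e1]
    grind
  · have e1 := hc (u - w) u d3 (by simpa using d2)
    have e2 := hc (u + 3 * w) u d4 (by simpa using d2.mul_left 3)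
    rw [e1, e2] at s1
    rw [v0 _ d1, v0 _ d3, v0 _ d4, hv] at s0
    rw [v0 _ d1, v0 _ d3, e1]
    grind
  · have e1 := hc u w d1 d3
    have e2 := hc (u + 3 * w) (2 * (2 * w)) d4 (by
      have : u + 3 * w - 2 * (2 * w) = u - w := by ring
      rwa [this])
    have kw : ¬(p : ℤ) ∣ 2 * w := fun hd => (hpr.dvd_or_dvd hd).elim k2 d2
    rw [hm k2 kw, hm k2 d2] at e2
    rw [e1, e2] at s1
    rw [v0 _ d1, v0 _ d2, v0 _ d4, hv] at s0
    rw [v0 _ d1, v0 _ d2, e1]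
    grind
  · have e1 := hc u (-3 * w) d1 (by
      have : u - -3 * w = u + 3 * w := by ring
      rwa [this])
    have e2 := hc (u - w) (-1 * (2 * (2 * w))) d3 (by
      have : u - w - -1 * (2 * (2 * w)) = u + 3 * w := by ring
      rwa [this])
    have kw : ¬(p : ℤ) ∣ 2 * w := fun hd => (hpr.dvd_or_dvd hd).elim k2 d2
    have kw2 : ¬(p : ℤ) ∣ 2 * (2 * w) := fun hd => (hpr.dvd_or_dvd hd).elim k2 kw
    rw [hm kk kw2, hm k2 kw, hm k2 d2] at e2
    rw [hm kk3 d2] at e1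
    rw [e1, e2] at s1
    rw [v0 _ d1, v0 _ d2, v0 _ d3, hv] at s0
    rw [v0 _ d1, v0 _ d2, v0 _ d3, e1, e2]
    grind
  · rw [v0 _ d1, v0 _ d2, v0 _ d3, v0 _ d4, hv] at s0
    exact absurd s0 (by decide)

end local_

/-- When u or w is even, the other three factors are odd, so its valuation carries the whole even
sum. -/
theorem valChar_two (hn : n ≠ 0) (h : IsIntRep n u w z) (hodd : ¬2 ∣ n) :
    valChar 2 (n * u * w) = 0 := by
  have : Fact (Nat.Prime 2) := ⟨Nat.prime_two⟩
  have s0 := h.char_sum hn (isMulChar_valChar 2)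
  have hv : ∀ m : ℤ, ¬(2 : ℤ) ∣ m → valChar 2 m = 0 := fun m => valChar_of_not_dvd 2
  have hvn := hv n (by omega)
  rw [h.char_zero hn (isMulChar_valChar 2), hvn]
  have hc := h.not_dvd_of_coprime 2
  push_cast at hc
  by_cases d1 : (2 : ℤ) ∣ u
  · rw [hv w (hc d1), hv (u - w) (by have := hc d1; omega),
      hv (u + 3 * w) (by have := hc d1; omega), hvn] at s0
    rw [hv w (hc d1)]
    grind
  · by_cases d2 : (2 : ℤ) ∣ w
    · rw [hv u d1, hv (u - w) (by omega), hv (u + 3 * w) (by omega), hvn] at s0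
      rw [hv u d1]
      grind
    · rw [hv u d1, hv w d2]
      simp

theorem valChar_three (hn : n ≠ 0) (h : IsIntRep n u w z) (h3 : ¬3 ∣ n) :
    valChar 3 (n * (u - w) * w) = 0 := by
  have : Fact (Nat.Prime 3) := ⟨Nat.prime_three⟩
  have s0 := h.char_sum hn (isMulChar_valChar 3)
  have hv : ∀ m : ℤ, ¬(3 : ℤ) ∣ m → valChar 3 m = 0 := fun m => valChar_of_not_dvd 3
  have hvn := hv n (by omega)
  rw [h.char_self hn (isMulChar_valChar 3), hvn]
  have hc := h.not_dvd_of_coprime 3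
  push_cast at hc
  by_cases d1 : (3 : ℤ) ∣ w
  · have d2 : ¬(3 : ℤ) ∣ u := fun hd => hc hd d1
    rw [hv u d2, hv (u - w) (by omega), hv (u + 3 * w) (by omega), hvn] at s0
    rw [hv (u - w) (by omega)]
    grind
  · by_cases d2 : (3 : ℤ) ∣ u - w
    · rw [hv u (by omega), hv w d1, hv (u + 3 * w) (by omega), hvn] at s0
      rw [hv w d1]
      grind
    · rw [hv w d1, hv _ d2]
      simp

/-- An additional condition at 3, coupling the valuation of one class with the residue of the other;
both terms are nonzero precisely when 3 divides u. -/
theorem locChar_three [Fact (Nat.Prime 3)] (hn : n ≠ 0) (h : IsIntRep n u w z) (h3 : n % 3 = 1) :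
    valChar 3 (n * u * w) + locChar 3 0 (n * (u - w) * w) = 0 := by
  have s0 := h.char_sum hn (isMulChar_valChar 3)
  have s1 := h.char_sum hn (isMulChar_locChar 3 0)
  have hv : ∀ m : ℤ, ¬(3 : ℤ) ∣ m → valChar 3 m = 0 := fun m => valChar_of_not_dvd 3
  have hcg : ∀ a b : ℤ, ¬(3 : ℤ) ∣ a → (3 : ℤ) ∣ a - b → locChar 3 0 a = locChar 3 0 b :=
    fun a b => locChar_congr 3 0
  have hvn := hv n (by omega)
  have hn1 : locChar 3 0 (n : ℤ) = 0 := by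
    rw [hcg n 1 (by omega) (by omega), (isMulChar_locChar 3 0).one]
  have hneg : locChar 3 0 (-1 : ℤ) = 1 := by
    rw [locChar_of_not_dvd 3 0 (by norm_num), legBit]
    norm_num
  have hm : ∀ {a b : ℤ}, a ≠ 0 → b ≠ 0 →
      locChar 3 0 (a * b) = locChar 3 0 a + locChar 3 0 b := fun {a b} => isMulChar_locChar 3 0 a b
  have hw0 := h.ne_w
  rw [h.char_zero hn (isMulChar_valChar 3), h.char_self hn (isMulChar_locChar 3 0), hvn, hn1]
  have hc := h.not_dvd_of_coprime 3
  push_cast at hc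
  by_cases d1 : (3 : ℤ) ∣ w
  · have d2 : ¬(3 : ℤ) ∣ u := fun hd => hc hd d1
    rw [hv u d2, hv (u - w) (by omega), hv (u + 3 * w) (by omega), hvn] at s0
    rw [hcg (u - w) u (by omega) (by omega), hcg (u + 3 * w) u (by omega) (by omega), hn1] at s1
    rw [hv u d2, hcg (u - w) u (by omega) (by omega)]
    grind
  · by_cases d2 : (3 : ℤ) ∣ u - w
    · rw [hcg u w (by omega) (by omega), hcg (u + 3 * w) w (by omega) (by omega), hn1] at s1
      rw [hv u (by omega), hv w d1]
      grind
    · by_cases d3 : (3 : ℤ) ∣ u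
      -- Here (u − w)w is minus a square modulo 3, so u must have odd valuation. If 9 ∣ u, then u +
      -- 3w has valuation exactly one and parity gives this; otherwise u itself has valuation one.
      · rw [hcg (u - w) (-1 * w) d2 (by omega), hm (by norm_num) hw0, hneg, hv w d1]
        obtain ⟨a, rfl⟩ := d3
        have ha0 : a ≠ 0 := by
          have := h.ne_u hn
          rintro rfl
          simp at this
        have h33 : valChar 3 (3 : ℤ) = 1 := by exact_mod_cast valChar_self 3
        have e0 : valChar 3 (3 * a) = 1 + valChar 3 a := by
          rw [isMulChar_valChar 3 3 a (by norm_num) ha0, h33]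
        by_cases d4 : (3 : ℤ) ∣ a
        · have e1 : valChar 3 (3 * a + 3 * w) = 1 := by
            rw [← mul_add, isMulChar_valChar 3 3 (a + w) (by norm_num)
              (fun h0 => d1 (by omega)), h33, hv (a + w) (by omega)]
            simp
          rw [hv w d1, hv _ d2, e1, hvn] at s0
          grind
        · rw [e0, hv a d4]
          grind
      · rw [hv u d3, hv w d1, hcg (u - w) w d2 (by
          have k1 : u % 3 = 1 ∨ u % 3 = 2 := by omega
          have k2 : w % 3 = 1 ∨ w % 3 = 2 := by omega
          rcases k1 with k1 | k1 <;> rcases k2 with k2 | k2 <;> omega)]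
        grind

end IsIntRep

/-! ### Square classes supported on a finite set of primes. -/

theorem isSquare_of_valChar {m : ℤ} (hm : 0 < m) (h : ∀ p : ℕ, p.Prime → valChar p m = 0) :
    IsSquare m := by
  lift m to ℕ using hm.le
  have hm' : m ≠ 0 := by rintro rfl; simp at hm
  obtain ⟨a, b, hab, ha⟩ := Nat.sq_mul_squarefree m
  have hb0 : b ≠ 0 := by rintro rfl; simp at hab; exact hm' hab.symm
  have ha1 : a = 1 := by
    by_contra ha1
    obtain ⟨p, hp, hpa⟩ := Nat.exists_prime_and_dvd ha1
    have : Fact p.Prime := ⟨hp⟩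
    obtain ⟨c, rfl⟩ := hpa
    have hc0 : c ≠ 0 := by rintro rfl; simp at ha
    have hpc : ¬p ∣ c := fun ⟨d, hd⟩ => by
      subst hd
      exact hp.one_lt.ne' (Nat.isUnit_iff.mp (ha p ⟨d, by ring⟩))
    have hc : valChar p c = 0 := valChar_of_not_dvd p (by rwa [Int.natCast_dvd_natCast])
    have h1 := h p hp
    have hp0 : (p : ℤ) ≠ 0 := by exact_mod_cast hp.ne_zero
    have hb0' : (b : ℤ) ≠ 0 := by exact_mod_cast hb0
    have hc0' : (c : ℤ) ≠ 0 := by exact_mod_cast hc0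
    rw [← hab] at h1
    push_cast at h1
    rw [isMulChar_valChar p _ _ (pow_ne_zero 2 hb0') (mul_ne_zero hp0 hc0'),
      (isMulChar_valChar p).sq hb0', isMulChar_valChar p _ _ hp0 hc0', hc, valChar_self] at h1
    exact absurd h1 (by decide)
  subst ha1
  exact ⟨b, by rw [← hab]; push_cast; ring⟩

open Classical in
/-- The character attached to a prime, or to the sign for an index that is not prime. -/
noncomputable def bitChar (g : ℕ) : ℤ → ZMod 2 := if g.Prime then valChar g else signChar

/-- The integer attached to an index: `-1` for `0`. -/
def genInt (g : ℕ) : ℤ := if g = 0 then -1 else g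

theorem bitChar_prime {p : ℕ} (hp : p.Prime) : bitChar p = valChar p := if_pos hp

theorem bitChar_zero : bitChar 0 = signChar := if_neg Nat.not_prime_zero

theorem isMulChar_bitChar (g : ℕ) : IsMulChar (bitChar g) := by
  unfold bitChar
  split_ifs with h
  · have : Fact g.Prime := ⟨h⟩
    exact isMulChar_valChar g
  · exact isMulChar_signChar

theorem genInt_ne_zero (g : ℕ) : genInt g ≠ 0 := by
  unfold genInt; split_ifs with h
  · norm_num
  · exact_mod_cast h

theorem bitChar_genInt {a b : ℕ} (ha : a = 0 ∨ a.Prime) (hb : b = 0 ∨ b.Prime) :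
    bitChar a (genInt b) = if a = b then 1 else 0 := by
  rcases ha with rfl | ha
  · rw [bitChar_zero]
    rcases hb with rfl | hb
    · simp [genInt, signChar]
    · have h0 : ¬((b : ℤ) < 0) := by omega
      simp [genInt, signChar, hb.ne_zero, hb.ne_zero.symm, h0]
  · rw [bitChar_prime ha]
    rcases hb with rfl | hb
    · rw [if_neg ha.ne_zero]
      exact valChar_of_not_dvd a (by
        simp only [genInt, if_true, dvd_neg]
        exact fun h => (Nat.prime_iff_prime_int.mp ha).not_isUnit (isUnit_of_dvd_one h))
    · simp only [genInt, if_neg hb.ne_zero]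
      have : Fact a.Prime := ⟨ha⟩
      split_ifs with h
      · subst h; exact valChar_self a
      · exact valChar_of_not_dvd a (IsIntRep.not_dvd_natCast a hb h)

/-- Every character is determined by its values at `-1` and at the primes. -/
theorem char_expand {f : ℤ → ZMod 2} (hf : IsMulChar f) (ps : List ℕ) (hps : ∀ p ∈ ps, p.Prime)
    (hnd : ps.Nodup) {m : ℤ} (hm : m ≠ 0)
    (h : ∀ q : ℕ, q.Prime → q ∉ ps → valChar q m = 0) :
    f m = ((0 :: ps).map fun g => f (genInt g) * bitChar g m).sum := by
  induction ps generalizing m with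
  | nil =>
    simp only [List.map_cons, List.map_nil, List.sum_cons, List.sum_nil, add_zero, bitChar_zero]
    rcases hm.lt_or_gt with hneg | hpos
    · have hsq : IsSquare (-m) := isSquare_of_valChar (by omega) fun p hp => by
        have : Fact p.Prime := ⟨hp⟩
        have := h p hp (by simp)
        rw [← neg_one_mul, isMulChar_valChar p _ _ (by norm_num) hm, this, add_zero]
        exact valChar_of_not_dvd p (by
          rw [dvd_neg]
          exact fun h => (Nat.prime_iff_prime_int.mp hp).not_isUnit (isUnit_of_dvd_one h))
      obtain ⟨r, hr⟩ := hsq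
      have hr0 : r ≠ 0 := by rintro rfl; simp at hr; exact hm hr
      have : m = -1 * (r * r) := by linarith
      have hf' : f m = f (-1) := by
        rw [this, hf _ _ (by norm_num) (mul_ne_zero hr0 hr0), hf.mul_self hr0, add_zero]
      rw [hf']
      simp [genInt, signChar, hneg]
    · obtain ⟨r, rfl⟩ := isSquare_of_valChar hpos fun p hp => h p hp (by simp)
      have hr0 : r ≠ 0 := by rintro rfl; simp at hm
      rw [hf.mul_self hr0]
      have : signChar (r * r) = 0 := by
        rw [isMulChar_signChar.mul_self hr0]
      rw [this, mul_zero]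
  | cons p ps ih =>
    have hp : p.Prime := hps p (by simp)
    have : Fact p.Prime := ⟨hp⟩
    have hps' : ∀ q ∈ ps, q.Prime := fun q hq => hps q (by simp [hq])
    obtain ⟨hp1, hnd'⟩ := List.nodup_cons.mp hnd
    have hp0 : (p : ℤ) ≠ 0 := by exact_mod_cast hp.ne_zero
    have hgp : genInt p = p := by simp [genInt, hp.ne_zero]
    by_cases hv : valChar p m = 0
    · rw [ih hps' hnd' hm fun q hq hq' => by
        by_cases hqp : q = p
        · rw [hqp, hv]
        · exact h q hq (by simp [hqp, hq'])]
      simp [bitChar_prime hp, hv]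
    · have hv1 : valChar p m = 1 := by
        generalize valChar p m = t at hv
        revert t; decide
      have hmp := mul_ne_zero hm hp0
      -- Multiplying m by p makes its p-valuation even, so the induction hypothesis for the shorter
      -- list applies.
      have key := ih hps' hnd' hmp fun q hq hq' => by
        have : Fact q.Prime := ⟨hq⟩
        rw [isMulChar_valChar q _ _ hm hp0]
        by_cases hqp : q = p
        · subst hqp
          rw [hv1, valChar_self]; decide
        · rw [h q hq (by simp [hqp, hq']), valChar_of_not_dvd q (IsIntRep.not_dvd_natCast q hp hqp),
            add_zero]
      have hcongr : ((0 :: ps).map fun g => f (genInt g) * bitChar g (m * p)).sum =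
          ((0 :: ps).map fun g => f (genInt g) * bitChar g m).sum := by
        congr 1
        refine List.map_congr_left fun g hg => ?_
        have hg' : g = 0 ∨ g.Prime := by
          rcases List.mem_cons.mp hg with rfl | hg
          · exact .inl rfl
          · exact .inr (hps' g hg)
        have hgp' : g ≠ p := by
          rintro rfl
          rcases List.mem_cons.mp hg with h | h
          · exact hp.ne_zero h
          · exact hp1 h
        rw [isMulChar_bitChar g _ _ hm hp0, ← hgp, bitChar_genInt hg' (.inr hp), if_neg hgp',
          add_zero]
      rw [hcongr, hf _ _ hm hp0] at key
      simp only [List.map_cons, List.sum_cons, bitChar_prime hp, hv1, hgp, mul_one] at key ⊢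
      grind

theorem sum_indicator (S : List ℕ) (hS : S.Nodup) {a : ℕ} (ha : a ∈ S) (F : ℕ → ZMod 2) :
    (S.map fun g => (if g = a then 1 else 0) * F g).sum = F a := by
  have h := List.sum_map_ite_eq S F (fun _ => 0) a
  simp only [List.count_eq_one_of_mem hS ha, sub_zero, one_smul, List.map_const', List.sum_replicate,
    smul_zero, add_zero] at h
  rw [← h]
  congr 1
  refine List.map_congr_left fun g _ => ?_
  split_ifs <;> simp

/-! ### Linear algebra over 𝔽₂ on binary digits. -/

/-- The embedding of the Booleans into `ZMod 2`. -/
def boolBit (b : Bool) : ZMod 2 := if b then 1 else 0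

/-- The vector over `ZMod 2` given by the binary digits of a natural number. -/
def digit (N b : ℕ) : ZMod 2 := boolBit (N.testBit b)

theorem boolBit_xor (a b : Bool) : boolBit (a ^^ b) = boolBit a + boolBit b := by
  revert a b; decide

theorem digit_xor (M N b : ℕ) : digit (M ^^^ N) b = digit M b + digit N b := by
  rw [digit, Nat.testBit_xor, boolBit_xor]; rfl

theorem digit_two_pow (a b : ℕ) : digit (2 ^ a) b = if a = b then 1 else 0 := by
  simp [digit, boolBit, Nat.testBit_two_pow]

/-- The sum of the vectors in a list that are selected by a predicate. -/
def xorSelect {α : Type} (f : α → Bool) (l : List (α × ℕ)) : ℕ :=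
  l.foldr (fun c acc => if f c.1 then c.2 ^^^ acc else acc) 0

theorem digit_xorSelect {α : Type} (f : α → Bool) (l : List (α × ℕ)) (b : ℕ) :
    digit (xorSelect f l) b = (l.map fun c => boolBit (f c.1) * digit c.2 b).sum := by
  induction l with
  | nil => simp [xorSelect, digit, boolBit]
  | cons c l ih =>
    simp only [List.map_cons, List.sum_cons, ← ih]
    simp only [xorSelect, List.foldr_cons]
    split_ifs with h
    · rw [digit_xor, h]; simp [boolBit]
    · simp [boolBit, h]

/-- Fixes the encoding: digit 2k + i belongs to the k-th index and to the i-th descent map. -/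
theorem sum_range_two_mul_length {M : Type*} [AddCommMonoid M] (S : List ℕ) (F : ℕ → Bool → M) :
    ∑ b ∈ Finset.range (2 * S.length), F (S.getD (b / 2) 0) (b % 2 == 1) =
      (S.map fun g => F g false + F g true).sum := by
  induction S with
  | nil => simp
  | cons g S ih =>
    rw [List.length_cons, mul_add, mul_one, Finset.sum_range_succ', Finset.sum_range_succ']
    simp only [List.map_cons, List.sum_cons, ← ih]
    have h : ∀ b, (b + 1 + 1) / 2 = b / 2 + 1 := by omega
    have h' : ∀ b, (b + 1 + 1) % 2 = b % 2 := by omega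
    simp only [h, h', List.getD_cons_succ]
    simp
    rw [add_assoc, add_comm (F g true), add_comm]

/-- The Euler criterion as a computation. -/
def symBit (p a : ℕ) : Bool := a ^ (p / 2) % p != 1

/-- A natural number in the residue class modulo `p` of the integer attached to an index. -/
def residue (p g : ℕ) : ℕ := if g = 0 then p - 1 else g

theorem legBit_natCast (p : ℕ) [hp : Fact p.Prime] (h2 : p ≠ 2) {a : ℕ} (ha : ¬p ∣ a) :
    legBit p a = boolBit (symBit p a) := by
  have ha' : ¬(p : ℤ) ∣ a := by rwa [Int.natCast_dvd_natCast]
  have h2p : 2 < p := lt_of_le_of_ne hp.out.two_le h2.symm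
  have : Fact (2 < p) := ⟨h2p⟩
  have h1 := legendreSym.eq_pow p a
  have h3 : a ^ (p / 2) % p = 1 ↔ ((a : ZMod p) ^ (p / 2) = 1) := by
    have e : ((a ^ (p / 2) : ℕ) : ZMod p) = (a : ZMod p) ^ (p / 2) := by push_cast; rfl
    have e1 := ZMod.natCast_eq_natCast_iff' (a ^ (p / 2)) 1 p
    rw [Nat.mod_eq_of_lt hp.out.one_lt, Nat.cast_one, e] at e1
    exact e1.symm
  simp only [legBit, boolBit, symBit, bne_iff_ne, ne_eq]
  rcases legendreSym.eq_one_or_neg_one p (cast_ne_zero_of_not_dvd p ha') with h | h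
  · rw [h] at h1
    have : a ^ (p / 2) % p = 1 := h3.mpr (by simpa using h1.symm)
    simp [h, this]
  · rw [h] at h1
    have : ¬a ^ (p / 2) % p = 1 := fun h4 => by
      rw [h3] at h4
      push_cast at h1
      rw [h4] at h1
      exact ZMod.neg_one_ne_one h1
    simp [h, this]

theorem not_dvd_pred (p : ℕ) [hp : Fact p.Prime] : ¬p ∣ p - 1 := fun h => by
  have := hp.out.two_le
  exact absurd (Nat.le_of_dvd (by omega) h) (by omega)

theorem legBit_neg_one (p : ℕ) [hp : Fact p.Prime] (h2 : p ≠ 2) :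
    legBit p (-1) = boolBit (symBit p (p - 1)) := by
  rw [← legBit_natCast p h2 (not_dvd_pred p)]
  refine legBit_congr p ?_
  rw [Nat.cast_sub hp.out.one_le]
  exact ⟨-1, by push_cast; ring⟩

theorem legBit_genInt (p : ℕ) [hp : Fact p.Prime] (h2 : p ≠ 2) {g : ℕ} (hg : g = 0 ∨ g.Prime)
    (hgp : g ≠ p) : legBit p (genInt g) = boolBit (symBit p (residue p g)) := by
  by_cases h : g = 0
  · subst h
    exact legBit_neg_one p h2
  · have hg' := hg.resolve_left h
    simp only [genInt, residue, if_neg h]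
    exact legBit_natCast p h2 fun hd => hgp ((Nat.prime_dvd_prime_iff_eq hp.out hg').mp hd).symm

/-! ### The local conditions in computable form. -/

/-- The local conditions satisfied by the square classes of the two descent maps. -/
inductive LocalCondition where
  | sign
  | two
  | three
  | threeSplit
  | first (p : ℕ)
  | second (p : ℕ)

/-- The coefficient of a local condition at an index, for the first or the second descent map. -/
def LocalCondition.coeff (n : ℕ) : LocalCondition → ℕ → Bool → Bool
  | .sign, g, _ => g == 0
  | .two, g, i => !i && g == 2
  | .three, g, i => i && g == 3
  | .threeSplit, g, i => if i then g != 3 && symBit 3 (residue 3 g) else g == 3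
  -- The entry at g = p is the value that the characters of `locChar_bad` prescribe at p: the
  -- residue bit of n/p here, and that of −1 times n/p below. Elsewhere it is the residue bit of g,
  -- with p − 1 and p − 3 standing for −1 and −3.
  | .first p, g, i => if i then g == p && symBit p (p - 3)
      else symBit p (if g = p then n / p else residue p g)
  | .second p, g, i => i && if g = p then symBit p (p - 1) ^^ symBit p (n / p)
      else symBit p (residue p g)

/-- The numerical side conditions of a local condition. -/
def LocalCondition.valid (n : ℕ) (ps : List ℕ) : LocalCondition → Bool
  | .sign => true
  | .two => n % 2 == 1
  | .three => n % 3 != 0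
  | .threeSplit => n % 3 == 1
  | .first p => ps.contains p && 5 ≤ p && n % p == 0 && n / p % p != 0
  | .second p => ps.contains p && 5 ≤ p && n % p == 0 && n / p % p != 0

/-- A list of distinct primes containing `2`, `3` and the prime divisors of `n`. -/
structure IsBadPrimes (n : ℕ) (ps : List ℕ) : Prop where
  prime : ∀ p ∈ ps, p.Prime
  nodup : ps.Nodup
  two_mem : 2 ∈ ps
  three_mem : 3 ∈ ps
  dvd : n ∣ ps.prod

namespace IsBadPrimes

variable {ps : List ℕ}

theorem mem_of_dvd (h : IsBadPrimes n ps) {q : ℕ} (hq : q.Prime) (hd : q ∣ n) : q ∈ ps := by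
  obtain ⟨p, hp, hqp⟩ := (Prime.dvd_prod_iff hq.prime).mp (hd.trans h.dvd)
  rwa [(Nat.prime_dvd_prime_iff_eq hq (h.prime p hp)).mp hqp]

theorem squarefree (h : IsBadPrimes n ps) : Squarefree n := by
  refine Squarefree.squarefree_of_dvd h.dvd ?_
  have h1 := h.prime
  have h2 := h.nodup
  clear h
  induction ps with
  | nil => simp
  | cons p ps ih =>
    obtain ⟨hp, h2⟩ := List.nodup_cons.mp h2
    have hpp := h1 p (by simp)
    rw [List.prod_cons, Nat.squarefree_mul]
    · exact ⟨hpp.prime.squarefree, ih (fun q hq => h1 q (by simp [hq])) h2⟩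
    · rw [hpp.coprime_iff_not_dvd]
      intro hd
      obtain ⟨q, hq, hpq⟩ := (Prime.dvd_prod_iff hpp.prime).mp hd
      rw [(Nat.prime_dvd_prime_iff_eq hpp (h1 q (by simp [hq]))).mp hpq] at hp
      exact hp hq

theorem index (h : IsBadPrimes n ps) {g : ℕ} (hg : g ∈ 0 :: ps) : g = 0 ∨ g.Prime :=
  (List.mem_cons.mp hg).imp_right (h.prime g)

theorem nodup_cons (h : IsBadPrimes n ps) : (0 :: ps).Nodup :=
  List.nodup_cons.mpr ⟨fun h0 => Nat.not_prime_zero (h.prime 0 h0), h.nodup⟩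

theorem ne_zero (h : IsBadPrimes n ps) : n ≠ 0 := h.squarefree.ne_zero

end IsBadPrimes

namespace IsIntRep

variable {u w z : ℤ} {ps : List ℕ}

theorem valChar_unramified (h : IsIntRep n u w z) (hps : IsBadPrimes n ps) {q : ℕ} (hq : q.Prime)
    (hqp : q ∉ ps) : valChar q (n * u * w) = 0 ∧ valChar q (n * (u - w) * w) = 0 := by
  have : Fact q.Prime := ⟨hq⟩
  have hqn : ¬q ∣ n := fun hd => hqp (hps.mem_of_dvd hq hd)
  obtain ⟨h1, h2, h3, -⟩ := h.valChar_good q hps.ne_zero (fun h => hqp (h ▸ hps.two_mem))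
    (fun h => hqp (h ▸ hps.three_mem)) hqn
  rw [h.char_zero hps.ne_zero (isMulChar_valChar q), h.char_self hps.ne_zero (isMulChar_valChar q),
    h1, h2, h3, valChar_of_not_dvd q (by rwa [Int.natCast_dvd_natCast])]
  simp

theorem mul_ne_zero₀ (h : IsIntRep n u w z) (hn : n ≠ 0) : (n * u * w : ℤ) ≠ 0 :=
  mul_ne_zero (mul_ne_zero (by exact_mod_cast hn) (h.ne_u hn)) h.ne_w

theorem mul_ne_zero₁ (h : IsIntRep n u w z) (hn : n ≠ 0) : (n * (u - w) * w : ℤ) ≠ 0 :=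
  mul_ne_zero (mul_ne_zero (by exact_mod_cast hn) (h.ne_sub hn)) h.ne_w

/-- Each condition is an identity between characters of the two classes. Both classes are unramified
outside the list, so `char_expand` turns the identity into coordinates at −1 and the listed primes.
-/
theorem localCondition_sum (h : IsIntRep n u w z) (hps : IsBadPrimes n ps) (c : LocalCondition)
    (hc : c.valid n ps = true) :
    ((0 :: ps).map fun g => boolBit (c.coeff n g false) * bitChar g (n * u * w) +
      boolBit (c.coeff n g true) * bitChar g (n * (u - w) * w)).sum = 0 := by
  have hn := hps.ne_zero
  have hS := hps.nodup_cons
  have h0 := h.mul_ne_zero₀ hn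
  have h1 := h.mul_ne_zero₁ hn
  have ind : ∀ {a : ℕ} (F : ℕ → ZMod 2), a ∈ 0 :: ps →
      ((0 :: ps).map fun g => boolBit (g == a) * F g).sum = F a := fun {a} F ha => by
    rw [← sum_indicator _ hS ha F]
    simp [boolBit]
  have m2 : 2 ∈ 0 :: ps := List.mem_cons_of_mem _ hps.two_mem
  have m3 : 3 ∈ 0 :: ps := List.mem_cons_of_mem _ hps.three_mem
  have e0 : ∀ {f : ℤ → ZMod 2}, IsMulChar f → f (n * u * w) = _ := fun {f} hf =>
    char_expand hf ps hps.prime hps.nodup h0 fun q hq hqp => (h.valChar_unramified hps hq hqp).1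
  have e1 : ∀ {f : ℤ → ZMod 2}, IsMulChar f → f (n * (u - w) * w) = _ := fun {f} hf =>
    char_expand hf ps hps.prime hps.nodup h1 fun q hq hqp => (h.valChar_unramified hps hq hqp).2
  have hF : boolBit false = 0 := rfl
  rw [List.sum_map_add]
  cases c with
  | sign =>
    simp only [LocalCondition.coeff]
    rw [ind _ (by simp), ind _ (by simp), bitChar_zero, h.signChar_eq hn,
      CharTwo.add_self_eq_zero]
  | two =>
    simp only [LocalCondition.coeff, Bool.not_false, Bool.true_and, Bool.not_true, Bool.false_and,
      hF, zero_mul, List.map_const', List.sum_replicate, smul_zero, add_zero]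
    rw [ind _ m2, bitChar_prime Nat.prime_two]
    simp only [LocalCondition.valid, beq_iff_eq] at hc
    exact h.valChar_two hn (by omega)
  | three =>
    simp only [LocalCondition.coeff, Bool.false_and, Bool.true_and,
      hF, zero_mul, List.map_const', List.sum_replicate, smul_zero, zero_add]
    rw [ind _ m3, bitChar_prime Nat.prime_three]
    simp only [LocalCondition.valid, bne_iff_ne] at hc
    exact h.valChar_three hn (by omega)
  | threeSplit =>
    have : Fact (Nat.Prime 3) := ⟨Nat.prime_three⟩
    simp only [LocalCondition.coeff, if_true, Bool.false_eq_true, if_false]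
    rw [ind _ m3, bitChar_prime Nat.prime_three]
    simp only [LocalCondition.valid, beq_iff_eq] at hc
    rw [← h.locChar_three hn hc, e1 (isMulChar_locChar 3 0)]
    congr 2
    refine List.map_congr_left fun g hg => ?_
    congr 1
    by_cases hg3 : g = 3
    · subst hg3
      simpa [boolBit, genInt] using (locChar_self 3).symm
    · rw [locChar_of_not_dvd 3 0, legBit_genInt 3 (by norm_num) (hps.index hg) hg3]
      · have : (g != 3) = true := by simpa using hg3
        rw [this, Bool.true_and]
      · rcases hps.index hg with rfl | hg
        · norm_num [genInt]
        · simp only [genInt, if_neg hg.ne_zero]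
          exact IsIntRep.not_dvd_natCast 3 hg (Ne.symm hg3)
  | first p | second p =>
    simp only [LocalCondition.valid, Bool.and_eq_true, List.contains_iff_mem, decide_eq_true_eq,
      beq_iff_eq, bne_iff_ne] at hc
    obtain ⟨⟨⟨hpm, hp5⟩, hpn⟩, hpn2⟩ := hc
    have hp := hps.prime p hpm
    have : Fact p.Prime := ⟨hp⟩
    have hp2 : p ≠ 2 := by omega
    have hp3 : p ≠ 3 := by omega
    have hnp : (n : ℤ) = p * (n / p : ℕ) := by
      exact_mod_cast (Nat.mul_div_cancel' (Nat.dvd_of_mod_eq_zero hpn)).symm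
    have hd : ¬p ∣ n / p := fun hd => hpn2 (Nat.mod_eq_zero_of_dvd hd)
    have hd' : ¬(p : ℤ) ∣ (n / p : ℕ) := by rwa [Int.natCast_dvd_natCast]
    have hp0 : (p : ℤ) ≠ 0 := by exact_mod_cast hp.ne_zero
    have hnp0 : ((n / p : ℕ) : ℤ) ≠ 0 := fun h => hd' (by simp [h])
    have hv : valChar p n = 1 := by
      rw [hnp, isMulChar_valChar p _ _ hp0 hnp0, valChar_self, valChar_of_not_dvd p hd', add_zero]
    have hl : locChar p 0 n = boolBit (symBit p (n / p)) := by
      rw [hnp, isMulChar_locChar p 0 _ _ hp0 hnp0, locChar_self, locChar_of_not_dvd p 0 hd',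
        zero_add, legBit_natCast p hp2 hd]
    have h3 : legBit p (-3) = boolBit (symBit p (p - 3)) := by
      rw [← legBit_natCast p hp2 (fun hd => absurd (Nat.le_of_dvd (by omega) hd) (by omega))]
      refine legBit_congr p ?_
      rw [Nat.cast_sub (by omega)]
      exact ⟨-1, by push_cast; ring⟩
    obtain ⟨b0, b1⟩ := h.locChar_bad p hn hp2 hp3 hv
    have hloc : ∀ ε : ZMod 2, ∀ g ∈ 0 :: ps, locChar p ε (genInt g) =
        if g = p then ε else boolBit (symBit p (residue p g)) := fun ε g hg => by
      split_ifs with hgp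
      · subst hgp
        rw [locChar_eq]
        simp [genInt, hp.ne_zero, locChar_self, valChar_self]
      · rw [locChar_of_not_dvd, legBit_genInt p hp2 (hps.index hg) hgp]
        rcases hps.index hg with rfl | hg
        · simp only [genInt, if_true, dvd_neg]
          exact fun h => (Nat.prime_iff_prime_int.mp hp).not_isUnit (isUnit_of_dvd_one h)
        · simp only [genInt, if_neg hg.ne_zero]
          exact IsIntRep.not_dvd_natCast p hg (Ne.symm hgp)
    simp only [LocalCondition.coeff, if_true, Bool.false_eq_true, if_false, Bool.true_and,
      Bool.false_and, hF, zero_mul, List.map_const', List.sum_replicate, smul_zero, zero_add]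
    first
    | rw [← b0, e0 (isMulChar_locChar p _)]
      congr 1
      · congr 1
        refine List.map_congr_left fun g hg => ?_
        rw [hloc _ g hg, hl]
        split_ifs <;> rfl
      · rw [h3, ← bitChar_prime hp, ← ind (fun g => boolBit (symBit p (p - 3)) *
          bitChar g (n * (u - w) * w)) (List.mem_cons_of_mem _ hpm)]
        congr 1
        refine List.map_congr_left fun g hg => ?_
        by_cases hgp : g = p
        · subst hgp
          simp [boolBit]
        · simp [boolBit, hgp]
    | rw [← b1, e1 (isMulChar_locChar p _)]
      congr 1
      refine List.map_congr_left fun g hg => ?_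
      rw [hloc _ g hg, hl, legBit_neg_one p hp2, ← boolBit_xor]
      split_ifs <;> rfl

end IsIntRep

theorem Finset.sum_list_sum_comm {M α : Type*} [AddCommMonoid M] (s : Finset ℕ) (l : List α)
    (F : ℕ → α → M) :
    ∑ b ∈ s, (l.map (F b)).sum = (l.map fun c => ∑ b ∈ s, F b c).sum := by
  induction l with
  | nil => simp
  | cons c l ih => simp [Finset.sum_add_distrib, ih]

theorem List.sum_map_eq_sum_range {M α : Type*} [AddCommMonoid M] (l : List α) (d : α)
    (F : α → M) : (l.map F).sum = ∑ k ∈ Finset.range l.length, F (l.getD k d) := by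
  induction l with
  | nil => simp
  | cons c l ih => simp [Finset.sum_range_succ', ih, add_comm]

/-! ### Class vectors, generators and the spanning certificate. -/

/-- The character of a point attached to an index and one of the two descent maps. -/
noncomputable def classChar (f : ℤ → ZMod 2) (hf : IsMulChar f) (hn : n ≠ 0) (i : Bool) :
    (piThirdCurve n).toAffine.Point →+ ZMod 2 :=
  if i then descentHom f hf (isRootDatum_self hn) else descentHom f hf (isRootDatum_zero hn)

/-- The integers `m₀, m₁` represent the square classes attached to the point `P`. -/
def HasClass (P : (piThirdCurve n).toAffine.Point) (m : Bool → ℤ) : Prop :=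
  (∀ i, m i ≠ 0) ∧ ∀ (hn : n ≠ 0) (f : ℤ → ZMod 2) (hf : IsMulChar f) (i : Bool),
    classChar f hf hn i P = f (m i)

theorem IsIntRep.hasClass {u w z : ℤ} (hn : n ≠ 0) (h : IsIntRep n u w z) :
    HasClass (h.point hn) fun i => if i then n * (u - w) * w else n * u * w := by
  refine ⟨fun i => ?_, fun _ f hf i => ?_⟩
  · cases i
    · exact h.mul_ne_zero₀ hn
    · exact h.mul_ne_zero₁ hn
  · cases i
    · exact h.ratChar_zero hn hf
    · exact h.ratChar_self hn hf

/-- The point `(0, 0)`. -/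
noncomputable def torsionZero (hn : n ≠ 0) : (piThirdCurve n).toAffine.Point :=
  .some 0 0 ((piThirdCurve_nonsingular_iff hn).mpr (by ring))

/-- The point `(n, 0)`. -/
noncomputable def torsionSelf (hn : n ≠ 0) : (piThirdCurve n).toAffine.Point :=
  .some n 0 ((piThirdCurve_nonsingular_iff hn).mpr (by ring))

theorem ratChar_intCast {f : ℤ → ZMod 2} (hf : IsMulChar f) (m : ℤ) : ratChar f m = f m := by
  simp [ratChar, hf.one]

theorem torsionZero_hasClass (hn : n ≠ 0) :
    HasClass (torsionZero hn) fun i => if i then -n else -3 * n ^ 2 := by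
  have hn' : (n : ℤ) ≠ 0 := by exact_mod_cast hn
  have hnq : (n : ℚ) ≠ 0 := by exact_mod_cast hn
  refine ⟨fun i => by cases i <;> simp [hn], fun _ f hf i => ?_⟩
  cases i
  · have := ratChar_intCast hf (-3 * n ^ 2)
    push_cast at this
    simpa [classChar, descentHom_apply, torsionZero, descentMap] using this
  · have := ratChar_intCast hf (-n)
    push_cast at this
    simpa [classChar, descentHom_apply, torsionZero, descentMap, hnq.symm] using this

theorem torsionSelf_hasClass (hn : n ≠ 0) :
    HasClass (torsionSelf hn) fun i => if i then 4 * n ^ 2 else n := by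
  have hn' : (n : ℤ) ≠ 0 := by exact_mod_cast hn
  have hnq : (n : ℚ) ≠ 0 := by exact_mod_cast hn
  refine ⟨fun i => by cases i <;> simp [hn], fun _ f hf i => ?_⟩
  cases i
  · have := ratChar_intCast hf n
    push_cast at this
    simpa [classChar, descentHom_apply, torsionSelf, descentMap, hnq] using this
  · have := ratChar_intCast hf (4 * n ^ 2)
    push_cast at this
    simpa [classChar, descentHom_apply, torsionSelf, descentMap] using this

theorem two_nsmul_some {x : ℚ} (h : (piThirdCurve n).toAffine.Nonsingular x 0) :
    2 • (Point.some x 0 h) = 0 := by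
  rw [two_nsmul]
  exact Point.add_self_of_Y_eq (by rw [piThirdCurve_negY, neg_zero])

/-- The points of order dividing two. -/
theorem two_torsion_cases (hn : n ≠ 0) {T : (piThirdCurve n).toAffine.Point} (hT : 2 • T = 0) :
    T = 0 ∨ T = torsionZero hn ∨ T = torsionSelf hn ∨ T = torsionZero hn + torsionSelf hn := by
  have hnq : (n : ℚ) ≠ 0 := by exact_mod_cast hn
  have key : ∀ {x y : ℚ} (h : (piThirdCurve n).toAffine.Nonsingular x y),
      2 • (Point.some x y h) = 0 → y = 0 := by
    intro x y h h2
    by_contra hy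
    rw [two_nsmul, ← eq_neg_iff_add_eq_zero, Point.neg_some, Point.some.injEq,
      piThirdCurve_negY] at h2
    exact hy (by linarith [h2.2])
  cases T with
  | zero => exact .inl rfl
  | some x y h =>
    obtain rfl := key h hT
    have heq := (piThirdCurve_nonsingular_iff hn).mp h
    have h0 : x * (x - n) * (x + 3 * n) = 0 := by rw [← heq]; ring
    rcases mul_eq_zero.mp h0 with h0 | h3
    · rcases mul_eq_zero.mp h0 with h0 | h0
      · subst h0; exact .inr (.inl rfl)
      · have : x = n := by linarith
        subst this; exact .inr (.inr (.inl rfl))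
    · have hx : x = -3 * n := by linarith
      subst hx
      refine .inr (.inr (.inr ?_))
      -- The three points of order two lie on the line y = 0, so the third is minus the sum of the
      -- other two.
      have hsum := add_eq_neg_of_collinear (n := n)
        ((piThirdCurve_nonsingular_iff hn).mpr (by ring))
        ((piThirdCurve_nonsingular_iff hn).mpr (by ring)) h (x₁ := 0) (y₁ := 0) (x₂ := n) (y₂ := 0)
        hnq.symm (fun h => hnq (by linarith)) (fun h => hnq (by linarith)) (by ring)
      unfold torsionZero torsionSelf
      rw [hsum, eq_neg_iff_add_eq_zero, ← two_nsmul, hT]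

theorem two_nsmul_torsionZero (hn : n ≠ 0) : 2 • torsionZero hn = 0 := two_nsmul_some _

theorem two_nsmul_torsionSelf (hn : n ≠ 0) : 2 • torsionSelf hn = 0 := two_nsmul_some _

/-- The product of the integers whose indices are selected by every second binary digit. -/
def maskProd (N : ℕ) : List ℕ → ℕ → ℤ
  | [], _ => 1
  | g :: S, b => (if N.testBit b then genInt g else 1) * maskProd N S (b + 2)

theorem maskProd_ne_zero (N : ℕ) (S : List ℕ) (b : ℕ) : maskProd N S b ≠ 0 := by
  induction S generalizing b with
  | nil => simp [maskProd]
  | cons g S ih =>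
    rw [maskProd]
    refine mul_ne_zero ?_ (ih _)
    split_ifs
    · exact genInt_ne_zero g
    · norm_num

theorem bitChar_maskProd_of_notMem (N : ℕ) {S : List ℕ} (hS : ∀ g ∈ S, g = 0 ∨ g.Prime) {a : ℕ}
    (ha : a = 0 ∨ a.Prime) (haS : a ∉ S) (b : ℕ) : bitChar a (maskProd N S b) = 0 := by
  induction S generalizing b with
  | nil => exact (isMulChar_bitChar a).one
  | cons g S ih =>
    obtain ⟨h1, h2⟩ := List.forall_mem_cons.mp hS
    rw [List.mem_cons, not_or] at haS
    rw [maskProd, isMulChar_bitChar a _ _ _ (maskProd_ne_zero _ _ _), ih h2 haS.2]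
    · split_ifs
      · rw [bitChar_genInt ha h1, if_neg haS.1, add_zero]
      · rw [(isMulChar_bitChar a).one, add_zero]
    · split_ifs
      · exact genInt_ne_zero g
      · norm_num

theorem bitChar_maskProd (N : ℕ) {S : List ℕ} (hS : ∀ g ∈ S, g = 0 ∨ g.Prime) (hnd : S.Nodup)
    {r : ℕ} (hr : r < S.length) (b : ℕ) :
    bitChar (S.getD r 0) (maskProd N S b) = digit N (b + 2 * r) := by
  induction S generalizing b r with
  | nil => simp at hr
  | cons g S ih =>
    obtain ⟨h1, h2⟩ := List.forall_mem_cons.mp hS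
    obtain ⟨h3, h4⟩ := List.nodup_cons.mp hnd
    have hne : (if N.testBit b then genInt g else 1) ≠ 0 := by
      split_ifs
      · exact genInt_ne_zero g
      · norm_num
    cases r with
    | zero =>
      simp only [List.getD_cons_zero, mul_zero, add_zero]
      rw [maskProd, isMulChar_bitChar g _ _ hne (maskProd_ne_zero _ _ _),
        bitChar_maskProd_of_notMem N h2 h1 h3, add_zero, digit]
      split_ifs with h
      · rw [bitChar_genInt h1 h1, if_pos rfl, h]; rfl
      · rw [(isMulChar_bitChar g).one]; simp [boolBit, h]
    | succ r =>
      simp only [List.getD_cons_succ]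
      simp only [List.length_cons, Nat.add_lt_add_iff_right] at hr
      have hmem : S.getD r 0 ∈ S := by
        rw [List.getD_eq_getElem _ _ hr]; exact List.getElem_mem hr
      have hgne : S.getD r 0 ≠ g := fun h => h3 (h ▸ hmem)
      rw [maskProd, isMulChar_bitChar _ _ _ hne (maskProd_ne_zero _ _ _), ih h2 h4 hr]
      have : bitChar (S.getD r 0) (if N.testBit b then genInt g else 1) = 0 := by
        split_ifs
        · rw [bitChar_genInt (h2 _ hmem) h1, if_neg hgne]
        · exact (isMulChar_bitChar _).one
      rw [this, zero_add]
      congr 1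
      ring

/-- Newton's iteration for integer square roots, with a bound on the number of steps. -/
def newtonSqrt (t : ℕ) : ℕ → ℕ → ℕ
  | 0, x => x
  | k + 1, x => let y := (x + t / x) / 2; if y < x then newtonSqrt t k y else x

/-- A sufficient computational criterion for being a nonzero square. -/
def squareCheck (t : ℤ) : Bool :=
  -- The starting value and the limit of 300 steps matter only for success; soundness uses the final
  -- comparison alone.
  0 < t && (let s := newtonSqrt t.toNat 300 t.toNat; (s * s : ℕ) == t.toNat)

theorem squareCheck_sound {t : ℤ} (h : squareCheck t = true) : 0 < t ∧ IsSquare t := by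
  simp only [squareCheck, Bool.and_eq_true, decide_eq_true_eq, beq_iff_eq] at h
  refine ⟨h.1, newtonSqrt t.toNat 300 t.toNat, ?_⟩
  have := h.2
  have h3 : (t.toNat : ℤ) = t := Int.toNat_of_nonneg h.1.le
  rw [← h3]
  exact_mod_cast this.symm

/-- The data of a generator: representatives of its two square classes, a functional, and the
vector of its square classes. -/
structure GenData where
  m : Bool → ℤ
  dual : ℕ
  vec : ℕ

/-- The vector of a generator is correct. -/
def GenData.check (S : List ℕ) (G : GenData) : Bool :=
  squareCheck (G.m false * maskProd G.vec S 0) && squareCheck (G.m true * maskProd G.vec S 1)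

/-- Every basis vector is a combination of correction vectors of local conditions and of
generators. -/
def spanCheck (n : ℕ) (ps : List ℕ) (conds : List (LocalCondition × ℕ)) (gens : List GenData) :
    Bool :=
  (conds.all fun c => c.1.valid n ps) && (gens.all fun G => G.check (0 :: ps)) &&
  (List.range (2 * (0 :: ps).length)).all fun b =>
    xorSelect (fun c : LocalCondition => c.coeff n ((0 :: ps).getD (b / 2) 0) (b % 2 == 1)) conds ^^^
      xorSelect (fun B : ℕ => B.testBit b) (gens.map fun G => (G.dual, G.vec)) == 2 ^ b

/-- The class vector of a point. -/
noncomputable def classVec (hn : n ≠ 0) (ps : List ℕ) (P : (piThirdCurve n).toAffine.Point)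
    (b : ℕ) : ZMod 2 :=
  classChar (bitChar ((0 :: ps).getD (b / 2) 0)) (isMulChar_bitChar _) hn (b % 2 == 1) P

/-- The representing integer and the product read off the digits differ by a square factor, so every
character agrees on them, also at primes outside the list. -/
theorem GenData.classChar_eq {hn : n ≠ 0} {ps : List ℕ} {G : GenData}
    (hG : G.check (0 :: ps) = true) {P : (piThirdCurve n).toAffine.Point} (hP : HasClass P G.m)
    {f : ℤ → ZMod 2} (hf : IsMulChar f) (i : Bool) :
    classChar f hf hn i P = f (maskProd G.vec (0 :: ps) (if i then 1 else 0)) := by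
  rw [hP.2]
  simp only [GenData.check, Bool.and_eq_true] at hG
  have key : ∀ a b : ℤ, squareCheck (a * b) = true → f a = f b := fun a b h => by
    obtain ⟨h0, r, hr⟩ := squareCheck_sound h
    have ha : a ≠ 0 := by rintro rfl; simp at h0
    have hb : b ≠ 0 := by rintro rfl; simp at h0
    have hr0 : r ≠ 0 := by rintro rfl; rw [hr] at h0; simp at h0
    have := congrArg f hr
    rw [hf _ _ ha hb, hf.mul_self hr0] at this
    exact CharTwo.add_eq_zero.mp this
  cases i
  · exact key _ _ hG.1
  · exact key _ _ hG.2

theorem GenData.classVec_eq {hn : n ≠ 0} {ps : List ℕ} (hps : IsBadPrimes n ps) {G : GenData}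
    (hG : G.check (0 :: ps) = true) {P : (piThirdCurve n).toAffine.Point} (hP : HasClass P G.m)
    {b : ℕ} (hb : b < 2 * (0 :: ps).length) : classVec hn ps P b = digit G.vec b := by
  rw [classVec, GenData.classChar_eq hG hP,
    bitChar_maskProd G.vec (fun g => hps.index) hps.nodup_cons (by omega)]
  congr 1
  rcases Nat.mod_two_eq_zero_or_one b with h | h <;> simp [h] <;> omega

/-- The certificate expresses the identity matrix as Σ (condition ⊗ correction) + Σ (dual ⊗
generator). Applied to a class vector, the first sum disappears because every condition vanishes on
it. -/
theorem classVec_eq_sum {hn : n ≠ 0} {ps : List ℕ} (hps : IsBadPrimes n ps)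
    {conds : List (LocalCondition × ℕ)} {gens : List GenData}
    (hc : spanCheck n ps conds gens = true) {u w z : ℤ} (h : IsIntRep n u w z) {c : ℕ}
    (hcl : c < 2 * (0 :: ps).length) :
    classVec hn ps (h.point hn) c = (gens.map fun G =>
      (∑ b ∈ Finset.range (2 * (0 :: ps).length), digit G.dual b * classVec hn ps (h.point hn) b) *
        digit G.vec c).sum := by
  simp only [spanCheck, Bool.and_eq_true, List.all_eq_true, List.mem_range, beq_iff_eq] at hc
  obtain ⟨⟨hvalid, -⟩, hrow⟩ := hc
  set m := 2 * (0 :: ps).length with hm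
  set β := classVec hn ps (h.point hn) with hβ
  have hzero : ∀ p ∈ conds, ∑ b ∈ Finset.range m,
      boolBit (p.1.coeff n ((0 :: ps).getD (b / 2) 0) (b % 2 == 1)) * β b = 0 := by
    intro p hp
    have h1 := h.localCondition_sum hps p.1 (hvalid p hp)
    have h2 := sum_range_two_mul_length (0 :: ps) fun g i => boolBit (p.1.coeff n g i) *
      bitChar g (if i then n * (u - w) * w else n * u * w)
    simp only [Bool.false_eq_true, if_true, if_false] at h2
    rw [← h1, ← h2]
    · refine Finset.sum_congr rfl fun b _ => ?_
      rw [hβ, classVec, (h.hasClass hn).2]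
  have hexp : β c = ∑ b ∈ Finset.range m, digit (2 ^ b) c * β b := by
    rw [Finset.sum_eq_single c]
    · simp [digit_two_pow]
    · intro b _ hb
      simp [digit_two_pow, hb]
    · intro hb
      simp [hcl] at hb
  rw [hexp]
  calc ∑ b ∈ Finset.range m, digit (2 ^ b) c * β b
      = ∑ b ∈ Finset.range m, ((conds.map fun p =>
          boolBit (p.1.coeff n ((0 :: ps).getD (b / 2) 0) (b % 2 == 1)) * β b *
            digit p.2 c).sum +
        (gens.map fun G => digit G.dual b * β b * digit G.vec c).sum) := by
        refine Finset.sum_congr rfl fun b hb => ?_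
        rw [← hrow b (Finset.mem_range.mp hb), digit_xor, digit_xorSelect, digit_xorSelect,
          add_mul, ← List.sum_map_mul_right, ← List.sum_map_mul_right, List.map_map]
        congr 2
        · exact List.map_congr_left fun _ _ => by ring
        · exact List.map_congr_left fun _ _ => mul_right_comm _ _ _
    _ = (gens.map fun G => (∑ b ∈ Finset.range m, digit G.dual b * β b) * digit G.vec c).sum := by
        rw [Finset.sum_add_distrib, Finset.sum_list_sum_comm, Finset.sum_list_sum_comm]
        simp only [← Finset.sum_mul]
        rw [List.map_congr_left (g := fun _ => (0 : ZMod 2)) (fun p hp => by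
          rw [hzero p hp, zero_mul])]
        simp

/-- A point all of whose square class characters vanish is a double up to two-torsion. -/
theorem exists_two_nsmul_of_classChar (hn : n ≠ 0) (P : (piThirdCurve n).toAffine.Point)
    (hs : ∀ i, classChar signChar isMulChar_signChar hn i P = 0)
    (hv : ∀ (p : ℕ) [Fact p.Prime] (i), classChar (valChar p) (isMulChar_valChar p) hn i P = 0) :
    ∃ T R : (piThirdCurve n).toAffine.Point, 2 • T = 0 ∧ P = T + 2 • R := by
  cases P with
  | zero => rw [← Point.zero_def]; exact ⟨0, 0, by simp, by simp⟩
  | some x y h =>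
    by_cases hy : y = 0
    · subst hy
      exact ⟨_, 0, two_nsmul_some h, by simp⟩
    have heq := (piThirdCurve_nonsingular_iff hn).mp h
    have hprod : x * (x - n) * (x + 3 * n) ≠ 0 := by rw [← heq]; exact pow_ne_zero 2 hy
    have hx : x ≠ 0 := fun h => hprod (by rw [h]; ring)
    have hx1 : x - n ≠ 0 := fun h => hprod (by rw [h]; ring)
    have hx2 : x + 3 * n ≠ 0 := fun h => hprod (by rw [h]; ring)
    have hsq : ∀ q : ℚ, q ≠ 0 → ratChar signChar q = 0 →
        (∀ (p : ℕ) [Fact p.Prime], ratChar (valChar p) q = 0) → IsSquare q := by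
      intro q hq h1 h2
      have hnum := Rat.num_ne_zero.mpr hq
      have hden : (q.den : ℤ) ≠ 0 := by exact_mod_cast q.den_nz
      have hne := mul_ne_zero hnum hden
      have hpos : 0 < q.num * q.den := by
        have : signChar (q.num * q.den) = 0 := by rw [isMulChar_signChar _ _ hnum hden]; exact h1
        unfold signChar at this
        split_ifs at this with h
        · exact absurd this (by decide)
        · omega
      obtain ⟨r, hr⟩ := isSquare_of_valChar hpos fun p hp => by
        have : Fact p.Prime := ⟨hp⟩
        rw [isMulChar_valChar p _ _ hnum hden]
        exact h2 p
      refine ⟨r / q.den, ?_⟩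
      have hdq : (q.den : ℚ) ≠ 0 := by exact_mod_cast q.den_nz
      have hr' : (q.num : ℚ) * q.den = r * r := by exact_mod_cast hr
      rw [div_mul_div_comm, ← hr', mul_div_mul_right _ _ hdq, Rat.num_div_den]
    have s0 : IsSquare x := hsq x hx
      (by have := hs false; simpa [classChar, descentHom_apply, descentMap, hx] using this)
      (fun p _ => by
        have := hv p false; simpa [classChar, descentHom_apply, descentMap, hx] using this)
    have hxn : x ≠ n := sub_ne_zero.mp hx1
    have s1 : IsSquare (x - n) := hsq (x - n) hx1
      (by have := hs true; simpa [classChar, descentHom_apply, descentMap, hxn] using this)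
      (fun p _ => by
        have := hv p true; simpa [classChar, descentHom_apply, descentMap, hxn] using this)
    -- The third difference needs no character: the product of the three differences is y².
    have s2 : IsSquare (x + 3 * n) := by
      have : x + 3 * n = y ^ 2 / (x * (x - n)) := by
        rw [heq]; field_simp
      rw [this]
      exact (IsSquare.sq y).div (s0.mul s1)
    obtain ⟨R, hR⟩ := exists_two_nsmul_eq hn h s0 s1 s2
    exact ⟨0, R, by simp, by rw [hR, zero_add]⟩

/-- Generators of the group modulo doubles and two-torsion. -/
theorem exists_eq_sum_add_two_nsmul {ps : List ℕ} (hps : IsBadPrimes n ps)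
    {conds : List (LocalCondition × ℕ)} {gens : List GenData}
    (hc : spanCheck n ps conds gens = true) (P : ℕ → (piThirdCurve n).toAffine.Point)
    (d : GenData) (hP : ∀ k < gens.length, HasClass (P k) (gens.getD k d).m)
    (Q : (piThirdCurve n).toAffine.Point) :
    ∃ (c : ℕ → ZMod 2) (T R : (piThirdCurve n).toAffine.Point), 2 • T = 0 ∧
      Q = ∑ k ∈ Finset.range gens.length, (c k).val • P k + T + 2 • R := by
  have hn := hps.ne_zero
  cases Q with
  | zero => rw [← Point.zero_def]; exact ⟨0, 0, 0, by simp, by simp⟩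
  | some x y h =>
  by_cases hy : y = 0
  · subst hy
    exact ⟨0, _, 0, two_nsmul_some h, by simp⟩
  obtain ⟨z, hr, hQ⟩ := exists_isIntRep hps.squarefree h hy
  rw [hQ]
  set Q := hr.point hps.squarefree.ne_zero with hQdef
  -- The coefficients are the dual functionals evaluated at Q; subtracting the corresponding
  -- generators kills all its characters, inside the list by `classVec_eq_sum` and outside because
  -- everything is unramified there.
  set c : ℕ → ZMod 2 := fun k => ∑ b ∈ Finset.range (2 * (0 :: ps).length),
    digit (gens.getD k d).dual b * classVec hn ps Q b with hcdef
  have hgen : ∀ k < gens.length, (gens.getD k d).check (0 :: ps) = true := by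
    intro k hk
    simp only [spanCheck, Bool.and_eq_true, List.all_eq_true] at hc
    rw [List.getD_eq_getElem _ _ hk]
    exact hc.1.2 _ (List.getElem_mem hk)
  have hsmul : ∀ (a t : ZMod 2), a.val • t = a * t := by decide
  have hin : ∀ b < 2 * (0 :: ps).length, classVec hn ps
      (Q - ∑ k ∈ Finset.range gens.length, (c k).val • P k) b = 0 := by
    intro b hb
    have h1 := classVec_eq_sum (hn := hn) hps hc hr hb
    rw [List.sum_map_eq_sum_range _ d] at h1
    simp only [classVec, map_sub, map_sum, map_nsmul] at h1 ⊢
    rw [sub_eq_zero, hQdef, h1]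
    refine Finset.sum_congr rfl fun k hk => ?_
    have hk' := Finset.mem_range.mp hk
    rw [hsmul, hcdef]
    congr 1
    exact (GenData.classVec_eq hps (hgen k hk') (hP k hk') hb).symm
  have hin' : ∀ g ∈ 0 :: ps, ∀ i, classChar (bitChar g) (isMulChar_bitChar g) hn i
      (Q - ∑ k ∈ Finset.range gens.length, (c k).val • P k) = 0 := by
    intro g hg i
    obtain ⟨r, hr, rfl⟩ := List.getElem_of_mem hg
    have := hin (2 * r + (if i then 1 else 0)) (by split_ifs <;> omega)
    rw [← this, classVec]
    have e1 : (2 * r + (if i then 1 else 0)) / 2 = r := by split_ifs <;> omega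
    have e2 : ((2 * r + (if i then 1 else 0)) % 2 == 1) = i := by cases i <;> simp
    simp only [e1, e2, List.getD_eq_getElem _ _ hr]
  have hout : ∀ (p : ℕ) [Fact p.Prime], p ∉ ps → ∀ i, classChar (valChar p)
      (isMulChar_valChar p) hn i (Q - ∑ k ∈ Finset.range gens.length, (c k).val • P k) = 0 := by
    intro p hp hpps i
    have hp0 : p ∉ 0 :: ps := by simp [hpps, hp.out.ne_zero]
    rw [map_sub, map_sum]
    have hQ0 : classChar (valChar p) (isMulChar_valChar p) hn i Q = 0 := by
      rw [hQdef, (hr.hasClass hn).2]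
      have := hr.valChar_unramified hps hp.out hpps
      cases i
      · exact this.1
      · exact this.2
    rw [hQ0, zero_sub, neg_eq_zero]
    refine Finset.sum_eq_zero fun k hk => ?_
    have hk' := Finset.mem_range.mp hk
    rw [map_nsmul, GenData.classChar_eq (hgen k hk') (hP k hk'), ← bitChar_prime hp.out,
      bitChar_maskProd_of_notMem _ (fun g => hps.index) (.inr hp.out) hp0, smul_zero]
  obtain ⟨T, R, hT, hTR⟩ := exists_two_nsmul_of_classChar hn
    (Q - ∑ k ∈ Finset.range gens.length, (c k).val • P k)
    (fun i => by
      have := hin' 0 (by simp) i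
      simpa only [bitChar_zero] using this)
    (fun p hp i => by
      by_cases hpps : p ∈ ps
      · have := hin' p (by simp [hpps]) i
        simpa only [bitChar_prime hp.out] using this
      · exact hout p hpps i)
  exact ⟨c, T, R, hT, by rw [add_assoc, ← hTR]; abel⟩

/-- The functionals of the generators form the dual basis. -/
def dualCheck (m : ℕ) (gens : List GenData) : Bool :=
  (List.range gens.length).all fun k => (List.range gens.length).all fun l =>
    ((List.range m).foldr (fun b acc => (((gens.getD k ⟨fun _ => 0, 0, 0⟩).dual.testBit b &&
      (gens.getD l ⟨fun _ => 0, 0, 0⟩).vec.testBit b) ^^ acc)) false) == (k == l)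

/-- The digits of `dual` pair with class vectors to give homomorphisms on points; on the generators
the pairing is the matrix tested by `dualCheck`. -/
theorem exists_dual {ps : List ℕ} (hps : IsBadPrimes n ps)
    {conds : List (LocalCondition × ℕ)} {gens : List GenData}
    (hc : spanCheck n ps conds gens = true)
    (hd : dualCheck (2 * (0 :: ps).length) gens = true)
    (P : ℕ → (piThirdCurve n).toAffine.Point)
    (hP : ∀ k < gens.length, HasClass (P k) (gens.getD k ⟨fun _ => 0, 0, 0⟩).m) :
    ∃ L : ℕ → (piThirdCurve n).toAffine.Point →+ ZMod 2,
      ∀ k < gens.length, ∀ l < gens.length, L k (P l) = if k = l then 1 else 0 := by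
  have hn := hps.ne_zero
  set d : GenData := ⟨fun _ => 0, 0, 0⟩
  have hgen : ∀ k < gens.length, (gens.getD k d).check (0 :: ps) = true := by
    intro k hk
    simp only [spanCheck, Bool.and_eq_true, List.all_eq_true] at hc
    rw [List.getD_eq_getElem _ _ hk]
    exact hc.1.2 _ (List.getElem_mem hk)
  refine ⟨fun k => AddMonoidHom.mk' (fun Q => ∑ b ∈ Finset.range (2 * (0 :: ps).length),
    digit (gens.getD k d).dual b * classVec hn ps Q b) fun Q R => by
      simp only [classVec, map_add, mul_add, Finset.sum_add_distrib], fun k hk l hl => ?_⟩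
  simp only [dualCheck, List.all_eq_true, List.mem_range, beq_iff_eq] at hd
  have h1 := hd k hk l hl
  have hfold : ∀ (m : List ℕ) (F : ℕ → Bool), boolBit (m.foldr (fun b acc => (F b ^^ acc)) false) =
      (m.map fun b => boolBit (F b)).sum := by
    intro m F
    induction m with
    | nil => rfl
    | cons b m ih => rw [List.foldr_cons, boolBit_xor, ih, List.map_cons, List.sum_cons]
  have h2 := congrArg boolBit h1
  rw [hfold, List.sum_map_eq_sum_range _ 0, List.length_range] at h2
  have h3 : boolBit (k == l) = if k = l then 1 else 0 := by
    by_cases h : k = l <;> simp [h, boolBit]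
  rw [← h3, ← h2]
  change ∑ b ∈ Finset.range (2 * (0 :: ps).length),
    digit (gens.getD k d).dual b * classVec hn ps (P l) b = _
  refine Finset.sum_congr rfl fun b hb => ?_
  have hb' := Finset.mem_range.mp hb
  rw [GenData.classVec_eq hps (hgen l hl) (hP l hl) hb', digit, digit,
    List.getD_eq_getElem (List.range _) 0 (by simpa using hb'), List.getElem_range]
  cases (gens.getD k d).dual.testBit b <;> cases (gens.getD l d).vec.testBit b <;> decide

/-! ### The naive height. -/

/-- The value of `a² + 3 b²` at the numerator and denominator of a rational number. -/
def quadHeight (r : ℚ) : ℤ := r.num ^ 2 + 3 * (r.den : ℤ) ^ 2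

theorem one_le_quadHeight (r : ℚ) : 1 ≤ quadHeight r := by
  have : (1 : ℤ) ≤ r.den := by exact_mod_cast r.den_pos
  unfold quadHeight
  nlinarith [sq_nonneg r.num]

theorem exists_eq_mul_num_den {r : ℚ} {a b : ℤ} (hb : b ≠ 0) (h : r = a / b) :
    ∃ k : ℤ, k ≠ 0 ∧ a = k * r.num ∧ b = k * r.den := by
  have hbq : (b : ℚ) ≠ 0 := by exact_mod_cast hb
  have hd : (r.den : ℚ) ≠ 0 := by exact_mod_cast r.den_nz
  have h1 : r.num * b = a * r.den := by
    have : (r.num : ℚ) / r.den = a / b := by rw [Rat.num_div_den, h]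
    rw [div_eq_div_iff hd hbq] at this
    exact_mod_cast this
  have hcop : IsCoprime (r.den : ℤ) r.num := (Rat.isCoprime_num_den r).symm
  obtain ⟨k, hk⟩ : (r.den : ℤ) ∣ b := hcop.dvd_of_dvd_mul_left (Dvd.intro_left a h1.symm)
  have hdz : (r.den : ℤ) ≠ 0 := by exact_mod_cast r.den_nz
  refine ⟨k, ?_, ?_, by rw [hk]; ring⟩
  · rintro rfl
    exact hb (by rw [hk]; ring)
  · refine mul_right_cancel₀ hdz ?_
    rw [← h1, hk]; ring

theorem quadHeight_le {r : ℚ} {a b : ℤ} (hb : b ≠ 0) (h : r = a / b) :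
    quadHeight r ≤ a ^ 2 + 3 * b ^ 2 := by
  obtain ⟨k, hk, rfl, rfl⟩ := exists_eq_mul_num_den hb h
  have : 1 ≤ k ^ 2 := by have := sq_pos_of_ne_zero hk; omega
  have h1 := one_le_quadHeight r
  unfold quadHeight at h1 ⊢
  nlinarith

/-- Gauss's lemma: the three integers are the coefficients of a product of two primitive linear
polynomials. -/
theorem isUnit_of_dvd_coeffs {a₁ b₁ a₂ b₂ d : ℤ} (h1 : IsCoprime a₁ b₁) (h2 : IsCoprime a₂ b₂)
    (hb : d ∣ b₁ * b₂) (ha : d ∣ a₁ * a₂) (hab : d ∣ a₁ * b₂ + a₂ * b₁) : IsUnit d := by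
  by_contra hd
  obtain ⟨p, hp, hpd⟩ : ∃ p : ℤ, Prime p ∧ p ∣ d := by
    obtain ⟨p, hp, hpd⟩ := Int.exists_prime_and_dvd (n := d) (by
      rwa [Ne, ← Int.isUnit_iff_natAbs_eq])
    exact ⟨p, hp, hpd⟩
  have hu := hp.not_isUnit
  have key : ∀ {x y : ℤ}, IsCoprime x y → p ∣ x → p ∣ y → False := fun h hx hy =>
    hu (h.isUnit_of_dvd' hx hy)
  have hs := hpd.trans hab
  rcases hp.dvd_or_dvd (hpd.trans ha) with h | h <;>
    rcases hp.dvd_or_dvd (hpd.trans hb) with h' | h'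
  · exact key h1 h h'
  · rcases hp.dvd_or_dvd ((Int.dvd_add_right (h.mul_right b₂)).mp hs) with h3 | h3
    · exact key h2 h3 h'
    · exact key h1 h h3
  · rcases hp.dvd_or_dvd ((Int.dvd_add_left (h.mul_right b₁)).mp hs) with h3 | h3
    · exact key h1 h3 h'
    · exact key h2 h h3
  · exact key h2 h h'

/-- The product of the heights of the roots of a quadratic polynomial. -/
theorem quadHeight_mul_le {r s : ℚ} {A B W : ℤ} (hW : W ≠ 0) (hadd : r + s = A / W)
    (hmul : r * s = B / W) : quadHeight r * quadHeight s ≤ (B - 3 * W) ^ 2 + 3 * A ^ 2 := by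
  have hWq : (W : ℚ) ≠ 0 := by exact_mod_cast hW
  have hr : (r.den : ℚ) ≠ 0 := by exact_mod_cast r.den_nz
  have hs : (s.den : ℚ) ≠ 0 := by exact_mod_cast s.den_nz
  have er := Rat.num_div_den r
  have es := Rat.num_div_den s
  set a := r.num
  set b : ℤ := (r.den : ℤ) with hb
  set c := s.num
  set d : ℤ := (s.den : ℤ) with hd
  have hb' : (b : ℚ) ≠ 0 := by rw [hb]; exact_mod_cast hr
  have hd' : (d : ℚ) ≠ 0 := by rw [hd]; exact_mod_cast hs
  have er' : r = a / b := by rw [hb]; exact_mod_cast er.symm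
  have es' : s = c / d := by rw [hd]; exact_mod_cast es.symm
  have e1 : (a * d + c * b) * W = A * (b * d) := by
    rw [er', es', div_add_div _ _ hb' hd', div_eq_div_iff (mul_ne_zero hb' hd') hWq] at hadd
    have : (a * d + b * c) * W = A * (b * d) := by exact_mod_cast hadd
    linear_combination this
  have e2 : a * c * W = B * (b * d) := by
    rw [er', es', div_mul_div_comm, div_eq_div_iff (mul_ne_zero hb' hd') hWq] at hmul
    exact_mod_cast hmul
  have hbd : b * d ≠ 0 := by exact_mod_cast mul_ne_zero hb' hd'
  -- The triple (bd, ad + cb, ac) is primitive, so the proportional integral triple (W, A, B) is an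
  -- integral multiple of it.
  obtain ⟨k, hk⟩ : b * d ∣ W := by
    obtain ⟨m, hm, hm1, hm2⟩ := exists_eq_mul_num_den (r := (W : ℚ) / (b * d : ℤ)) hbd rfl
    set q := (W : ℚ) / (b * d : ℤ)
    have hcop : IsCoprime (q.den : ℤ) q.num := (Rat.isCoprime_num_den q).symm
    have f1 : (q.den : ℤ) ∣ a * d + c * b := hcop.dvd_of_dvd_mul_right
      ⟨A, mul_left_cancel₀ hm (by linear_combination e1 - (a * d + c * b) * hm1 + A * hm2)⟩
    have f2 : (q.den : ℤ) ∣ a * c := hcop.dvd_of_dvd_mul_right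
      ⟨B, mul_left_cancel₀ hm (by linear_combination e2 - (a * c) * hm1 + B * hm2)⟩
    have hu := isUnit_of_dvd_coeffs (Rat.isCoprime_num_den r) (Rat.isCoprime_num_den s)
      (Dvd.intro_left m hm2.symm) f2 f1
    rw [hm1, hm2]
    exact mul_dvd_mul_left m (hu.dvd)
  have hk0 : k ≠ 0 := by rintro rfl; exact hW (by rw [hk]; ring)
  have hA : A = k * (a * d + c * b) := mul_right_cancel₀ hbd (by rw [← e1, hk]; ring)
  have hB : B = k * (a * c) := mul_right_cancel₀ hbd (by rw [← e2, hk]; ring)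
  have : 1 ≤ k ^ 2 := by have := sq_pos_of_ne_zero hk0; omega
  have h1 := mul_nonneg (by linarith [one_le_quadHeight r] : 0 ≤ quadHeight r)
    (by linarith [one_le_quadHeight s] : 0 ≤ quadHeight s)
  -- Multiplicativity of the norm of a + b√−3.
  have h2 : (B - 3 * W) ^ 2 + 3 * A ^ 2 = k ^ 2 * (quadHeight r * quadHeight s) := by
    rw [hA, hB, hk]; unfold quadHeight; ring
  rw [h2]
  nlinarith

/-- The naive height of a point, normalised by the form `a² + 3 b²`. -/
def ptHeight : (piThirdCurve n).toAffine.Point → ℤ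
  | .zero => 1
  | .some x _ _ => quadHeight (x / n)

theorem one_le_ptHeight (P : (piThirdCurve n).toAffine.Point) : 1 ≤ ptHeight P := by
  cases P with
  | zero => exact le_rfl
  | some x y h => exact one_le_quadHeight _

theorem ptHeight_zero : ptHeight (0 : (piThirdCurve n).toAffine.Point) = 1 := rfl

theorem ptHeight_neg (P : (piThirdCurve n).toAffine.Point) : ptHeight (-P) = ptHeight P := by
  cases P with
  | zero => rfl
  | some x y h => rw [Point.neg_some]; rfl

/-- The integers of a point are bounded by its height. -/
theorem exists_int_coords (hn : n ≠ 0) {x y : ℚ}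
    (h : (piThirdCurve n).toAffine.Nonsingular x y) :
    ∃ u w : ℤ, IsCoprime u w ∧ 0 < w ∧ x = n * u / w ∧ quadHeight (x / n) = u ^ 2 + 3 * w ^ 2 ∧
      0 ≤ u * w * (u - w) * (u + 3 * w) := by
  have hnq : (n : ℚ) ≠ 0 := by exact_mod_cast hn
  have hd : ((x / n).den : ℚ) ≠ 0 := by exact_mod_cast (x / n).den_nz
  have hx : x = n * ((x / n).num : ℚ) / (((x / n).den : ℤ) : ℚ) := by
    have h1 := Rat.num_div_den (x / n)
    push_cast
    rw [mul_div_assoc, h1]; field_simp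
  have hpos : (0 : ℤ) < (x / n).den := by exact_mod_cast (x / n).den_pos
  have hcop : IsCoprime (x / n).num ((x / n).den : ℤ) := Rat.isCoprime_num_den _
  have hq : quadHeight (x / n) = (x / n).num ^ 2 + 3 * ((x / n).den : ℤ) ^ 2 := rfl
  generalize (x / n).num = u at *
  generalize ((x / n).den : ℤ) = w at *
  refine ⟨u, w, hcop, hpos, hx, hq, ?_⟩
  have hw0 : (w : ℚ) ≠ 0 := by exact_mod_cast hpos.ne'
  have heq := (piThirdCurve_nonsingular_iff hn).mp h
  have hnpos : (0 : ℚ) < n := by positivity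
  have h2 : ((u * w * (u - w) * (u + 3 * w) : ℤ) : ℚ) = y ^ 2 * w ^ 4 / n ^ 3 := by
    rw [heq, hx]; push_cast; field_simp
  have h3 : (0 : ℚ) ≤ ((u * w * (u - w) * (u + 3 * w) : ℤ) : ℚ) := by rw [h2]; positivity
  exact_mod_cast h3

/-- The parallelogram inequality for the naive height. -/
theorem ptHeight_add_mul_ptHeight_sub_le (hn : n ≠ 0) {P Q : (piThirdCurve n).toAffine.Point}
    (h1 : P ≠ Q) (h2 : P ≠ -Q) :
    ptHeight (P + Q) * ptHeight (P - Q) ≤ 4 * (ptHeight P * ptHeight Q) ^ 2 := by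
  have hnq : (n : ℚ) ≠ 0 := by exact_mod_cast hn
  cases P with
  | zero =>
    rw [← Point.zero_def, zero_add, zero_sub, ptHeight_neg, ptHeight_zero]
    nlinarith [one_le_ptHeight Q]
  | some x₁ y₁ hP =>
  cases Q with
  | zero =>
    rw [← Point.zero_def, add_zero, sub_zero, ptHeight_zero]
    nlinarith [one_le_ptHeight (Point.some x₁ y₁ hP)]
  | some x₂ y₂ hQ =>
  have e1 := (piThirdCurve_nonsingular_iff hn).mp hP
  have e2 := (piThirdCurve_nonsingular_iff hn).mp hQ
  have hx : x₁ ≠ x₂ := by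
    rintro rfl
    rcases sq_eq_sq_iff_eq_or_eq_neg.mp (e1.trans e2.symm) with rfl | rfl
    · exact h1 rfl
    · exact h2 (by rw [Point.neg_some]; simp only [piThirdCurve_negY])
  have hx' := sub_ne_zero.mpr hx
  obtain ⟨l, x₃, y₃, h₃, hs, -, hc, hl⟩ := exists_line hP hQ fun h => hx h.1
  have hQ' : (piThirdCurve n).toAffine.Nonsingular x₂ (-y₂) := by
    rw [piThirdCurve_nonsingular_iff hn]; rw [← e2]; ring
  obtain ⟨l', x₄, y₄, h₄, hs', -, hc', hl'⟩ := exists_line hP hQ' fun h => hx h.1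
  have hneg : -Point.some x₂ y₂ hQ = Point.some x₂ (-y₂) hQ' := by
    rw [Point.neg_some]; simp only [piThirdCurve_negY]
  rw [sub_eq_add_neg, hneg, hs, hs']
  obtain ⟨u₁, w₁, -, hw₁, hx₁, hq₁, hG₁⟩ := exists_int_coords hn hP
  obtain ⟨u₂, w₂, -, hw₂, hx₂, hq₂, hG₂⟩ := exists_int_coords hn hQ
  simp only [ptHeight]
  rw [hq₁, hq₂]
  have hw₁q : (w₁ : ℚ) ≠ 0 := by exact_mod_cast hw₁.ne'
  have hw₂q : (w₂ : ℚ) ≠ 0 := by exact_mod_cast hw₂.ne'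
  have hl2 : l * (x₁ - x₂) = y₁ - y₂ := by rw [hl hx]; field_simp
  have hl2' : l' * (x₁ - x₂) = y₁ + y₂ := by rw [hl' hx]; field_simp; ring
  have s3 : x₃ = l ^ 2 - 2 * n - x₁ - x₂ := by linear_combination (hc 1 + hc (-1) - 2 * hc 0) / (2)
  have s4 : x₄ = l' ^ 2 - 2 * n - x₁ - x₂ := by
    linear_combination (hc' 1 + hc' (-1) - 2 * hc' 0) / (2)
  have s3' : x₃ * (x₁ - x₂) ^ 2 = (y₁ - y₂) ^ 2 - (2 * n + x₁ + x₂) * (x₁ - x₂) ^ 2 := by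
    rw [← hl2, s3]; ring
  have s4' : x₄ * (x₁ - x₂) ^ 2 = (y₁ + y₂) ^ 2 - (2 * n + x₁ + x₂) * (x₁ - x₂) ^ 2 := by
    rw [← hl2', s4]; ring
  have hW : (u₁ * w₂ - u₂ * w₁) ≠ 0 := by
    intro h
    have h' : (u₁ : ℚ) * w₂ - u₂ * w₁ = 0 := by exact_mod_cast h
    apply hx'
    rw [hx₁, hx₂]; field_simp; linear_combination n * h'
  have hWq : (u₁ : ℚ) * w₂ - u₂ * w₁ ≠ 0 := by exact_mod_cast hW
  -- The abscissas of P + Q and P − Q are exchanged by y₂ ↦ −y₂, so their sum and product involve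
  -- only x₁ and x₂.
  have hsum : (x₃ + x₄) * (x₁ - x₂) ^ 2 = 2 * (x₁ + x₂) * (x₁ * x₂ - 3 * n ^ 2) +
      8 * n * x₁ * x₂ := by
    linear_combination s3' + s4' + 2 * e1 + 2 * e2
  have hprod : x₃ * x₄ * (x₁ - x₂) ^ 2 = (x₁ * x₂ + 3 * n ^ 2) ^ 2 := by
    have h4 : x₃ * x₄ * (x₁ - x₂) ^ 2 * (x₁ - x₂) ^ 2 =
        (x₁ * x₂ + 3 * n ^ 2) ^ 2 * (x₁ - x₂) ^ 2 := by
      calc _ = (x₃ * (x₁ - x₂) ^ 2) * (x₄ * (x₁ - x₂) ^ 2) := by ring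
        _ = (y₁ ^ 2 - y₂ ^ 2) ^ 2 - 2 * ((2 * n + x₁ + x₂) * (x₁ - x₂) ^ 2) * (y₁ ^ 2 + y₂ ^ 2) +
            ((2 * n + x₁ + x₂) * (x₁ - x₂) ^ 2) ^ 2 := by rw [s3', s4']; ring
        _ = _ := by rw [e1, e2]; ring
    exact mul_right_cancel₀ (pow_ne_zero 2 hx') h4
  have hd : (x₁ - x₂) ^ 2 = n ^ 2 * (u₁ * w₂ - u₂ * w₁) ^ 2 / (w₁ * w₂) ^ 2 := by
    rw [hx₁, hx₂]; field_simp
  refine (quadHeight_mul_le (A := 2 * (u₁ * w₂ + u₂ * w₁) * (u₁ * u₂ - 3 * w₁ * w₂) +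
    8 * u₁ * u₂ * w₁ * w₂) (B := (u₁ * u₂ + 3 * w₁ * w₂) ^ 2)
    (pow_ne_zero 2 hW) ?_ ?_).trans ?_
  · have h5 : x₃ + x₄ = (2 * (x₁ + x₂) * (x₁ * x₂ - 3 * n ^ 2) +
      8 * n * x₁ * x₂) / (x₁ - x₂) ^ 2 := by rw [← hsum]; field_simp
    rw [← add_div, h5, hd, hx₁, hx₂]
    push_cast
    field_simp
  · have h5 : x₃ * x₄ = (x₁ * x₂ + 3 * n ^ 2) ^ 2 / (x₁ - x₂) ^ 2 := by rw [← hprod]; field_simp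
    rw [div_mul_div_comm, h5, hd, hx₁, hx₂]
    push_cast
    field_simp
  -- With N = u² + 3w² and G = uw(u − w)(u + 3w), the bound from `quadHeight_mul_le` equals N₁²N₂² +
  -- 48G₁G₂. Since N² − 4G is a square and G ≥ 0 on points, this is at most 4N₁²N₂².
  · have k1 : ∀ u w : ℤ, 4 * (u * w * (u - w) * (u + 3 * w)) ≤ (u ^ 2 + 3 * w ^ 2) ^ 2 :=
      fun u w => by nlinarith [sq_nonneg (u ^ 2 - 2 * u * w - 3 * w ^ 2)]
    have k2 := mul_le_mul (k1 u₁ w₁) (k1 u₂ w₂) (by linarith) (by positivity)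
    linear_combination 3 * k2

/-- The duplication formula for the abscissa. -/
theorem exists_two_nsmul_some {x y : ℚ} (h : (piThirdCurve n).toAffine.Nonsingular x y)
    (hn : n ≠ 0) (hy : y ≠ 0) :
    ∃ (x₃ y₃ : ℚ) (h₃ : (piThirdCurve n).toAffine.Nonsingular x₃ y₃),
      2 • Point.some x y h = Point.some x₃ y₃ h₃ ∧ x₃ * (4 * y ^ 2) = (x ^ 2 + 3 * n ^ 2) ^ 2 := by
  have heq := (piThirdCurve_nonsingular_iff hn).mp h
  obtain ⟨l, x₃, y₃, h₃, hs, -, hc, -⟩ := exists_line h h fun h => hy (by linarith [h.2])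
  refine ⟨x₃, y₃, h₃, by rw [two_nsmul, hs], ?_⟩
  have s : x₃ = l ^ 2 - 2 * n - x - x := by linear_combination (hc 1 + hc (-1) - 2 * hc 0) / (2)
  have hl : 2 * l * y = 3 * x ^ 2 + 4 * n * x - 3 * n ^ 2 := by
    linear_combination -(hc 1 - hc (-1)) / 2 - 2 * x * s
  have h4 : x₃ * (4 * y ^ 2) = (2 * l * y) ^ 2 - 8 * (n + x) * y ^ 2 := by rw [s]; ring
  rw [h4, hl, heq]; ring

/-- The numerator and denominator of the abscissa of a double, up to a common factor. -/
theorem exists_ptHeight_two_nsmul {x y : ℚ} (h : (piThirdCurve n).toAffine.Nonsingular x y)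
    (hn : n ≠ 0) (hy : y ≠ 0) {u w : ℤ} (hw : w ≠ 0) (hx : x = n * u / w) :
    ∃ k : ℤ, k ∣ (u ^ 2 + 3 * w ^ 2) ^ 2 ∧ k ∣ 4 * (u * w * (u - w) * (u + 3 * w)) ∧
      (u ^ 2 + 3 * w ^ 2) ^ 4 ≤ k ^ 2 * ptHeight (2 • Point.some x y h) := by
  have hnq : (n : ℚ) ≠ 0 := by exact_mod_cast hn
  have hwq : (w : ℚ) ≠ 0 := by exact_mod_cast hw
  have heq := (piThirdCurve_nonsingular_iff hn).mp h
  obtain ⟨x₃, y₃, h₃, hs, h3⟩ := exists_two_nsmul_some h hn hy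
  have hG : ((u * w * (u - w) * (u + 3 * w) : ℤ) : ℚ) = y ^ 2 * w ^ 4 / n ^ 3 := by
    rw [heq, hx]; push_cast; field_simp
  have hG0 : 4 * (u * w * (u - w) * (u + 3 * w)) ≠ 0 := by
    refine mul_ne_zero (by norm_num) ?_
    have : ((u * w * (u - w) * (u + 3 * w) : ℤ) : ℚ) ≠ 0 := by rw [hG]; positivity
    exact_mod_cast this
  obtain ⟨k, -, h1, h2⟩ := exists_eq_mul_num_den (r := x₃ / n) (a := (u ^ 2 + 3 * w ^ 2) ^ 2) hG0 (by
    have : x₃ = (x ^ 2 + 3 * n ^ 2) ^ 2 / (4 * y ^ 2) := by rw [← h3]; field_simp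
    rw [this, Int.cast_mul 4, hG, hx]
    push_cast
    field_simp)
  refine ⟨k, Dvd.intro _ h1.symm, Dvd.intro _ h2.symm, ?_⟩
  rw [hs]
  have : k ^ 2 * ptHeight (Point.some x₃ y₃ h₃) = ((u ^ 2 + 3 * w ^ 2) ^ 2) ^ 2 +
      3 * (4 * (u * w * (u - w) * (u + 3 * w))) ^ 2 := by
    rw [h1, h2]; simp only [ptHeight, quadHeight]; ring
  rw [this]
  nlinarith [sq_nonneg (4 * (u * w * (u - w) * (u + 3 * w)))]

theorem isCoprime_of_dvd_form {k u w : ℤ} (hc : IsCoprime u w)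
    (h1 : k ∣ (u ^ 2 + 3 * w ^ 2) ^ 2) : IsCoprime k w := by
  have h2 : IsCoprime (u ^ 2 + 3 * w ^ 2) w := by
    have : u ^ 2 + 3 * w ^ 2 = u ^ 2 + w * (3 * w) := by ring
    rw [this]
    exact IsCoprime.add_mul_left_left (hc.pow_left) _
  exact (h2.pow_left).of_isCoprime_of_dvd_left h1

/-- The common factor in the duplication formula divides a constant. -/
theorem dvd_const_of_dvd_form {k u w : ℤ} (hc : IsCoprime u w)
    (h1 : k ∣ (u ^ 2 + 3 * w ^ 2) ^ 2) (h2 : k ∣ 4 * (u * w * (u - w) * (u + 3 * w))) :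
    k ∣ 82944 := by
  have hk := isCoprime_of_dvd_form hc h1
  have hk4 : IsCoprime k (w ^ 4) := hk.pow_right
  -- The factors u, u − w, u + 3w are eliminated in turn. Modulo each, (u² + 3w²)² is w⁴ times 9, 16
  -- and 144 respectively, and 4·9·16·144 = 82944.
  have a1 : k ∣ 4 * (u * (u - w) * (u + 3 * w)) := hk.dvd_of_dvd_mul_left (by
    rwa [show w * (4 * (u * (u - w) * (u + 3 * w))) = 4 * (u * w * (u - w) * (u + 3 * w)) by ring])
  have a2 : k ∣ 36 * ((u - w) * (u + 3 * w)) := hk4.dvd_of_dvd_mul_left (by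
    have := (h1.mul_right (4 * ((u - w) * (u + 3 * w)))).sub (a1.mul_right (u ^ 3 + 6 * u * w ^ 2))
    convert this using 1; ring)
  have a3 : k ∣ 576 * (u + 3 * w) := hk4.dvd_of_dvd_mul_left (by
    have := (h1.mul_right (36 * (u + 3 * w))).sub
      (a2.mul_right ((u + w) * (u ^ 2 + 7 * w ^ 2)))
    convert this using 1; ring)
  refine hk4.dvd_of_dvd_mul_left ?_
  have := (h1.mul_right 576).sub
    (a3.mul_right ((u - 3 * w) * (u ^ 2 + 15 * w ^ 2)))
  convert this using 1; ring

/-- The naive height of a double is at least a constant times the fourth power. -/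
theorem ptHeight_pow_four_le (hn : n ≠ 0) (P : (piThirdCurve n).toAffine.Point) :
    ptHeight P ^ 4 ≤ 82944 ^ 2 * ptHeight (2 • P) := by
  have h1 := one_le_ptHeight (2 • P)
  have hnq : (n : ℚ) ≠ 0 := by exact_mod_cast hn
  cases P with
  | zero => rw [← Point.zero_def, ptHeight_zero, two_nsmul, add_zero, ptHeight_zero]; norm_num
  | some x y h =>
  by_cases hy : y = 0
  · subst hy
    have heq := (piThirdCurve_nonsingular_iff hn).mp h
    have h0 : x * (x - n) * (x + 3 * n) = 0 := by rw [← heq]; ring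
    -- The three points of order two have heights 3, 4 and 12.
    have h12 : ptHeight (Point.some x 0 h) ≤ 12 := by
      simp only [ptHeight]
      rcases mul_eq_zero.mp h0 with h0 | h3
      · rcases mul_eq_zero.mp h0 with rfl | h0
        · rw [zero_div]; decide
        · rw [sub_eq_zero.mp h0, div_self hnq]; decide
      · rw [eq_neg_of_add_eq_zero_left h3, ← neg_mul, mul_div_assoc, div_self hnq]
        have : (-3 * 1 : ℚ) = ((-3 : ℤ) : ℚ) := by norm_num
        rw [this, quadHeight, Rat.num_intCast, Rat.den_intCast]; norm_num
    have h0 := one_le_ptHeight (Point.some x 0 h)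
    have := pow_le_pow_left₀ (by linarith) h12 4
    linarith
  · obtain ⟨u, w, hc, hw, hx, hq, -⟩ := exists_int_coords hn h
    obtain ⟨k, k1, k2, k3⟩ := exists_ptHeight_two_nsmul h hn hy hw.ne' hx
    have hk := dvd_const_of_dvd_form hc k1 k2
    have hk' : k ^ 2 ≤ 82944 ^ 2 := Int.le_of_dvd (by norm_num) (pow_dvd_pow_of_dvd hk 2)
    have : ptHeight (Point.some x y h) = u ^ 2 + 3 * w ^ 2 := hq
    rw [this]
    exact k3.trans (mul_le_mul_of_nonneg_right hk' (by linarith))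

/-- There are finitely many points of bounded height. -/
theorem finite_ptHeight_le (hn : n ≠ 0) (M : ℤ) :
    {P : (piThirdCurve n).toAffine.Point | ptHeight P ≤ M}.Finite := by
  have hnq : (n : ℚ) ≠ 0 := by exact_mod_cast hn
  let f : (piThirdCurve n).toAffine.Point → ℚ := fun P => match P with
    | .zero => 0
    | .some x _ _ => x
  refine Set.Finite.of_finite_fibers f ?_ ?_
  · refine ((((Set.finite_Icc (-M) M).prod (Set.finite_Icc (-M) M)).image
      fun p : ℤ × ℤ => (n * p.1 / p.2 : ℚ)).union (Set.finite_singleton 0)).subset ?_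
    rintro _ ⟨P, hP, rfl⟩
    cases P with
    | zero => exact .inr rfl
    | some x y h =>
      obtain ⟨u, w, -, hw, hx, hq, -⟩ := exists_int_coords hn h
      have hq' : u ^ 2 + 3 * w ^ 2 ≤ M := hq ▸ hP
      refine .inl ⟨(u, w), ⟨⟨?_, ?_⟩, ?_, ?_⟩, hx.symm⟩ <;> simp only <;> nlinarith
  · rintro _ ⟨P, -, rfl⟩
    -- The point at infinity was sent to the abscissa 0, so its fibre also contains (0,0).
    refine (Set.toFinite {0, P, -P, torsionZero hn}).subset ?_
    rintro Q ⟨-, hQ⟩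
    cases Q with
    | zero => exact .inl rfl
    | some x y h =>
    cases P with
    | zero =>
      have h0 : x = 0 := hQ
      subst h0
      have hy : y = 0 := by simpa using (piThirdCurve_nonsingular_iff hn).mp h
      subst hy
      exact .inr (.inr (.inr rfl))
    | some x' y' h' =>
      have hx : x = x' := hQ
      subst hx
      have e1 := (piThirdCurve_nonsingular_iff hn).mp h
      have e2 := (piThirdCurve_nonsingular_iff hn).mp h'
      rcases sq_eq_sq_iff_eq_or_eq_neg.mp (e1.trans e2.symm) with rfl | rfl
      · exact .inr (.inl rfl)
      · refine .inr (.inr (.inl ?_))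
        rw [Point.neg_some]; simp only [piThirdCurve_negY]

/-! ### Descent and finite generation. -/

/-- One step of the descent: a point outside a subgroup, congruent to a point of the subgroup
modulo doubles, gives a point outside the subgroup whose double has controlled height. -/
theorem exists_descent_step (hn : n ≠ 0) (G : AddSubgroup (piThirdCurve n).toAffine.Point)
    {Q g R : (piThirdCurve n).toAffine.Point} (hQ : Q ∉ G) (hg : g ∈ G) (h : Q = g + 2 • R) :
    ∃ R' ∉ G, ptHeight (2 • R') ≤ 2 * (ptHeight Q * ptHeight g) := by
  have hR : R ∉ G := fun hR => hQ (h ▸ G.add_mem hg (G.nsmul_mem hR 2))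
  have hRg : R + g ∉ G := fun h' => hR (by simpa using G.sub_mem h' hg)
  have hp := ptHeight_add_mul_ptHeight_sub_le hn (P := Q) (Q := g) (fun h => hQ (h ▸ hg))
    (fun h => hQ (h ▸ G.neg_mem hg))
  -- Both Q + g and Q − g are doubles of points outside the subgroup. Their heights have product at
  -- most 4(H(Q)H(g))², so one of them is at most 2H(Q)H(g).
  have e1 : Q + g = 2 • (R + g) := by rw [h]; abel
  have e2 : Q - g = 2 • R := by rw [h]; abel
  rw [e1, e2] at hp
  have h0 : 0 ≤ ptHeight Q * ptHeight g :=
    mul_nonneg (by linarith [one_le_ptHeight Q]) (by linarith [one_le_ptHeight g])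
  by_contra! hcon
  have h1 := hcon R hR
  have h2 := hcon (R + g) hRg
  nlinarith [mul_lt_mul'' h1 h2 (by linarith) (by linarith)]

/-- The Mordell–Weil theorem from its weak form. -/
theorem fg_of_finite_reps (hn : n ≠ 0) {S : Set (piThirdCurve n).toAffine.Point} (hS : S.Finite)
    (h : ∀ Q : (piThirdCurve n).toAffine.Point, ∃ g ∈ S, ∃ R, Q = g + 2 • R) :
    AddGroup.FG (piThirdCurve n).toAffine.Point := by
  obtain ⟨B, hB⟩ : ∃ B, ∀ g ∈ S, ptHeight g ≤ B := by
    obtain ⟨B, hB⟩ := (hS.image ptHeight).bddAbove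
    exact ⟨B, fun g hg => hB ⟨g, hg, rfl⟩⟩
  -- For Q of least height outside the subgroup, H(Q)⁴ ≤ 82944²·2·H(Q)·B, hence H(Q)³ ≤ M and Q is
  -- already among the generators.
  set M : ℤ := 2 * 82944 ^ 2 * B
  set U := S ∪ {P | ptHeight P ≤ M} with hU
  have hUf : U.Finite := hS.union (finite_ptHeight_le hn M)
  refine ⟨⟨hUf.toFinset, ?_⟩⟩
  rw [Set.Finite.coe_toFinset]
  set G := AddSubgroup.closure U
  by_contra hne
  have hex : ∃ k : ℕ, ∃ Q ∉ G, (ptHeight Q).toNat = k := by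
    by_contra! hcon
    exact hne (eq_top_iff.mpr fun Q _ => by by_contra hQ; exact hcon _ Q hQ rfl)
  classical
  obtain ⟨Q, hQ, hQk⟩ := Nat.find_spec hex
  have hmin : ∀ Q' ∉ G, ptHeight Q ≤ ptHeight Q' := fun Q' hQ' => by
    have := Nat.find_min' hex ⟨Q', hQ', rfl⟩
    rw [← hQk] at this
    have h1 := one_le_ptHeight Q
    have h2 := one_le_ptHeight Q'
    omega
  obtain ⟨g, hg, R, hR⟩ := h Q
  obtain ⟨R', hR', hle⟩ := exists_descent_step hn G hQ (AddSubgroup.subset_closure (.inl hg)) hR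
  have h1 := one_le_ptHeight Q
  have h2 := pow_le_pow_left₀ (by linarith) (hmin R' hR') 4
  have h3 := ptHeight_pow_four_le hn R'
  have h4 := hB g hg
  refine hQ (AddSubgroup.subset_closure (.inr ?_))
  have h5 : ptHeight Q ^ 4 ≤ ptHeight Q * M := by nlinarith
  have h6 : ptHeight Q ^ 3 ≤ M := by
    refine le_of_mul_le_mul_left ?_ (by linarith : 0 < ptHeight Q)
    linarith [pow_succ' (ptHeight Q) 3]
  have h7 : ptHeight Q ≤ ptHeight Q ^ 3 := le_self_pow₀ h1 (by norm_num)
  exact h7.trans h6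

/-! ### Independence and rank from information modulo two. -/

/-- Descent criterion for linear independence: if every relation modulo two-torsion is divisible
by two, then there is no relation. -/
theorem linearIndependent_of_even {M : Type*} [AddCommGroup M] {r : ℕ} (v : Fin r → M)
    (h : ∀ a : Fin r → ℤ, 2 • ∑ i, a i • v i = 0 →
      ∃ b : Fin r → ℤ, (∀ i, a i = 2 * b i) ∧ 2 • ∑ i, b i • v i = 0) :
    LinearIndependent ℤ v := by
  rw [Fintype.linearIndependent_iff]
  intro a ha i
  have key : ∀ (k : ℕ) (a : Fin r → ℤ), 2 • ∑ i, a i • v i = 0 → (2 : ℤ) ^ k ∣ a i := by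
    intro k
    induction k with
    | zero => intro a _; simp
    | succ k ih =>
      intro a ha
      obtain ⟨b, hb, hb0⟩ := h a ha
      rw [hb i, pow_succ']
      exact mul_dvd_mul_left 2 (ih b hb0)
  by_contra hne
  -- A nonzero coefficient a would be divisible by 2^|a| > |a|.
  have h1 := Int.le_of_dvd (abs_pos.mpr hne)
    ((dvd_abs _ _).mpr (key (a i).natAbs a (by rw [ha, smul_zero])))
  have h2 : (a i).natAbs < 2 ^ (a i).natAbs := Nat.lt_two_pow_self
  have h3 : ((a i).natAbs : ℤ) < 2 ^ (a i).natAbs := by exact_mod_cast h2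
  rw [Int.natCast_natAbs] at h3
  linarith

theorem mem_torsion_of_two_nsmul {M : Type*} [AddCommGroup M] {T : M} (hT : 2 • T = 0) :
    T ∈ Submodule.torsion ℤ M := by
  rw [Submodule.mem_torsion_iff]
  exact ⟨⟨2, by simp⟩, by
    simpa [Submonoid.smul_def, two_smul] using (two_nsmul T).symm.trans hT⟩

/-- The rank of a finitely generated group that is generated modulo doubles by independent
elements and torsion. -/
theorem finrank_eq_of_generates_mod_two {M : Type*} [AddCommGroup M] [Module.Finite ℤ M] {r : ℕ}
    {v : Fin r → M} (hv : LinearIndependent ℤ v)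
    (h : ∀ Q : M, ∃ g ∈ Submodule.span ℤ (Set.range v), ∃ T R : M, 2 • T = 0 ∧ Q = g + T + 2 • R) :
    Module.finrank ℤ M = r := by
  set N := Submodule.span ℤ (Set.range v) with hN
  have htors : Module.finrank ℤ (M ⧸ N) = 0 := by
    rw [Module.finrank_eq_zero_iff_isTorsion]
    set N' := (N ⊔ Submodule.torsion ℤ M)
    -- The quotient equals its own double and is finitely generated, so by Nakayama an odd, hence
    -- nonzero, integer annihilates it.
    have hle : (⊤ : Submodule ℤ (M ⧸ N')) ≤ (Ideal.span {(2 : ℤ)}) • ⊤ := by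
      rintro x -
      obtain ⟨Q, rfl⟩ := Submodule.Quotient.mk_surjective _ x
      obtain ⟨g, hg, T, R, hT, rfl⟩ := h Q
      have hT' := mem_torsion_of_two_nsmul hT
      have h0 : (Submodule.Quotient.mk (g + T) : M ⧸ N') = 0 :=
        (Submodule.Quotient.mk_eq_zero _).mpr (Submodule.add_mem_sup hg hT')
      rw [Submodule.Quotient.mk_add, h0, zero_add, Submodule.Quotient.mk_smul,
        ← Nat.cast_smul_eq_nsmul ℤ]
      exact Submodule.smul_mem_smul (Ideal.subset_span rfl) trivial
    obtain ⟨s, hs, hs0⟩ := Submodule.exists_sub_one_mem_and_smul_eq_zero_of_fg_of_le_smul _ _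
      Module.Finite.fg_top hle
    have hsne : s ≠ 0 := by
      rintro rfl
      rw [Ideal.mem_span_singleton] at hs
      omega
    intro x
    obtain ⟨Q, rfl⟩ := Submodule.Quotient.mk_surjective _ x
    have h1 := hs0 (Submodule.Quotient.mk Q) trivial
    rw [← Submodule.Quotient.mk_smul, Submodule.Quotient.mk_eq_zero, Submodule.mem_sup] at h1
    obtain ⟨g, hg, T, hT, hgT⟩ := h1
    rw [Submodule.mem_torsion_iff] at hT
    obtain ⟨⟨m, hm⟩, hmT⟩ := hT
    refine ⟨⟨m * s, mul_mem hm (mem_nonZeroDivisors_of_ne_zero hsne)⟩, ?_⟩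
    change (m * s) • (Submodule.Quotient.mk Q : M ⧸ N) = 0
    have hmT' : m • T = 0 := hmT
    rw [← Submodule.Quotient.mk_smul, Submodule.Quotient.mk_eq_zero, mul_smul, ← hgT, smul_add,
      hmT', add_zero]
    exact N.smul_mem m hg
  have h1 := Submodule.finrank_quotient_add_finrank N
  rw [htors, zero_add] at h1
  rw [← h1, hN, finrank_span_eq_card hv, Fintype.card_fin]

/-- Six points followed by two points of order two. -/
noncomputable def withTorsion (hn : n ≠ 0) (v : Fin 6 → (piThirdCurve n).toAffine.Point) (k : ℕ) :
    (piThirdCurve n).toAffine.Point :=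
  if h : k < 6 then v ⟨k, h⟩ else if k = 6 then torsionZero hn else torsionSelf hn

theorem withTorsion_fin (hn : n ≠ 0) (v : Fin 6 → (piThirdCurve n).toAffine.Point) (k : Fin 6) :
    withTorsion hn v k = v k := by
  simp [withTorsion]

theorem withTorsion_six (hn : n ≠ 0) (v : Fin 6 → (piThirdCurve n).toAffine.Point) :
    withTorsion hn v 6 = torsionZero hn := by
  simp [withTorsion]

theorem withTorsion_seven (hn : n ≠ 0) (v : Fin 6 → (piThirdCurve n).toAffine.Point) :
    withTorsion hn v 7 = torsionSelf hn := by
  simp [withTorsion]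

/-- In a relation modulo two-torsion the first six functionals vanish on the torsion and force even
coefficients. The combination is then a double, and the last two functionals show that the only
two-torsion double occurring is 0, so the halved relation again holds modulo two-torsion. -/
theorem linearIndependent_of_dual (hn : n ≠ 0) (v : Fin 6 → (piThirdCurve n).toAffine.Point)
    (L : ℕ → (piThirdCurve n).toAffine.Point →+ ZMod 2)
    (hL : ∀ k < 8, ∀ l < 8, L k (withTorsion hn v l) = if k = l then 1 else 0) :
    LinearIndependent ℤ v := by
  have hv : ∀ k < 8, ∀ i : Fin 6, L k (v i) = if k = i then 1 else 0 := fun k hk i => by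
    rw [← withTorsion_fin hn v i]; exact hL k hk i (by omega)
  have h6 : ∀ k < 8, L k (torsionZero hn) = if k = 6 then 1 else 0 := fun k hk => by
    rw [← withTorsion_six hn v]; exact hL k hk 6 (by omega)
  have h7 : ∀ k < 8, L k (torsionSelf hn) = if k = 7 then 1 else 0 := fun k hk => by
    rw [← withTorsion_seven hn v]; exact hL k hk 7 (by omega)
  refine linearIndependent_of_even v fun a ha => ?_
  have hval : ∀ k < 8, L k (∑ i, a i • v i) = ∑ i : Fin 6, if k = i then (a i : ZMod 2) else 0 := by
    intro k hk
    rw [map_sum]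
    refine Finset.sum_congr rfl fun i _ => ?_
    rw [map_zsmul, hv k hk i]
    split_ifs <;> simp
  have heven : ∀ i, ∃ b : ℤ, a i = 2 * b := by
    intro i
    have h1 := hval i (by omega)
    simp only [Fin.val_inj, Finset.sum_ite_eq, Finset.mem_univ, if_true] at h1
    have h0 : L i (∑ i, a i • v i) = 0 := by
      rcases two_torsion_cases hn ha with h | h | h | h <;> rw [h]
      · exact map_zero _
      · rw [h6 _ (by omega), if_neg (by omega)]
      · rw [h7 _ (by omega), if_neg (by omega)]
      · rw [map_add, h6 _ (by omega), h7 _ (by omega), if_neg (by omega), if_neg (by omega),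
          add_zero]
    rw [h0] at h1
    exact (ZMod.intCast_zmod_eq_zero_iff_dvd _ 2).mp h1.symm
  choose b hb using heven
  refine ⟨b, hb, ?_⟩
  have hsum : ∑ i, a i • v i = 2 • ∑ i, b i • v i := by
    rw [Finset.smul_sum]
    refine Finset.sum_congr rfl fun i _ => ?_
    rw [hb i, mul_smul, ← Nat.cast_smul_eq_nsmul ℤ]; rfl
  rw [← hsum]
  have hz : ∀ k, L k (∑ i, a i • v i) = 0 := fun k => by
    rw [hsum, map_nsmul, two_nsmul, CharTwo.add_self_eq_zero]
  rcases two_torsion_cases hn ha with h | h | h | h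
  · exact h
  · have := hz 6; rw [h, h6 6 (by omega)] at this; exact absurd this (by decide)
  · have := hz 7; rw [h, h7 7 (by omega)] at this; exact absurd this (by decide)
  · have := hz 6
    rw [h, map_add, h6 6 (by omega), h7 6 (by omega)] at this; exact absurd this (by decide)

/-! ### Rank certificates and their numerical test. -/

/-- A certificate that the descent bound for the rank is attained by six given points. -/
structure RankSixCertificate (n : ℕ) (ps : List ℕ) (conds : List (LocalCondition × ℕ))
    (gens : List GenData) (v : Fin 6 → (piThirdCurve n).toAffine.Point) : Prop where
  bad : IsBadPrimes n ps
  length : gens.length = 8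
  span : spanCheck n ps conds gens = true
  dual : dualCheck (2 * (0 :: ps).length) gens = true
  hasClass : ∀ k : Fin 6, HasClass (v k) (gens.getD k ⟨fun _ => 0, 0, 0⟩).m
  class_zero : (gens.getD 6 ⟨fun _ => 0, 0, 0⟩).m = fun i => if i then -n else -3 * n ^ 2
  class_self : (gens.getD 7 ⟨fun _ => 0, 0, 0⟩).m = fun i => if i then 4 * n ^ 2 else n

namespace RankSixCertificate

variable {ps : List ℕ} {conds : List (LocalCondition × ℕ)} {gens : List GenData}
  {v : Fin 6 → (piThirdCurve n).toAffine.Point}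

theorem hasClass_withTorsion (C : RankSixCertificate n ps conds gens v) :
    ∀ k < gens.length,
      HasClass (withTorsion C.bad.ne_zero v k) (gens.getD k ⟨fun _ => 0, 0, 0⟩).m := by
  intro k hk
  rw [C.length] at hk
  rcases lt_or_ge k 6 with h | h
  · have := C.hasClass ⟨k, h⟩
    rwa [← withTorsion_fin C.bad.ne_zero v] at this
  · obtain rfl | rfl : k = 6 ∨ k = 7 := by omega
    · rw [withTorsion_six, C.class_zero]; exact torsionZero_hasClass _
    · rw [withTorsion_seven, C.class_self]; exact torsionSelf_hasClass _

theorem linearIndependent (C : RankSixCertificate n ps conds gens v) : LinearIndependent ℤ v := by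
  obtain ⟨L, hL⟩ := exists_dual C.bad C.span C.dual _ C.hasClass_withTorsion
  rw [C.length] at hL
  exact linearIndependent_of_dual _ v L hL

/-- Every point is a sum of some of the six points, a point of order two and a double. -/
theorem exists_eq_sum (C : RankSixCertificate n ps conds gens v)
    (Q : (piThirdCurve n).toAffine.Point) :
    ∃ (c : Fin 6 → ZMod 2) (T R : (piThirdCurve n).toAffine.Point), 2 • T = 0 ∧
      Q = ∑ k, (c k).val • v k + T + 2 • R := by
  obtain ⟨c, T, R, hT, hQ⟩ := exists_eq_sum_add_two_nsmul C.bad C.span _ _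
    C.hasClass_withTorsion Q
  rw [C.length, Finset.sum_range_succ, Finset.sum_range_succ, Finset.sum_range,
    withTorsion_six, withTorsion_seven] at hQ
  simp only [withTorsion_fin] at hQ
  refine ⟨fun k => c k, (c 6).val • torsionZero C.bad.ne_zero +
    (c 7).val • torsionSelf C.bad.ne_zero + T, R, ?_, by rw [hQ]; abel⟩
  rw [nsmul_add, nsmul_add, hT, nsmul_left_comm, two_nsmul_torsionZero, nsmul_left_comm,
    two_nsmul_torsionSelf, nsmul_zero, nsmul_zero, add_zero, add_zero]

theorem fg (C : RankSixCertificate n ps conds gens v) :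
    AddGroup.FG (piThirdCurve n).toAffine.Point := by
  have hn := C.bad.ne_zero
  refine fg_of_finite_reps hn (S := Set.range fun p : (Fin 6 → ZMod 2) × Bool × Bool =>
    ∑ k, (p.1 k).val • v k + ((if p.2.1 then torsionZero hn else 0) +
      (if p.2.2 then torsionSelf hn else 0))) (Set.finite_range _) fun Q => ?_
  obtain ⟨c, T, R, hT, hQ⟩ := C.exists_eq_sum Q
  rcases two_torsion_cases hn hT with h | h | h | h
  · exact ⟨_, Set.mem_range_self (c, false, false), R, by rw [hQ, h]; simp⟩
  · exact ⟨_, Set.mem_range_self (c, true, false), R, by rw [hQ, h]; simp⟩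
  · exact ⟨_, Set.mem_range_self (c, false, true), R, by rw [hQ, h]; simp⟩
  · exact ⟨_, Set.mem_range_self (c, true, true), R, by rw [hQ, h]; simp⟩

theorem mordellWeilRank_eq (C : RankSixCertificate n ps conds gens v) :
    mordellWeilRank (piThirdCurve n) = 6 := by
  have := C.fg
  have : Module.Finite ℤ (piThirdCurve n).toAffine.Point := Module.Finite.iff_addGroup_fg.mpr this
  refine finrank_eq_of_generates_mod_two C.linearIndependent fun Q => ?_
  obtain ⟨c, T, R, hT, hQ⟩ := C.exists_eq_sum Q
  refine ⟨∑ k, (c k).val • v k, Submodule.sum_mem _ fun k _ => ?_, T, R, hT, hQ⟩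
  exact nsmul_mem (Submodule.subset_span (Set.mem_range_self k)) _

end RankSixCertificate

/-- A computational test for integers to describe a rational point. -/
def repCheck (n : ℕ) (t : ℤ × ℤ × ℤ) : Bool :=
  Int.gcd t.1 t.2.1 == 1 && 0 < t.2.1 && t.2.2 != 0 &&
    n * t.2.2 ^ 2 == t.1 * t.2.1 * (t.1 - t.2.1) * (t.1 + 3 * t.2.1)

theorem isIntRep_of_repCheck {t : ℤ × ℤ × ℤ} (h : repCheck n t = true) :
    IsIntRep n t.1 t.2.1 t.2.2 := by
  simp only [repCheck, Bool.and_eq_true, beq_iff_eq, decide_eq_true_eq, bne_iff_ne, ne_eq] at h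
  exact ⟨Int.isCoprime_iff_gcd_eq_one.mpr h.1.1.1, h.1.1.2, h.2, h.1.2⟩

/-- The data of the generators given by integer triples and by the points of order two. -/
def genDataList (n : ℕ) (reps : Fin 6 → ℤ × ℤ × ℤ) (dual vec : Fin 8 → ℕ) : List GenData :=
  (List.ofFn fun k : Fin 6 => ⟨fun i => if i then n * ((reps k).1 - (reps k).2.1) * (reps k).2.1
    else n * (reps k).1 * (reps k).2.1, dual (Fin.castLE (by omega) k),
      vec (Fin.castLE (by omega) k)⟩) ++
  [⟨fun i => if i then -n else -3 * n ^ 2, dual 6, vec 6⟩,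
    ⟨fun i => if i then 4 * n ^ 2 else n, dual 7, vec 7⟩]

/-- The complete numerical test for the rank to be six. -/
def rankSixCheck (n : ℕ) (ps : List ℕ) (conds : List (LocalCondition × ℕ))
    (reps : Fin 6 → ℤ × ℤ × ℤ) (dual vec : Fin 8 → ℕ) : Bool :=
  spanCheck n ps conds (genDataList n reps dual vec) &&
  dualCheck (2 * (0 :: ps).length) (genDataList n reps dual vec) &&
  (List.finRange 6).all fun k => repCheck n (reps k)

theorem rankSixCertificate_of_check {ps : List ℕ} {conds : List (LocalCondition × ℕ)}
    {reps : Fin 6 → ℤ × ℤ × ℤ} {dual vec : Fin 8 → ℕ} (hb : IsBadPrimes n ps)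
    (h : rankSixCheck n ps conds reps dual vec = true)
    (hr : ∀ k, IsIntRep n (reps k).1 (reps k).2.1 (reps k).2.2) :
    RankSixCertificate n ps conds (genDataList n reps dual vec)
      fun k => (hr k).point hb.ne_zero := by
  simp only [rankSixCheck, Bool.and_eq_true] at h
  refine ⟨hb, rfl, h.1.1, h.1.2, fun k => ?_, rfl, rfl⟩
  have := (hr k).hasClass hb.ne_zero
  fin_cases k <;> exact this

theorem mordellWeilRank_eq_six_of_check {ps : List ℕ} {conds : List (LocalCondition × ℕ)}
    {reps : Fin 6 → ℤ × ℤ × ℤ} {dual vec : Fin 8 → ℕ} (hb : IsBadPrimes n ps)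
    (h : rankSixCheck n ps conds reps dual vec = true) :
    Squarefree n ∧ mordellWeilRank (piThirdCurve n) = 6 := by
  have h' := h
  simp only [rankSixCheck, Bool.and_eq_true, List.all_eq_true] at h'
  have hr : ∀ k, IsIntRep n (reps k).1 (reps k).2.1 (reps k).2.2 := fun k =>
    isIntRep_of_repCheck (h'.2 k (List.mem_finRange k))
  exact ⟨hb.squarefree, (rankSixCertificate_of_check hb h hr).mordellWeilRank_eq⟩

/-! ### Certificates for the eight further integers. -/

theorem isBadPrimes_167514827545 : IsBadPrimes 167514827545 [2, 3, 5, 13, 17, 73, 79, 97, 271] where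
  prime := by
    simp only [List.forall_mem_cons, List.not_mem_nil, false_imp_iff, implies_true]
    norm_num
  nodup := by decide
  two_mem := by decide
  three_mem := by decide
  dvd := by decide +kernel

/-- The index −1 and nine primes give twenty coordinates, filled by twelve conditions and eight
generators. The certificate needs no further condition, for instance no second one at 73. -/
theorem mordellWeilRank_167514827545 :
    Squarefree 167514827545 ∧ mordellWeilRank (piThirdCurve 167514827545) = 6 :=
  mordellWeilRank_eq_six_of_check isBadPrimes_167514827545
    (conds := [(.sign, 1281), (.two, 3655), (.three, 4024), (.first 5, 2579), (.second 5, 512),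
      (.first 13, 1104), (.second 13, 520), (.first 17, 3843), (.second 17, 2203),
      (.first 73, 2835), (.first 79, 1280), (.second 79, 1283)])
    (reps := ![(1241, 271, 2), (-9555, 4607, 126), (-2548, 26287, 938), (1663335, 1565296, 3112884),
      (-23305899, 8518343, 291252846), (1218162375, 721703623, 2969036447040)])
    (dual := ![512000, 40960, 602112, 159744, 1044480, 491520, 524288, 262144])
    (vec := ![125768, 119451, 24131, 219024, 193499, 149392, 699027, 349504])
    (by decide +kernel)

theorem isBadPrimes_198606002595 : IsBadPrimes 198606002595
    [2, 3, 5, 7, 11, 13, 17, 19, 31, 1321] where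
  prime := by
    simp only [List.forall_mem_cons, List.not_mem_nil, false_imp_iff, implies_true]
    norm_num
  nodup := by decide
  two_mem := by decide
  three_mem := by decide
  dvd := by decide +kernel

theorem mordellWeilRank_198606002595 :
    Squarefree 198606002595 ∧ mordellWeilRank (piThirdCurve 198606002595) = 6 :=
  mordellWeilRank_eq_six_of_check isBadPrimes_198606002595
    (conds := [(.sign, 2498), (.two, 6359), (.first 5, 6595), (.second 5, 10688), (.first 7, 1088),
      (.second 7, 4267), (.first 11, 6275), (.second 11, 8744), (.first 13, 3219),
      (.second 13, 3040), (.first 17, 2195), (.second 17, 520), (.first 19, 5376),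
      (.second 31, 15171)])
    (reps := ![(-8151, 6605, 216), (26979, 9247, 1104), (-64757, 25099, 2784), (-19437, 89828, 15498),
      (-166419, 1110961, 1940448), (-1245621, 785995, 3337728)])
    (dual := ![2211840, 983040, 3112960, 1671168, 1966080, 737280, 2097152, 1048576])
    (vec := ![420131, 496864, 842451, 662371, 1006451, 404515, 2796211, 1398096])
    (by decide +kernel)

theorem isBadPrimes_271314827665 : IsBadPrimes 271314827665
    [2, 3, 5, 7, 17, 23, 31, 43, 107, 139] where
  prime := by
    simp only [List.forall_mem_cons, List.not_mem_nil, false_imp_iff, implies_true]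
    norm_num
  nodup := by decide
  two_mem := by decide
  three_mem := by decide
  dvd := by decide +kernel

theorem mordellWeilRank_271314827665 :
    Squarefree 271314827665 ∧ mordellWeilRank (piThirdCurve 271314827665) = 6 :=
  mordellWeilRank_eq_six_of_check isBadPrimes_271314827665
    (conds := [(.sign, 170202), (.two, 170831), (.three, 32808), (.first 5, 640), (.second 5, 164360),
      (.first 7, 320), (.second 7, 137936), (.first 17, 4816), (.second 17, 6352),
      (.first 23, 166043), (.second 23, 131080), (.first 31, 166091), (.first 43, 170443),
      (.second 107, 164352)])
    (reps := ![(2193, 695, 6), (78217, 3197, 2464), (148955, 148869, 2046), (203728, 21545, 28124),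
      (453871, 53793, 148830), (-265788, 728221, 1166490)])
    (dual := ![877568, 1909760, 4014080, 1597440, 2368512, 3416064, 2097152, 1048576])
    (vec := ![456984, 674624, 897160, 727552, 832968, 733139, 2796179, 1398080])
    (by decide +kernel)

theorem isBadPrimes_3302971161265 : IsBadPrimes 3302971161265
    [2, 3, 5, 19, 29, 31, 37, 79, 101, 131] where
  prime := by
    simp only [List.forall_mem_cons, List.not_mem_nil, false_imp_iff, implies_true]
    norm_num
  nodup := by decide
  two_mem := by decide
  three_mem := by decide
  dvd := by decide +kernel

theorem mordellWeilRank_3302971161265 :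
    Squarefree 3302971161265 ∧ mordellWeilRank (piThirdCurve 3302971161265) = 6 :=
  mordellWeilRank_eq_six_of_check isBadPrimes_3302971161265
    (conds := [(.sign, 3018), (.two, 8079), (.three, 32800), (.first 5, 1296), (.second 5, 520),
      (.first 19, 4352), (.second 19, 35928), (.first 29, 1104), (.second 29, 35264),
      (.second 31, 34704), (.first 37, 1360), (.second 37, 1944), (.first 79, 6859),
      (.first 101, 2715)])
    (reps := ![(-11211, 3799, 6), (-51529, 92093, 6810), (-978123, 1604095, 2168658),
      (10418821, 1748981, 27373528), (-8311255, 19859731, 268652906),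
      (1160458380, 646215271, 601524514422)])
    (dual := ![614400, 3825664, 2187264, 983040, 4071424, 2228224, 2097152, 1048576])
    (vec := ![635227, 343243, 837403, 288320, 26763, 243600, 2796179, 1398080])
    (by decide +kernel)

theorem isBadPrimes_3492293850595 : IsBadPrimes 3492293850595
    [2, 3, 5, 11, 17, 19, 41, 113, 151, 281] where
  prime := by
    simp only [List.forall_mem_cons, List.not_mem_nil, false_imp_iff, implies_true]
    norm_num
  nodup := by decide
  two_mem := by decide
  three_mem := by decide
  dvd := by decide +kernel

theorem mordellWeilRank_3492293850595 :
    Squarefree 3492293850595 ∧ mordellWeilRank (piThirdCurve 3492293850595) = 6 :=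
  mordellWeilRank_eq_six_of_check isBadPrimes_3492293850595
    (conds := [(.sign, 1105), (.two, 276), (.three, 2547), (.first 5, 1344), (.second 5, 25240),
      (.first 11, 17744), (.second 11, 10312), (.first 17, 64), (.second 17, 1472),
      (.first 19, 16640), (.second 19, 19160), (.first 41, 17424), (.second 41, 17040),
      (.second 151, 26307)])
    (reps := ![(-9348, 4777, 30), (140581, 61820, 7994), (-228657, 95540, 10842),
      (-5511349, 4320656, 22349388), (70077741, 1405, 11766888),
      (129544565929, 34762869680, 5345979908554684)])
    (dual := ![3182592, 3837952, 2396160, 1474560, 3440640, 4165632, 2097152, 1048576])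
    (vec := ![893779, 615424, 365075, 682819, 720144, 82944, 2796179, 1398080])
    (by decide +kernel)

theorem isBadPrimes_6634009064865 : IsBadPrimes 6634009064865
    [2, 3, 5, 7, 13, 17, 19, 31, 61, 73, 109] where
  prime := by
    simp only [List.forall_mem_cons, List.not_mem_nil, false_imp_iff, implies_true]
    norm_num
  nodup := by decide
  two_mem := by decide
  three_mem := by decide
  dvd := by decide +kernel

theorem mordellWeilRank_6634009064865 :
    Squarefree 6634009064865 ∧ mordellWeilRank (piThirdCurve 6634009064865) = 6 :=
  mordellWeilRank_eq_six_of_check isBadPrimes_6634009064865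
    (conds := [(.sign, 83281), (.two, 69636), (.first 5, 17488), (.second 5, 85331), (.first 7, 320),
      (.second 7, 93640), (.first 13, 16704), (.second 13, 27755), (.first 17, 65808),
      (.second 17, 2080), (.first 19, 70928), (.second 19, 92128), (.first 31, 20736),
      (.second 31, 85883), (.second 61, 18128), (.first 73, 66816)])
    (reps := ![(-156, 7957, 6), (-13377, 6649, 42), (-3315, 14497, 72), (150765, 46543, 5658),
      (-150499, 232715, 33286), (301467, 12971, 7608)])
    (dual := ![11796480, 2129920, 7864320, 4620288, 12976128, 8912896, 8388608, 4194304])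
    (vec := ![489955, 3234539, 1517731, 3259560, 3380251, 2049248, 11184819, 5592400])
    (by decide +kernel)

theorem isBadPrimes_40582123000419 : IsBadPrimes 40582123000419
    [2, 3, 7, 11, 13, 17, 23, 31, 41, 71, 383] where
  prime := by
    simp only [List.forall_mem_cons, List.not_mem_nil, false_imp_iff, implies_true]
    norm_num
  nodup := by decide
  two_mem := by decide
  three_mem := by decide
  dvd := by decide +kernel

theorem mordellWeilRank_40582123000419 :
    Squarefree 40582123000419 ∧ mordellWeilRank (piThirdCurve 40582123000419) = 6 :=
  mordellWeilRank_eq_six_of_check isBadPrimes_40582123000419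
    (conds := [(.sign, 9906), (.two, 142415), (.first 7, 146763), (.second 7, 177192),
      (.first 11, 133800), (.second 11, 168496), (.first 13, 9955), (.second 13, 168504),
      (.first 17, 134840), (.second 17, 170512), (.first 23, 137912), (.second 23, 48296),
      (.first 31, 134120), (.second 31, 48128), (.first 41, 145419), (.second 41, 37400)])
    (reps := ![(4301, 1532, 2), (-9775, 11873, 40), (74727, 15703, 456), (-2829, 84643, 360),
      (-29889587, 31736529, 306745200),
      (-1369499515188272, 686766109660675, 181440146154007230381020)])
    (dual := ![2949120, 2703360, 13172736, 10813440, 3686400, 7864320, 8388608, 4194304])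
    (vec := ![2074320, 3452371, 3252080, 1802595, 3467395, 2422995, 11184819, 5592400])
    (by decide +kernel)

theorem isBadPrimes_45563330326345 : IsBadPrimes 45563330326345
    [2, 3, 5, 13, 23, 47, 139, 827, 5641] where
  prime := by
    simp only [List.forall_mem_cons, List.not_mem_nil, false_imp_iff, implies_true]
    norm_num
  nodup := by decide
  two_mem := by decide
  three_mem := by decide
  dvd := by decide +kernel

/-- Among the listed integers this is the only one whose certificate uses the extra condition at 3,
available because n ≡ 1 mod 3. -/
theorem mordellWeilRank_45563330326345 :
    Squarefree 45563330326345 ∧ mordellWeilRank (piThirdCurve 45563330326345) = 6 :=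
  mordellWeilRank_eq_six_of_check isBadPrimes_45563330326345
    (conds := [(.sign, 1345), (.two, 3292), (.three, 1531), (.threeSplit, 2504), (.first 5, 2520),
      (.second 5, 1499), (.first 13, 1280), (.second 13, 3099), (.first 23, 2200),
      (.second 23, 1867), (.first 47, 3544), (.second 47, 3008)])
    (reps := ![(-4135, 5641, 8), (-121465625, 272872093, 14141517150),
      (1096912367, 434791357, 129005835574), (5460646308, 3242249365, 3618251621838),
      (-35513910757, 56454422875, 735983046294160),
      (-14956054044383, 111123442827556, 1210102407371150277354)])
    (dual := ![1003520, 921600, 933888, 552960, 184320, 626688, 524288, 262144])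
    (vec := ![187779, 158859, 123976, 9744, 217603, 252355, 699027, 349504])
    (by decide +kernel)

/-! ### Explicit height comparisons for doubling and two-torsion translation. -/

theorem exists_add_torsionZero (hn : n ≠ 0) {x y : ℚ}
    (h : (piThirdCurve n).toAffine.Nonsingular x y) (hx : x ≠ 0) :
    ∃ y' h', Point.some x y h + torsionZero hn = Point.some (-3 * n ^ 2 / x) y' h' := by
  have heq := (piThirdCurve_nonsingular_iff hn).mp h
  obtain ⟨l, x₃, y₃, h₃, hs, -, hc, -⟩ := exists_line h
    ((piThirdCurve_nonsingular_iff hn (x := 0) (y := 0)).mpr (by ring)) fun h => hx h.1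
  have h0 : (y - l * x) ^ 2 = 0 := by linear_combination -hc 0
  have hl : y = l * x := by linear_combination pow_eq_zero_iff two_ne_zero |>.mp h0
  have hx₃ : x₃ = -3 * n ^ 2 / x := by
    have s : x₃ = l ^ 2 - 2 * n - x := by linear_combination (hc 1 + hc (-1) - 2 * hc 0) / (2)
    rw [eq_div_iff hx]
    refine mul_right_cancel₀ hx ?_
    rw [hl] at heq
    rw [s]; linear_combination heq
  subst hx₃
  exact ⟨y₃, h₃, hs⟩

theorem exists_add_torsionSelf (hn : n ≠ 0) {x y : ℚ}
    (h : (piThirdCurve n).toAffine.Nonsingular x y) (hx : x ≠ n) :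
    ∃ y' h', Point.some x y h + torsionSelf hn =
      Point.some (n * (x + 3 * n) / (x - n)) y' h' := by
  have heq := (piThirdCurve_nonsingular_iff hn).mp h
  obtain ⟨l, x₃, y₃, h₃, hs, -, hc, -⟩ := exists_line h
    ((piThirdCurve_nonsingular_iff hn (x := n) (y := 0)).mpr (by ring)) fun h => hx h.1
  have hx' := sub_ne_zero.mpr hx
  have h0 : (y - l * (x - n)) ^ 2 = 0 := by linear_combination -hc n
  have hl : y = l * (x - n) := by linear_combination pow_eq_zero_iff two_ne_zero |>.mp h0
  have hx₃ : x₃ = n * (x + 3 * n) / (x - n) := by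
    have s : x₃ = l ^ 2 - 2 * n - x - n := by linear_combination (hc 1 + hc (-1) - 2 * hc 0) / (2)
    rw [eq_div_iff hx']
    refine mul_right_cancel₀ hx' ?_
    rw [hl] at heq
    rw [s]; linear_combination heq
  subst hx₃
  exact ⟨y₃, h₃, hs⟩

theorem two_nsmul_ne_zero (hn : n ≠ 0) {x y : ℚ}
    (h : (piThirdCurve n).toAffine.Nonsingular x y) (hy : y ≠ 0) : 2 • Point.some x y h ≠ 0 := by
  obtain ⟨_, _, _, hs, -⟩ := exists_two_nsmul_some h hn hy
  rw [hs]
  exact Point.some_ne_zero _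

theorem ordinate_ne_zero {x y : ℚ} (h : (piThirdCurve n).toAffine.Nonsingular x y)
    (h2 : 2 • Point.some x y h ≠ 0) : y ≠ 0 := by
  rintro rfl
  exact h2 (two_nsmul_some h)

/-- The hypotheses make u² + 3w² prime to 6, while any factor cancelled in the duplication formula
divides 82944 = 2¹⁰·3⁴; so nothing cancels. -/
theorem ptHeight_pow_four_le_of_not_dvd (hn : n ≠ 0) {x y : ℚ}
    (h : (piThirdCurve n).toAffine.Nonsingular x y) (hy : y ≠ 0) {u w : ℤ} (hw : w ≠ 0)
    (hx : x = n * u / w) (hc : IsCoprime u w) (h3 : ¬(3 : ℤ) ∣ u) (h2 : ¬(Odd u ∧ Odd w)) :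
    ptHeight (Point.some x y h) ^ 4 ≤ ptHeight (2 • Point.some x y h) := by
  have hnq : (n : ℚ) ≠ 0 := by exact_mod_cast hn
  obtain ⟨k, k1, k2, k3⟩ := exists_ptHeight_two_nsmul h hn hy hw hx
  have hk := dvd_const_of_dvd_form hc k1 k2
  have hp3 : Prime (3 : ℤ) := Int.prime_three
  have c3 : IsCoprime k 3 := by
    refine (IsCoprime.symm ?_)
    rw [hp3.coprime_iff_not_dvd]
    intro hd
    have := hp3.dvd_of_dvd_pow (hd.trans k1)
    exact h3 (hp3.dvd_of_dvd_pow ((Int.dvd_add_left (Dvd.intro _ rfl)).mp this))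
  have c2 : IsCoprime k 2 := by
    refine (IsCoprime.symm ?_)
    rw [Int.prime_two.coprime_iff_not_dvd]
    intro hd
    have := Int.prime_two.dvd_of_dvd_pow (hd.trans k1)
    rw [← even_iff_two_dvd] at this
    rcases Int.even_or_odd u with hu | hu
    · rcases Int.even_or_odd w with hw | hw
      · have := hc.isUnit_of_dvd' hu.two_dvd hw.two_dvd
        exact Int.prime_two.not_isUnit this
      · simp only [Int.even_add, Int.even_pow, Int.even_mul] at this
        grind
    · rcases Int.even_or_odd w with hw | hw
      · simp only [Int.even_add, Int.even_pow, Int.even_mul] at this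
        grind
      · exact h2 ⟨hu, hw⟩
  have hunit : IsUnit k := by
    have h4 : (82944 : ℤ) = 2 ^ 10 * 3 ^ 4 := by norm_num
    rw [h4] at hk
    exact ((c2.pow_right (n := 10)).mul_right (c3.pow_right (n := 4))).isUnit_of_dvd' dvd_rfl hk
  rw [Int.isUnit_sq hunit, one_mul] at k3
  refine le_trans (pow_le_pow_left₀ (by linarith [one_le_ptHeight (Point.some x y h)]) ?_ 4) k3
  exact quadHeight_le hw (by rw [hx]; field_simp)

/-- If 3 ∣ u, translation by (0,0) turns u/w into −w/(u/3), whose numerator is prime to 3, and the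
parities are merely exchanged. -/
theorem exists_translate_of_not_odd (hn : n ≠ 0) {x y : ℚ}
    (h : (piThirdCurve n).toAffine.Nonsingular x y) (hy : y ≠ 0) {u w : ℤ} (hw : w ≠ 0)
    (hx : x = n * u / w) (hc : IsCoprime u w) (h2 : ¬(Odd u ∧ Odd w)) :
    ∃ T : (piThirdCurve n).toAffine.Point, 2 • T = 0 ∧
      ptHeight (Point.some x y h + T) ^ 4 ≤ ptHeight (2 • Point.some x y h) := by
  have hnq : (n : ℚ) ≠ 0 := by exact_mod_cast hn
  have hwq : (w : ℚ) ≠ 0 := by exact_mod_cast hw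
  by_cases h3 : (3 : ℤ) ∣ u
  · obtain ⟨a, rfl⟩ := h3
    have heq := (piThirdCurve_nonsingular_iff hn).mp h
    have hx0 : x ≠ 0 := by
      rintro rfl
      exact hy (by simpa using heq)
    have ha : a ≠ 0 := by rintro rfl; exact hx0 (by rw [hx]; simp)
    have haq : (a : ℚ) ≠ 0 := by exact_mod_cast ha
    obtain ⟨y', h', hs⟩ := exists_add_torsionZero hn h hx0
    have h2s : 2 • Point.some x y h = 2 • Point.some (-3 * n ^ 2 / x) y' h' := by
      rw [← hs, nsmul_add, two_nsmul_torsionZero, add_zero]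
    refine ⟨torsionZero hn, two_nsmul_torsionZero hn, ?_⟩
    rw [hs, h2s]
    refine ptHeight_pow_four_le_of_not_dvd hn h'
      (ordinate_ne_zero h' (h2s ▸ two_nsmul_ne_zero hn h hy)) (u := -w) ha ?_ ?_ ?_ ?_
    · rw [hx]; push_cast; field_simp
    · exact (hc.of_mul_left_right).symm.neg_left
    · intro hd
      exact Int.prime_three.not_isUnit (hc.isUnit_of_dvd' (Dvd.intro _ rfl) ((dvd_neg).mp hd))
    · rintro ⟨o1, o2⟩
      exact h2 ⟨Odd.mul (by decide) o2, by simpa using o1⟩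
  · exact ⟨0, by simp, by
      rw [add_zero]; exact ptHeight_pow_four_le_of_not_dvd hn h hy hw hx hc h3 h2⟩

/-- Translation by two-torsion leaves 2P unchanged, so it may be used to avoid cancellation at 2 and
3. For u, w both odd, n ≡ 3 mod 8 forces u ≡ w mod 4, and translation by (n,0) then restores
opposite parities. -/
theorem exists_translate (hn : Squarefree n) (hn8 : n % 8 = 3)
    (P : (piThirdCurve n).toAffine.Point) :
    ∃ T : (piThirdCurve n).toAffine.Point, 2 • T = 0 ∧
      ptHeight (P + T) ^ 4 ≤ ptHeight (2 • P) := by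
  have hn0 := hn.ne_zero
  have hnq : (n : ℚ) ≠ 0 := by exact_mod_cast hn0
  cases P with
  | zero =>
    rw [← Point.zero_def]
    exact ⟨0, by simp, by rw [add_zero, ptHeight_zero, one_pow]; exact one_le_ptHeight _⟩
  | some x y h =>
  by_cases hy : y = 0
  · subst hy
    refine ⟨-Point.some x 0 h, by rw [neg_nsmul, two_nsmul_some, neg_zero], ?_⟩
    rw [add_neg_cancel, ptHeight_zero, one_pow]; exact one_le_ptHeight _
  obtain ⟨z, hr, hP⟩ := exists_isIntRep hn h hy
  generalize (x / n).num = u at *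
  generalize ((x / n).den : ℤ) = w at *
  have hx : x = n * u / w := by
    rw [IsIntRep.point, Point.some.injEq] at hP
    rw [hP.1]; push_cast; rfl
  have hw := hr.ne_w
  have hwq : (w : ℚ) ≠ 0 := by exact_mod_cast hw
  by_cases h2 : Odd u ∧ Odd w
  · have h4 : (4 : ℤ) ∣ u - w := by
      by_contra h4
      obtain ⟨⟨a, rfl⟩, ⟨b, rfl⟩⟩ := h2
      have hz := hr.eq
      have hodd : (a - b) % 2 = 1 := by omega
      obtain ⟨s, hs⟩ : ∃ s, a = b + 2 * s + 1 := ⟨(a - b) / 2, by omega⟩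
      subst hs
      obtain ⟨m, hm⟩ : ∃ m : ℤ, (n : ℤ) = 8 * m + 3 := ⟨n / 8, by omega⟩
      rw [hm] at hz
      have hz2 : (2 : ℤ) ∣ z := by
        by_contra hodd
        obtain ⟨t, rfl⟩ : Odd z := by rw [← Int.not_even_iff_odd, even_iff_two_dvd]; exact hodd
        have h5 : Even ((8 * m + 3) * (2 * t + 1) ^ 2) := by
          rw [hz]; exact ⟨(2 * (b + 2 * s + 1) + 1) * (2 * b + 1) * (2 * s + 1) *
            ((2 * (b + 2 * s + 1) + 1) + 3 * (2 * b + 1)), by ring⟩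
        simp [Int.even_mul, Int.even_add, Int.even_pow, parity_simps] at h5
        grind
      obtain ⟨t, rfl⟩ := hz2
      -- If u − w ≡ 2 mod 4, cancelling 4 leaves a product of four odd numbers on the right. It is
      -- congruent to (1 + 2w(2s+1))² ≡ 1 mod 8, whereas 3t² never is.
      have h6 : (8 * m + 3) * t ^ 2 = (2 * (b + 2 * s + 1) + 1) * (2 * b + 1) * (2 * s + 1) *
          (4 * b + 2 * s + 3) :=
        mul_left_cancel₀ (by norm_num : (4 : ℤ) ≠ 0) (by linear_combination hz)
      have h7 := congrArg (Int.cast : ℤ → ZMod 8) h6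
      push_cast at h7
      rw [show (8 : ZMod 8) = 0 by decide, zero_mul, zero_add] at h7
      have key : ∀ b s t : ZMod 8, 3 * t ^ 2 ≠ (2 * (b + 2 * s + 1) + 1) * (2 * b + 1) *
          (2 * s + 1) * (4 * b + 2 * s + 3) := by decide +kernel
      exact key _ _ _ h7
    obtain ⟨c, hc⟩ := h4
    have hu : u = w + 4 * c := by linarith
    subst hu
    have heq := (piThirdCurve_nonsingular_iff hn0).mp h
    have hxn : x ≠ n := by
      rintro rfl
      exact hy (by simpa using heq)
    have hc0 : c ≠ 0 := by
      rintro rfl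
      exact hxn (by rw [hx]; push_cast; field_simp; ring)
    have hcq : (c : ℚ) ≠ 0 := by exact_mod_cast hc0
    obtain ⟨y', h', hs⟩ := exists_add_torsionSelf hn0 h hxn
    have h2s : 2 • Point.some x y h = 2 • Point.some _ y' h' := by
      rw [← hs, nsmul_add, two_nsmul_torsionSelf, add_zero]
    -- The translate has x/n = (u + 3w)/(u − w) = (w + c)/c; since w is odd, w + c and c have
    -- opposite parity.
    obtain ⟨T, hT, hle⟩ := exists_translate_of_not_odd hn0 h'
      (ordinate_ne_zero h' (h2s ▸ two_nsmul_ne_zero hn0 h hy)) (u := w + c) hc0 (by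
        rw [hx]; push_cast; field_simp; ring) (by
        obtain ⟨r, s, hrs⟩ := hr.coprime
        exact ⟨r + s, 3 * r - s, by linear_combination hrs⟩) (by
        rintro ⟨o1, o2⟩
        have := h2.2
        grind)
    refine ⟨torsionSelf hn0 + T, by rw [nsmul_add, hT, two_nsmul_torsionSelf, add_zero], ?_⟩
    rw [← add_assoc, hs, h2s]
    exact hle
  · exact exists_translate_of_not_odd hn0 h hy hw hx hr.coprime h2

/-- Translation sends (u, w) to (−3w, u), which multiplies u² + 3w² by exactly 3; reducing the
fraction can only lower the value. -/
theorem ptHeight_add_torsionZero_le (hn : n ≠ 0) {x y : ℚ}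
    (h : (piThirdCurve n).toAffine.Nonsingular x y) (hx0 : x ≠ 0) :
    ptHeight (Point.some x y h + torsionZero hn) ≤ 3 * ptHeight (Point.some x y h) := by
  have hnq : (n : ℚ) ≠ 0 := by exact_mod_cast hn
  obtain ⟨u, w, -, hw, hx, hq, -⟩ := exists_int_coords hn h
  have hwq : (w : ℚ) ≠ 0 := by exact_mod_cast hw.ne'
  have hu : u ≠ 0 := by rintro rfl; exact hx0 (by rw [hx]; simp)
  have huq : (u : ℚ) ≠ 0 := by exact_mod_cast hu
  obtain ⟨y', h', hs⟩ := exists_add_torsionZero hn h hx0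
  rw [hs]
  simp only [ptHeight]
  rw [hq]
  refine (quadHeight_le (a := -3 * w) hu ?_).trans (by linarith)
  rw [hx]; push_cast; field_simp

/-- Here (u, w) goes to (u + 3w, u − w), which multiplies the form by exactly 4. -/
theorem ptHeight_add_torsionSelf_le (hn : n ≠ 0) {x y : ℚ}
    (h : (piThirdCurve n).toAffine.Nonsingular x y) (hxn : x ≠ n) :
    ptHeight (Point.some x y h + torsionSelf hn) ≤ 4 * ptHeight (Point.some x y h) := by
  have hnq : (n : ℚ) ≠ 0 := by exact_mod_cast hn
  obtain ⟨u, w, -, hw, hx, hq, -⟩ := exists_int_coords hn h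
  have hwq : (w : ℚ) ≠ 0 := by exact_mod_cast hw.ne'
  have hu : u - w ≠ 0 := by
    intro h
    exact hxn (by rw [hx, sub_eq_zero.mp h]; field_simp)
  have huq : (u : ℚ) - w ≠ 0 := by exact_mod_cast hu
  obtain ⟨y', h', hs⟩ := exists_add_torsionSelf hn h hxn
  rw [hs]
  simp only [ptHeight]
  rw [hq]
  refine (quadHeight_le (a := u + 3 * w) hu ?_).trans (by linarith)
  have : (n * u / w - n : ℚ) ≠ 0 := by
    have : (n * u / w - n : ℚ) = n * (u - w) / w := by field_simp
    rw [this]; positivity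
  rw [hx]; push_cast
  field_simp

/-- Translation by two-torsion changes the height by a bounded factor. -/
theorem ptHeight_add_le (hn : n ≠ 0) {P T : (piThirdCurve n).toAffine.Point} (hT : 2 • T = 0)
    (hP : 2 • P ≠ 0) : ptHeight (P + T) ≤ 12 * ptHeight P := by
  have key : ∀ P : (piThirdCurve n).toAffine.Point, 2 • P ≠ 0 →
      ptHeight (P + torsionZero hn) ≤ 3 * ptHeight P ∧
      ptHeight (P + torsionSelf hn) ≤ 4 * ptHeight P := by
    intro P hP
    cases P with
    | zero => exact absurd (by rw [← Point.zero_def]; simp) hP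
    | some x y h =>
      have hy := ordinate_ne_zero h hP
      have heq := (piThirdCurve_nonsingular_iff hn).mp h
      constructor
      · refine ptHeight_add_torsionZero_le hn h ?_
        rintro rfl
        exact hy (by simpa using heq)
      · refine ptHeight_add_torsionSelf_le hn h ?_
        rintro rfl
        exact hy (by simpa using heq)
  have h0 := one_le_ptHeight P
  obtain ⟨k1, k2⟩ := key P hP
  rcases two_torsion_cases hn hT with rfl | rfl | rfl | rfl
  · rw [add_zero]; linarith
  · linarith
  · linarith
  · have k3 := (key (P + torsionZero hn) (by
      rwa [nsmul_add, two_nsmul_torsionZero, add_zero])).2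
    rw [add_assoc] at k3
    linarith

/-! ### Square classes of the four factors. -/

-- The variables are the parities at p of the valuations of u, w, u − w, u + 3w for two points.
-- Vanishing products say that p divides at most one factor; the three sums are the two descent
-- values and the valuation of n.
set_option synthInstance.maxSize 1024 in
set_option synthInstance.maxHeartbeats 200000 in
theorem factor_parities : ∀ x₀ x₁ x₂ x₃ y₀ y₁ y₂ y₃ : ZMod 2, x₀ * x₁ = 0 → x₀ * x₂ = 0 →
    x₁ * x₂ = 0 → x₁ * x₃ = 0 → x₀ * x₃ = 0 → x₂ * x₃ = 0 → y₀ * y₁ = 0 → y₀ * y₂ = 0 →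
    y₁ * y₂ = 0 → y₁ * y₃ = 0 → y₀ * y₃ = 0 → y₂ * y₃ = 0 → x₀ + x₁ = y₀ + y₁ →
    x₂ + x₁ = y₂ + y₁ → x₀ + x₁ + x₂ + x₃ = y₀ + y₁ + y₂ + y₃ →
    x₀ = y₀ ∧ x₁ = y₁ ∧ x₂ = y₂ ∧ x₃ = y₃ := by
  decide +kernel

-- At 3 the factors u and u + 3w may both be divisible, so x₀x₃ = 0 is unavailable; the odd
-- valuation of n compensates.
set_option synthInstance.maxSize 1024 in
set_option synthInstance.maxHeartbeats 200000 in
theorem factor_parities_three : ∀ x₀ x₁ x₂ x₃ y₀ y₁ y₂ y₃ : ZMod 2, x₀ * x₁ = 0 → x₀ * x₂ = 0 →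
    x₁ * x₂ = 0 → x₁ * x₃ = 0 → x₂ * x₃ = 0 → y₀ * y₁ = 0 → y₀ * y₂ = 0 →
    y₁ * y₂ = 0 → y₁ * y₃ = 0 → y₂ * y₃ = 0 → x₀ + x₁ + x₂ + x₃ = 1 →
    y₀ + y₁ + y₂ + y₃ = 1 → x₀ + x₁ = y₀ + y₁ → x₂ + x₁ = y₂ + y₁ →
    x₀ = y₀ ∧ x₁ = y₁ ∧ x₂ = y₂ ∧ x₃ = y₃ := by
  decide +kernel

-- At 2 the factors u − w and u + 3w may both be even, so x₂x₃ = 0 is unavailable; here n is odd.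
set_option synthInstance.maxSize 1024 in
set_option synthInstance.maxHeartbeats 200000 in
theorem factor_parities_two : ∀ x₀ x₁ x₂ x₃ y₀ y₁ y₂ y₃ : ZMod 2, x₀ * x₁ = 0 → x₀ * x₂ = 0 →
    x₁ * x₂ = 0 → x₁ * x₃ = 0 → x₀ * x₃ = 0 → y₀ * y₁ = 0 → y₀ * y₂ = 0 →
    y₁ * y₂ = 0 → y₁ * y₃ = 0 → y₀ * y₃ = 0 → x₀ + x₁ + x₂ + x₃ = 0 →
    y₀ + y₁ + y₂ + y₃ = 0 → x₀ + x₁ = y₀ + y₁ → x₂ + x₁ = y₂ + y₁ →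
    x₀ = y₀ ∧ x₁ = y₁ ∧ x₂ = y₂ ∧ x₃ = y₃ := by
  decide +kernel

/-- The square classes of the four factors attached to a point are determined by the values of
the descent maps. -/
theorem IsIntRep.isSquare_mul (hn : Squarefree n) (h2n : ¬2 ∣ n) (h3n : 3 ∣ n)
    {u w z u' w' z' : ℤ} (h : IsIntRep n u w z) (h' : IsIntRep n u' w' z')
    (h0 : ∀ f : ℤ → ZMod 2, IsMulChar f → f (n * u * w) = f (n * u' * w'))
    (h1 : ∀ f : ℤ → ZMod 2, IsMulChar f → f (n * (u - w) * w) = f (n * (u' - w') * w')) :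
    IsSquare (u * u') ∧ IsSquare (w * w') ∧ IsSquare ((u - w) * (u' - w')) ∧
      IsSquare ((u + 3 * w) * (u' + 3 * w')) := by
  have hn0 := hn.ne_zero
  have k0 : ∀ f : ℤ → ZMod 2, IsMulChar f → f u + f w = f u' + f w' := fun f hf => by
    have := h0 f hf
    rw [h.char_zero hn0 hf, h'.char_zero hn0 hf] at this
    linear_combination this
  have k1 : ∀ f : ℤ → ZMod 2, IsMulChar f → f (u - w) + f w = f (u' - w') + f w' := fun f hf => by
    have := h1 f hf
    rw [h.char_self hn0 hf, h'.char_self hn0 hf] at this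
    linear_combination this
  have key : ∀ p : ℕ, p.Prime → valChar p u = valChar p u' ∧ valChar p w = valChar p w' ∧
      valChar p (u - w) = valChar p (u' - w') ∧
      valChar p (u + 3 * w) = valChar p (u' + 3 * w') := by
    intro p hp
    have : Fact p.Prime := ⟨hp⟩
    have hpz := Nat.prime_iff_prime_int.mp hp
    have hf := isMulChar_valChar p
    have e0 := k0 _ hf
    have e1 := k1 _ hf
    have s := h.char_sum hn0 hf
    have s' := h'.char_sum hn0 hf
    have hmul : ∀ {a b : ℤ}, ((p : ℤ) ∣ a → (p : ℤ) ∣ b → False) →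
        valChar p a * valChar p b = 0 := by
      intro a b hab
      by_cases ha : (p : ℤ) ∣ a
      · rw [valChar_of_not_dvd p (fun hb => hab ha hb), mul_zero]
      · rw [valChar_of_not_dvd p ha, zero_mul]
    have gen : ∀ {u w z : ℤ}, IsIntRep n u w z → valChar p u * valChar p w = 0 ∧
        valChar p u * valChar p (u - w) = 0 ∧ valChar p w * valChar p (u - w) = 0 ∧
        valChar p w * valChar p (u + 3 * w) = 0 ∧
        (p ≠ 3 → valChar p u * valChar p (u + 3 * w) = 0) ∧
        (p ≠ 2 → valChar p (u - w) * valChar p (u + 3 * w) = 0) := by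
      intro u w z h
      have hc : (p : ℤ) ∣ u → (p : ℤ) ∣ w → False := fun a b => h.not_dvd_of_coprime p a b
      refine ⟨hmul hc, hmul fun a b => hc a ?_, hmul fun a b => hc ?_ a, hmul fun a b => hc ?_ a,
        fun h3 => hmul fun a b => hc a ?_, fun h2 => hmul fun a b => ?_⟩
      · simpa using dvd_sub a b
      · simpa using dvd_add b a
      · simpa using dvd_sub b (a.mul_left 3)
      · have : (p : ℤ) ∣ 3 * w := by simpa using dvd_sub b a
        exact (hpz.dvd_or_dvd this).resolve_left (not_dvd_natCast p Nat.prime_three h3)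
      · have h4 : (p : ℤ) ∣ 2 * (2 * w) := by
          have := dvd_sub b a
          ring_nf at this ⊢
          exact this
        have hp2 := not_dvd_natCast p Nat.prime_two h2
        have hw := (hpz.dvd_or_dvd ((hpz.dvd_or_dvd h4).resolve_left hp2)).resolve_left hp2
        exact hc (by simpa using dvd_add a hw) hw
    obtain ⟨a1, a2, a3, a4, a5, a6⟩ := gen h
    obtain ⟨b1, b2, b3, b4, b5, b6⟩ := gen h'
    generalize valChar p u = x0 at *
    generalize valChar p w = x1 at *
    generalize valChar p (u - w) = x2 at *
    generalize valChar p (u + 3 * w) = x3 at *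
    generalize valChar p u' = y0 at *
    generalize valChar p w' = y1 at *
    generalize valChar p (u' - w') = y2 at *
    generalize valChar p (u' + 3 * w') = y3 at *
    by_cases h2 : p = 2
    · subst h2
      have hv : valChar 2 n = 0 := valChar_of_not_dvd 2 (by exact_mod_cast h2n)
      have a5 := a5 (by norm_num)
      have b5 := b5 (by norm_num)
      rw [hv] at s s'
      exact factor_parities_two _ _ _ _ _ _ _ _ a1 a2 a3 a4 a5 b1 b2 b3 b4 b5 s.symm s'.symm e0 e1
    have c6 := a6 h2
    have d6 := b6 h2
    by_cases h3 : p = 3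
    · subst h3
      have hv : valChar 3 n = 1 := by
        obtain ⟨m, rfl⟩ := h3n
        have hm : ¬3 ∣ m := by
          rintro ⟨k, rfl⟩
          exact absurd (Nat.isUnit_iff.mp (hn 3 ⟨k, by ring⟩)) (by norm_num)
        have hm0 : (m : ℤ) ≠ 0 := by intro h; exact hn0 (by rw [Int.natCast_eq_zero.mp h, mul_zero])
        have h33 : valChar 3 (3 : ℤ) = 1 := valChar_self 3
        rw [Nat.cast_mul, hf _ _ (by norm_num) hm0, Nat.cast_ofNat, h33,
          valChar_of_not_dvd 3 (by exact_mod_cast hm), add_zero]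
      rw [hv] at s s'
      exact factor_parities_three _ _ _ _ _ _ _ _ a1 a2 a3 a4 c6 b1 b2 b3 b4 d6
        s.symm s'.symm e0 e1
    have a5 := a5 h3
    have b5 := b5 h3
    exact factor_parities _ _ _ _ _ _ _ _ a1 a2 a3 a4 a5 c6 b1 b2 b3 b4 b5 d6 e0 e1
      (s.symm.trans s')
  have hsgn : ∀ {a b : ℤ}, a ≠ 0 → b ≠ 0 → signChar a = signChar b → 0 < a * b := by
    intro a b ha hb hab
    unfold signChar at hab
    split_ifs at hab with h1 h2 h2
    · exact mul_pos_of_neg_of_neg h1 h2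
    · exact absurd hab (by decide)
    · exact absurd hab (by decide)
    · exact mul_pos (by omega) (by omega)
  have conv : ∀ {a b : ℤ}, a ≠ 0 → b ≠ 0 → signChar a = signChar b →
      (∀ p : ℕ, p.Prime → valChar p a = valChar p b) → IsSquare (a * b) := by
    intro a b ha hb hs hv
    refine isSquare_of_valChar (hsgn ha hb hs) fun p hp => ?_
    have : Fact p.Prime := ⟨hp⟩
    rw [isMulChar_valChar p _ _ ha hb, hv p hp, CharTwo.add_self_eq_zero]
  have e0 := k0 _ isMulChar_signChar
  have e1 := k1 _ isMulChar_signChar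
  have s := h.char_sum hn0 isMulChar_signChar
  have s' := h'.char_sum hn0 isMulChar_signChar
  have w0 : signChar w = 0 := if_neg (by linarith [h.pos])
  have w0' : signChar w' = 0 := if_neg (by linarith [h'.pos])
  rw [w0, w0', add_zero, add_zero] at e0 e1
  refine ⟨conv (h.ne_u hn0) (h'.ne_u hn0) e0 fun p hp => (key p hp).1,
    conv h.ne_w h'.ne_w (w0.trans w0'.symm) fun p hp => (key p hp).2.1,
    conv (h.ne_sub hn0) (h'.ne_sub hn0) e1 fun p hp => (key p hp).2.2.1,
    conv (h.ne_add hn0) (h'.ne_add hn0) ?_ fun p hp => (key p hp).2.2.2⟩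
  rw [w0, e0, e1] at s
  rw [w0'] at s'
  linear_combination s' - s

/-- An integer in the square class of a squarefree integer is that integer times a square. -/
theorem exists_eq_mul_sq {U U' d : ℤ} (hd : Squarefree d) (hU : U ≠ 0) (hU' : U' ≠ 0)
    (h1 : IsSquare (U * U')) (h2 : IsSquare (U' * d)) : ∃ t : ℕ, t ≠ 0 ∧ U = d * t ^ 2 := by
  obtain ⟨a, ha⟩ := h1
  obtain ⟨b, hb⟩ := h2
  have hsq : IsSquare (U * d) := by
    have h3 : (U * d) * U' ^ 2 = (a * b) ^ 2 := by linear_combination U' * d * ha + a * a * hb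
    have h4 : U' ^ 2 ∣ (a * b) ^ 2 := Dvd.intro_left _ h3
    obtain ⟨c, hc⟩ := (Int.pow_dvd_pow_iff two_ne_zero).mp h4
    refine ⟨c, mul_right_cancel₀ (pow_ne_zero 2 hU') ?_⟩
    rw [h3, hc]; ring
  obtain ⟨s, hs⟩ := hsq
  obtain ⟨t, rfl⟩ : d ∣ s := by
    rw [← hd.dvd_pow_iff_dvd two_ne_zero, sq, ← hs]
    exact Dvd.intro_left _ rfl
  have hUt : U = d * t ^ 2 := mul_right_cancel₀ hd.ne_zero (by rw [hs]; ring)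
  refine ⟨t.natAbs, ?_, by rw [hUt, Int.natAbs_sq]⟩
  rw [Int.natAbs_ne_zero]
  rintro rfl
  exact hU (by rw [hUt]; ring)

/-! ### The finite search in a class. -/

/-- Moduli with the sets of square residues, encoded in binary digits. -/
def squareMasks : List (ℕ × ℕ) :=
  [(64, 144680414395695635), (63, 288872697407275667), (65, 20863489977805260307), (11, 571),
    (17, 107287), (19, 199411), (23, 340831), (29, 332473075), (31, 303908791),
    (37, 96068509339), (41, 1870503675703)]

/-- A quick necessary condition for being a square, by residues modulo some integers. -/
def maybeSquare (t : ℕ) : Bool :=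
  squareMasks.all fun m => m.2.testBit (t % m.1)

theorem maybeSquare_sq (t : ℕ) : maybeSquare (t ^ 2) = true := by
  have key : ∀ m ∈ squareMasks, ∀ r < m.1, m.2.testBit (r ^ 2 % m.1) = true := by decide +kernel
  simp only [maybeSquare, List.all_eq_true]
  intro m hm
  have hpos : 0 < m.1 := (by decide : ∀ m ∈ squareMasks, 0 < m.1) m hm
  rw [Nat.pow_mod]
  have := key m hm (t % m.1) (Nat.mod_lt _ hpos)
  rwa [Nat.pow_mod, Nat.mod_mod] at this

/-- A necessary condition for being `d` times a square. -/
def maybeMulSq (d U : ℤ) : Bool :=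
  U % d == 0 && 0 ≤ U / d && maybeSquare (U / d).toNat

theorem maybeMulSq_of_eq {d U : ℤ} (hd : d ≠ 0) {t : ℕ} (h : U = d * t ^ 2) :
    maybeMulSq d U = true := by
  have h1 : U / d = t ^ 2 := by rw [h, Int.mul_ediv_cancel_left _ hd]
  have h2 : ((t : ℤ) ^ 2).toNat = t ^ 2 := by rw [← Nat.cast_pow, Int.toNat_natCast]
  simp only [maybeMulSq, Bool.and_eq_true, beq_iff_eq, decide_eq_true_eq]
  rw [h1, h2]
  exact ⟨⟨by rw [h, Int.mul_emod_right], by positivity⟩, maybeSquare_sq t⟩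

/-- No two multiples of squares in a box give multiples of squares as values of two linear
forms. -/
def boxCheck (dx dy d₁ d₂ α₁ β₁ α₂ β₂ : ℤ) (a b : ℕ) : Bool :=
  -- The shift by one omits zero roots, since the four factors of a point outside the two-torsion
  -- are nonzero. A bound 0 means an empty box.
  (List.range a).all fun s => (List.range b).all fun r =>
    !(maybeMulSq d₁ (α₁ * (dx * (s + 1 : ℕ) ^ 2) + β₁ * (dy * (r + 1 : ℕ) ^ 2)) &&
      maybeMulSq d₂ (α₂ * (dx * (s + 1 : ℕ) ^ 2) + β₂ * (dy * (r + 1 : ℕ) ^ 2)))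

theorem boxCheck_sound {dx dy d₁ d₂ α₁ β₁ α₂ β₂ : ℤ} {a b : ℕ}
    (h : boxCheck dx dy d₁ d₂ α₁ β₁ α₂ β₂ a b = true) (hd₁ : d₁ ≠ 0) (hd₂ : d₂ ≠ 0)
    {s r t₁ t₂ : ℕ} (hs : s ≠ 0) (hr : r ≠ 0) (hsa : s ≤ a) (hrb : r ≤ b)
    (h₁ : α₁ * (dx * s ^ 2) + β₁ * (dy * r ^ 2) = d₁ * t₁ ^ 2)
    (h₂ : α₂ * (dx * s ^ 2) + β₂ * (dy * r ^ 2) = d₂ * t₂ ^ 2) : False := by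
  simp only [boxCheck, List.all_eq_true, List.mem_range] at h
  have := h (s - 1) (by omega) (r - 1) (by omega)
  rw [Nat.sub_add_cancel (by omega), Nat.sub_add_cancel (by omega),
    maybeMulSq_of_eq hd₁ h₁, maybeMulSq_of_eq hd₂ h₂] at this
  exact absurd this (by decide)

/-- The data of a finite search: the square classes of the four factors, a choice of two of them,
and the size of the box. -/
structure SearchData where
  d₀ : ℤ
  d₁ : ℤ
  d₂ : ℤ
  d₃ : ℤ
  mode : ℕ
  a : ℕ
  b : ℕ

/-- No integers `u, w` of height at most `B` have factors in the given square classes. -/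
def SearchData.check (S : SearchData) (B : ℕ) : Bool :=
  -- The mode selects which two factors are enumerated: u and w; u − w and w; u and u − w; or u + 3w
  -- and w. The inequalities put their roots in the box, by u² ≤ B, 3w² ≤ B, 3(u − w)² ≤ 4B and (u +
  -- 3w)² ≤ 4B; the remaining two factors are linear forms in the chosen ones.
  match S.mode with
  | 0 => B < S.d₀ ^ 2 * (S.a + 1) ^ 4 && B < 3 * S.d₁ ^ 2 * (S.b + 1) ^ 4 &&
      boxCheck S.d₀ S.d₁ S.d₂ S.d₃ 1 (-1) 1 3 S.a S.b
  | 1 => 4 * B < 3 * S.d₂ ^ 2 * (S.a + 1) ^ 4 && B < 3 * S.d₁ ^ 2 * (S.b + 1) ^ 4 &&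
      boxCheck S.d₂ S.d₁ S.d₀ S.d₃ 1 1 1 4 S.a S.b
  | 2 => B < S.d₀ ^ 2 * (S.a + 1) ^ 4 && 4 * B < 3 * S.d₂ ^ 2 * (S.b + 1) ^ 4 &&
      boxCheck S.d₀ S.d₂ S.d₁ S.d₃ 1 (-1) 4 (-3) S.a S.b
  | _ => 4 * B < S.d₃ ^ 2 * (S.a + 1) ^ 4 && B < 3 * S.d₁ ^ 2 * (S.b + 1) ^ 4 &&
      boxCheck S.d₃ S.d₁ S.d₀ S.d₂ 1 (-3) 1 (-4) S.a S.b

theorem SearchData.check_sound {S : SearchData} {B : ℕ} (h : S.check B = true)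
    (hd₀ : S.d₀ ≠ 0) (hd₁ : S.d₁ ≠ 0) (hd₂ : S.d₂ ≠ 0) (hd₃ : S.d₃ ≠ 0) {u w : ℤ}
    (hB : u ^ 2 + 3 * w ^ 2 ≤ B) {t₀ t₁ t₂ t₃ : ℕ} (h₀ : t₀ ≠ 0) (h₁ : t₁ ≠ 0) (h₂ : t₂ ≠ 0)
    (h₃ : t₃ ≠ 0) (e₀ : u = S.d₀ * t₀ ^ 2) (e₁ : w = S.d₁ * t₁ ^ 2) (e₂ : u - w = S.d₂ * t₂ ^ 2)
    (e₃ : u + 3 * w = S.d₃ * t₃ ^ 2) : False := by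
  have bound : ∀ {K L d U : ℤ} {t a : ℕ}, 0 < K → U = d * t ^ 2 → K * U ^ 2 ≤ L →
      L < K * d ^ 2 * (a + 1) ^ 4 → t ≤ a := by
    intro K L d U t a hK hU hL hlt
    by_contra! hta
    have h1 : ((a : ℤ) + 1) ^ 4 ≤ (t : ℤ) ^ 4 := by
      have : ((a + 1 : ℕ) : ℤ) ≤ t := by exact_mod_cast hta
      push_cast at this
      gcongr
    have h2 : K * d ^ 2 * (a + 1) ^ 4 ≤ K * d ^ 2 * t ^ 4 :=
      mul_le_mul_of_nonneg_left h1 (by positivity)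
    have h3 : K * U ^ 2 = K * d ^ 2 * t ^ 4 := by rw [hU]; ring
    linarith
  have hu : 1 * u ^ 2 ≤ B := by nlinarith [sq_nonneg w]
  have hw : 3 * w ^ 2 ≤ B := by nlinarith [sq_nonneg u]
  have hs : 3 * (u - w) ^ 2 ≤ 4 * B := by nlinarith [sq_nonneg (u + 3 * w)]
  have ha : 1 * (u + 3 * w) ^ 2 ≤ 4 * B := by nlinarith [sq_nonneg (u - w)]
  unfold SearchData.check at h
  split at h <;> simp only [Bool.and_eq_true, decide_eq_true_eq] at h <;>
    obtain ⟨⟨b1, b2⟩, hbox⟩ := h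
  · exact boxCheck_sound hbox hd₂ hd₃ h₀ h₁ (bound one_pos e₀ hu (by linarith))
      (bound three_pos e₁ hw b2) (t₁ := t₂) (t₂ := t₃)
      (by rw [← e₀, ← e₁, ← e₂]; ring) (by rw [← e₀, ← e₁, ← e₃]; ring)
  · exact boxCheck_sound hbox hd₀ hd₃ h₂ h₁ (bound three_pos e₂ hs b1)
      (bound three_pos e₁ hw b2) (t₁ := t₀) (t₂ := t₃)
      (by rw [← e₂, ← e₁, ← e₀]; ring) (by rw [← e₂, ← e₁, ← e₃]; ring)
  · exact boxCheck_sound hbox hd₁ hd₃ h₀ h₂ (bound one_pos e₀ hu (by linarith))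
      (bound three_pos e₂ hs b2) (t₁ := t₁) (t₂ := t₃)
      (by rw [← e₂, ← e₁, ← e₀]; ring) (by rw [← e₂, ← e₀, ← e₃]; ring)
  · exact boxCheck_sound hbox hd₀ hd₂ h₃ h₁ (bound one_pos e₃ ha (by linarith))
      (bound three_pos e₁ hw b2) (t₁ := t₀) (t₂ := t₂)
      (by rw [← e₃, ← e₁, ← e₀]; ring) (by rw [← e₃, ← e₁, ← e₂]; ring)

/-! ### Representatives of classes by chains of collinear points. -/

/-- The point `P` lies in `G` and is, up to doubles and two-torsion, the sum of the points
selected by the binary digits of a mask. -/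
def InClass (G : AddSubgroup (piThirdCurve n).toAffine.Point)
    (v : Fin 6 → (piThirdCurve n).toAffine.Point) (m : ℕ) (P : (piThirdCurve n).toAffine.Point) :
    Prop :=
  P ∈ G ∧ ∃ T R, 2 • T = 0 ∧ P = ∑ k : Fin 6, (m.testBit k).toNat • v k + T + 2 • R

namespace InClass

variable {G : AddSubgroup (piThirdCurve n).toAffine.Point}
  {v : Fin 6 → (piThirdCurve n).toAffine.Point} {m m' : ℕ} {P Q : (piThirdCurve n).toAffine.Point}

theorem neg (h : InClass G v m P) : InClass G v m (-P) := by
  obtain ⟨hG, T, R, hT, hP⟩ := h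
  refine ⟨G.neg_mem hG, T, R - P, hT, ?_⟩
  calc -P = P - 2 • P := by rw [two_nsmul]; abel
    _ = _ := by nth_rewrite 1 [hP]; rw [nsmul_sub]; abel

theorem add (h : InClass G v m P) (h' : InClass G v m' Q) : InClass G v (m ^^^ m') (P + Q) := by
  obtain ⟨hG, T, R, hT, hP⟩ := h
  obtain ⟨hG', T', R', hT', hQ⟩ := h'
  refine ⟨G.add_mem hG hG', T + T',
    R + R' + ∑ k : Fin 6, (m.testBit k && m'.testBit k).toNat • v k, by
      rw [nsmul_add, hT, hT', add_zero], ?_⟩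
  -- Bitwise addition without propagation: the carries are absorbed into the double.
  have key : ∑ k : Fin 6, (m.testBit k).toNat • v k + ∑ k : Fin 6, (m'.testBit k).toNat • v k =
      ∑ k : Fin 6, ((m ^^^ m').testBit k).toNat • v k +
        2 • ∑ k : Fin 6, (m.testBit k && m'.testBit k).toNat • v k := by
    rw [Finset.smul_sum, ← Finset.sum_add_distrib, ← Finset.sum_add_distrib]
    refine Finset.sum_congr rfl fun k _ => ?_
    rw [Nat.testBit_xor, ← mul_nsmul', ← add_nsmul, ← add_nsmul]
    congr 1
    cases m.testBit k <;> cases m'.testBit k <;> rfl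
  calc P + Q = (∑ k : Fin 6, (m.testBit k).toNat • v k + ∑ k : Fin 6, (m'.testBit k).toNat • v k) +
        (T + T') + (2 • R + 2 • R') := by rw [hP, hQ]; abel
    _ = _ := by rw [key, nsmul_add, nsmul_add]; abel

theorem of_torsion (hG : P ∈ G) (hP : 2 • P = 0) : InClass G v 0 P :=
  ⟨hG, P, 0, hP, by simp⟩

theorem of_generator (k : Fin 6) (hG : v k ∈ G) : InClass G v (2 ^ (k : ℕ)) (v k) := by
  refine ⟨hG, 0, 0, by simp, ?_⟩
  rw [Finset.sum_eq_single k]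
  · simp
  · intro b _ hb
    have : (k : ℕ) ≠ b := fun h => hb (Fin.ext h.symm)
    simp [this]
  · simp

end InClass

/-- Integers `u, w, z` describing a point, and a mask for its class modulo doubles. -/
structure ChainEntry where
  mask : ℕ
  u : ℤ
  w : ℤ
  z : ℤ

/-- The integers of the entry describe a point in the class given by the mask. -/
def ChainEntry.Valid (G : AddSubgroup (piThirdCurve n).toAffine.Point)
    (v : Fin 6 → (piThirdCurve n).toAffine.Point) (E : ChainEntry) : Prop :=
  E.w ≠ 0 ∧ ∃ h : (piThirdCurve n).toAffine.Nonsingular ((n * E.u : ℤ) / (E.w : ℤ) : ℚ)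
    ((n ^ 2 * E.z : ℤ) / (E.w ^ 2 : ℤ) : ℚ), InClass G v E.mask (.some _ _ h)

/-- The entry with the opposite point. -/
def ChainEntry.neg (E : ChainEntry) : ChainEntry := ⟨E.mask, E.u, E.w, -E.z⟩

theorem ChainEntry.Valid.neg {G : AddSubgroup (piThirdCurve n).toAffine.Point}
    {v : Fin 6 → (piThirdCurve n).toAffine.Point} {E : ChainEntry} (h : E.Valid G v) :
    E.neg.Valid G v := by
  obtain ⟨hw, h, hE⟩ := h
  have hy : ((n ^ 2 * (-E.z) : ℤ) / (E.w ^ 2 : ℤ) : ℚ) =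
      (piThirdCurve n).toAffine.negY ((n * E.u : ℤ) / (E.w : ℤ) : ℚ)
        ((n ^ 2 * E.z : ℤ) / (E.w ^ 2 : ℤ) : ℚ) := by
    rw [piThirdCurve_negY]; push_cast; ring
  have aux : ∀ y', y' = (piThirdCurve n).toAffine.negY ((n * E.u : ℤ) / (E.w : ℤ) : ℚ)
      ((n ^ 2 * E.z : ℤ) / (E.w ^ 2 : ℤ) : ℚ) →
      ∃ h' : (piThirdCurve n).toAffine.Nonsingular ((n * E.u : ℤ) / (E.w : ℤ) : ℚ) y',
        InClass G v E.mask (.some _ _ h') := by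
    rintro _ rfl
    exact ⟨(nonsingular_neg ..).mpr h, by have := hE.neg; rwa [Point.neg_some] at this⟩
  exact ⟨hw, aux _ hy⟩

/-- The three points are distinct and collinear, and the third one lies on the curve. -/
def collinearCheck (n : ℕ) (E₁ E₂ E₃ : ChainEntry) : Bool :=
  E₃.w != 0 && n * E₃.z ^ 2 == E₃.u * E₃.w * (E₃.u - E₃.w) * (E₃.u + 3 * E₃.w) &&
  E₁.u * E₂.w != E₂.u * E₁.w && E₁.u * E₃.w != E₃.u * E₁.w && E₂.u * E₃.w != E₃.u * E₂.w &&
  (E₁.z * E₂.w ^ 2 - E₂.z * E₁.w ^ 2) * (E₃.u * E₁.w - E₁.u * E₃.w) * E₃.w ==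
    (E₃.z * E₁.w ^ 2 - E₁.z * E₃.w ^ 2) * (E₁.u * E₂.w - E₂.u * E₁.w) * E₂.w &&
  E₃.mask == E₁.mask ^^^ E₂.mask

theorem ChainEntry.Valid.of_collinear (hn : n ≠ 0)
    {G : AddSubgroup (piThirdCurve n).toAffine.Point}
    {v : Fin 6 → (piThirdCurve n).toAffine.Point} {E₁ E₂ E₃ : ChainEntry} (h₁ : E₁.Valid G v)
    (h₂ : E₂.Valid G v) (h : collinearCheck n E₁ E₂ E₃ = true) : E₃.Valid G v := by
  simp only [collinearCheck, Bool.and_eq_true, bne_iff_ne, ne_eq, beq_iff_eq] at h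
  obtain ⟨⟨⟨⟨⟨⟨hw₃, heq⟩, h12⟩, h13⟩, h23⟩, hdet⟩, hmask⟩ := h
  obtain ⟨hw₁, c₁, hc₁⟩ := h₁
  obtain ⟨hw₂, c₂, hc₂⟩ := h₂
  have hnq : (n : ℚ) ≠ 0 := by exact_mod_cast hn
  have q₁ : (E₁.w : ℚ) ≠ 0 := by exact_mod_cast hw₁
  have q₂ : (E₂.w : ℚ) ≠ 0 := by exact_mod_cast hw₂
  have q₃ : (E₃.w : ℚ) ≠ 0 := by exact_mod_cast hw₃
  have hne : ∀ {a b c d : ℤ}, (b : ℚ) ≠ 0 → (d : ℚ) ≠ 0 → a * d ≠ c * b →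
      ((n * a : ℤ) / (b : ℤ) : ℚ) ≠ ((n * c : ℤ) / (d : ℤ) : ℚ) := by
    intro a b c d hb hd h he
    rw [div_eq_div_iff hb hd] at he
    have he' : (n * a) * d = (n * c) * b := by exact_mod_cast he
    have hnz : (n : ℤ) ≠ 0 := by exact_mod_cast hn
    exact h (mul_left_cancel₀ hnz (by linear_combination he'))
  have c₃ : (piThirdCurve n).toAffine.Nonsingular ((n * E₃.u : ℤ) / (E₃.w : ℤ) : ℚ)
      ((n ^ 2 * E₃.z : ℤ) / (E₃.w ^ 2 : ℤ) : ℚ) := by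
    rw [piThirdCurve_nonsingular_iff hn]
    have he : (n : ℚ) * E₃.z ^ 2 = E₃.u * E₃.w * (E₃.u - E₃.w) * (E₃.u + 3 * E₃.w) := by
      exact_mod_cast heq
    push_cast
    field_simp
    linear_combination he
  have hsum := add_eq_neg_of_collinear c₁ c₂ c₃ (hne q₁ q₂ h12) (hne q₁ q₃ h13) (hne q₂ q₃ h23) (by
    have hd : ((E₁.z : ℚ) * E₂.w ^ 2 - E₂.z * E₁.w ^ 2) * (E₃.u * E₁.w - E₁.u * E₃.w) * E₃.w =
        (E₃.z * E₁.w ^ 2 - E₁.z * E₃.w ^ 2) * (E₁.u * E₂.w - E₂.u * E₁.w) * E₂.w := by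
      exact_mod_cast hdet
    push_cast
    field_simp
    linear_combination hd)
  have := (hc₁.add hc₂).neg
  rw [hsum, neg_neg, ← hmask] at this
  exact ⟨hw₃, c₃, this⟩

/-- Extend a list of entries by the third points of the lines through two previous entries, the
second one possibly replaced by its opposite. -/
def runChain (n : ℕ) : List ChainEntry → List (ℕ × ℕ × Bool × ChainEntry) → Option (List ChainEntry)
  | l, [] => some l
  | l, (i, j, s, E) :: steps =>
    match l[i]?, l[j]? with
    | some A, some B =>
      -- New entries go to the front, so positions in later steps count back from the newest entry.
      if collinearCheck n A (if s then B.neg else B) E then runChain n (E :: l) steps else none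
    | _, _ => none

theorem valid_of_runChain (hn : n ≠ 0) {G : AddSubgroup (piThirdCurve n).toAffine.Point}
    {v : Fin 6 → (piThirdCurve n).toAffine.Point} {l r : List ChainEntry}
    {steps : List (ℕ × ℕ × Bool × ChainEntry)} (hl : ∀ E ∈ l, E.Valid G v)
    (h : runChain n l steps = some r) : ∀ E ∈ r, E.Valid G v := by
  induction steps generalizing l with
  | nil =>
    rw [runChain, Option.some.injEq] at h
    exact h ▸ hl
  | cons s steps ih =>
    obtain ⟨i, j, s, E⟩ := s
    rw [runChain] at h
    split at h
    · rename_i A B hA hB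
      split_ifs at h with hs hc hc
      · refine ih (List.forall_mem_cons.mpr ⟨?_, hl⟩) h
        exact .of_collinear hn (hl A (List.mem_of_getElem? hA))
          (hl B (List.mem_of_getElem? hB)).neg hc
      · refine ih (List.forall_mem_cons.mpr ⟨?_, hl⟩) h
        exact .of_collinear hn (hl A (List.mem_of_getElem? hA))
          (hl B (List.mem_of_getElem? hB)) hc
    · exact absurd h (by simp)

/-! ### Excluding small points and the generation criterion. -/

/-- The search data exclude points of small height in the class of the entry. -/
def ChainEntry.searchCheck (n : ℕ) (E : ChainEntry) (S : SearchData) (B : ℕ) : Bool :=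
  repCheck n (E.u, E.w, E.z) && 41472 * (E.u ^ 2 + 3 * E.w ^ 2) < (B + 1) ^ 3 &&
  n % S.d₀ == 0 && n % S.d₁ == 0 && n % S.d₂ == 0 && n % S.d₃ == 0 &&
  squareCheck (E.u * S.d₀) && squareCheck (E.w * S.d₁) && squareCheck ((E.u - E.w) * S.d₂) &&
  squareCheck ((E.u + 3 * E.w) * S.d₃) && S.check B

/-- A point of smaller height would have height at most B. Having the same descent values as E, its
four factors would lie in the square classes d₀, …, d₃, hence be these squarefree integers times
squares, which the search excludes. -/
theorem ChainEntry.lt_ptHeight (hn : Squarefree n) (h2n : ¬2 ∣ n) (h3n : 3 ∣ n) {E : ChainEntry}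
    {S : SearchData} {B : ℕ} (hc : E.searchCheck n S B = true)
    {h : (piThirdCurve n).toAffine.Nonsingular ((n * E.u : ℤ) / (E.w : ℤ) : ℚ)
      ((n ^ 2 * E.z : ℤ) / (E.w ^ 2 : ℤ) : ℚ)} {Q R : (piThirdCurve n).toAffine.Point}
    (hQ : Q = .some _ _ h + 2 • R) (hQ2 : 2 • Q ≠ 0) :
    41472 * ptHeight (Point.some _ _ h) < ptHeight Q ^ 3 := by
  simp only [ChainEntry.searchCheck, Bool.and_eq_true, decide_eq_true_eq, beq_iff_eq] at hc
  obtain ⟨⟨⟨⟨⟨⟨⟨⟨⟨⟨hrep, hB⟩, hd₀⟩, hd₁⟩, hd₂⟩, hd₃⟩, s₀⟩, s₁⟩, s₂⟩, s₃⟩, hS⟩ := hc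
  have hn0 := hn.ne_zero
  have hr := isIntRep_of_repCheck hrep
  have hnq : (n : ℚ) ≠ 0 := by exact_mod_cast hn0
  have hwq : (E.w : ℚ) ≠ 0 := by exact_mod_cast hr.ne_w
  have hg : ptHeight (Point.some _ _ h) ≤ E.u ^ 2 + 3 * E.w ^ 2 :=
    quadHeight_le hr.ne_w (by push_cast; field_simp)
  by_contra! hlt
  have hQB : ptHeight Q ≤ B := by
    by_contra! hBQ
    have h1 : (B : ℤ) + 1 ≤ ptHeight Q := hBQ
    have h2 := pow_le_pow_left₀ (by positivity) h1 3
    linarith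
  obtain ⟨x, y, hxy, rfl⟩ : ∃ x y hxy, Q = Point.some x y hxy := by
    cases Q with
    | zero => exact absurd (by rw [← Point.zero_def]; simp) hQ2
    | some x y hxy => exact ⟨x, y, hxy, rfl⟩
  obtain ⟨z, hr', hP⟩ := exists_isIntRep hn hxy (ordinate_ne_zero hxy hQ2)
  have hq : ptHeight (Point.some x y hxy) = (x / n).num ^ 2 + 3 * ((x / n).den : ℤ) ^ 2 := rfl
  rw [hq] at hQB
  generalize (x / n).num = u at *
  generalize ((x / n).den : ℤ) = w at *
  have hpt : Point.some _ _ h = hr.point hn0 := rfl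
  have hcl : ∀ (f : ℤ → ZMod 2) (hf : IsMulChar f) (i : Bool),
      classChar f hf hn0 i (hr'.point hn0) = classChar f hf hn0 i (hr.point hn0) := by
    intro f hf i
    rw [← hP, hQ, map_add, map_nsmul, two_nsmul, CharTwo.add_self_eq_zero, add_zero, hpt]
  obtain ⟨q₀, q₁, q₂, q₃⟩ := hr'.isSquare_mul hn h2n h3n hr
    (fun f hf => by
      have := hcl f hf false
      rwa [(hr'.hasClass hn0).2, (hr.hasClass hn0).2] at this)
    (fun f hf => by
      have := hcl f hf true
      rwa [(hr'.hasClass hn0).2, (hr.hasClass hn0).2] at this)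
  have hsf : ∀ {d : ℤ}, (n : ℤ) % d = 0 → Squarefree d := fun hd =>
    (Int.squarefree_natCast.mpr hn).squarefree_of_dvd (Int.dvd_of_emod_eq_zero hd)
  obtain ⟨t₀, z₀, e₀⟩ := exists_eq_mul_sq (hsf hd₀) (hr'.ne_u hn0) (hr.ne_u hn0) q₀
    (squareCheck_sound s₀).2
  obtain ⟨t₁, z₁, e₁⟩ := exists_eq_mul_sq (hsf hd₁) hr'.ne_w hr.ne_w q₁ (squareCheck_sound s₁).2
  obtain ⟨t₂, z₂, e₂⟩ := exists_eq_mul_sq (hsf hd₂) (hr'.ne_sub hn0) (hr.ne_sub hn0) q₂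
    (squareCheck_sound s₂).2
  obtain ⟨t₃, z₃, e₃⟩ := exists_eq_mul_sq (hsf hd₃) (hr'.ne_add hn0) (hr.ne_add hn0) q₃
    (squareCheck_sound s₃).2
  exact SearchData.check_sound hS (hsf hd₀).ne_zero (hsf hd₁).ne_zero (hsf hd₂).ne_zero
    (hsf hd₃).ne_zero hQB z₀ z₁ z₂ z₃ e₀ e₁ e₂ e₃

/-- Descent: a subgroup containing the two-torsion is everything if every class modulo doubles
and two-torsion has a representative in the subgroup such that all other points of its class are
large. -/
theorem eq_top_of_reps (hn : Squarefree n) (hn8 : n % 8 = 3)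
    (G : AddSubgroup (piThirdCurve n).toAffine.Point)
    (hT : ∀ T : (piThirdCurve n).toAffine.Point, 2 • T = 0 → T ∈ G)
    (h : ∀ Q : (piThirdCurve n).toAffine.Point, ∃ g ∈ G,
      (∃ T R, 2 • T = 0 ∧ Q = g + T + 2 • R) ∧
      ∀ Q' R' : (piThirdCurve n).toAffine.Point, 2 • Q' ≠ 0 → Q' = g + 2 • R' →
        41472 * ptHeight g < ptHeight Q' ^ 3) : G = ⊤ := by
  have hn0 := hn.ne_zero
  by_contra hne
  have hex : ∃ k : ℕ, ∃ Q ∉ G, (ptHeight Q).toNat = k := by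
    by_contra! hcon
    exact hne (eq_top_iff.mpr fun Q _ => by by_contra hQ; exact hcon _ Q hQ rfl)
  classical
  obtain ⟨Q, hQ, hQk⟩ := Nat.find_spec hex
  have hmin : ∀ Q' ∉ G, ptHeight Q ≤ ptHeight Q' := fun Q' hQ' => by
    have := Nat.find_min' hex ⟨Q', hQ', rfl⟩
    rw [← hQk] at this
    have h1 := one_le_ptHeight Q
    have h2 := one_le_ptHeight Q'
    omega
  obtain ⟨g, hg, ⟨T, R, hT0, hQe⟩, hlarge⟩ := h Q
  have hQT : Q - T ∉ G := fun h' => hQ (by simpa using G.add_mem h' (hT T hT0))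
  have hQ2 : 2 • Q ≠ 0 := fun h' => hQ (hT Q h')
  have hQT2 : 2 • (Q - T) ≠ 0 := fun h' => hQT (hT _ h')
  -- One representative serves a class modulo doubles and two-torsion: Q is moved by T into the
  -- exact class of g modulo doubles, at the cost of a factor 12.
  have hQTe : Q - T = g + 2 • R := by rw [hQe]; abel
  have h12 : ptHeight (Q - T) ≤ 12 * ptHeight Q := by
    rw [sub_eq_add_neg]
    exact ptHeight_add_le hn0 (by rw [neg_nsmul, hT0, neg_zero]) hQ2
  obtain ⟨R', hR', hle⟩ := exists_descent_step hn0 G hQT hg hQTe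
  obtain ⟨T', hT', hle'⟩ := exists_translate hn hn8 R'
  have hRT : R' + T' ∉ G := fun h' => hR' (by simpa using G.sub_mem h' (hT T' hT'))
  have h0 := hmin _ hRT
  have h1 := one_le_ptHeight Q
  have h2 := one_le_ptHeight g
  have h3 := pow_le_pow_left₀ (by linarith) h0 4
  have h4 := hlarge _ R hQT2 hQTe
  -- The 24 is 2 from the parallelogram inequality times 12 from T. Passing back to Q − T costs 12³
  -- = 1728, and 1728·24 = 41472.
  have h5 : ptHeight Q ^ 4 ≤ ptHeight Q * (24 * ptHeight g) := by nlinarith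
  have h6 : ptHeight Q ^ 3 ≤ 24 * ptHeight g := by
    refine le_of_mul_le_mul_left ?_ (by linarith : 0 < ptHeight Q)
    linarith [pow_succ' (ptHeight Q) 3]
  have h7 := pow_le_pow_left₀ (by linarith [one_le_ptHeight (Q - T)]) h12 3
  have h8 : (12 * ptHeight Q) ^ 3 = 1728 * ptHeight Q ^ 3 := by ring
  linarith

/-! ### Numerical data for 11229594411. -/

theorem isBadPrimes_11229594411 : IsBadPrimes 11229594411 [2, 3, 7, 31, 139, 193, 643] where
  prime := by
    simp only [List.forall_mem_cons, List.not_mem_nil, false_imp_iff, implies_true]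
    norm_num
  nodup := by decide
  two_mem := by decide
  three_mem := by decide
  dvd := by decide +kernel

/-- Integers describing the six generators. -/
def mainReps : Fin 6 → ℤ × ℤ × ℤ :=
  ![(11191, 3475, -760), (89377, 10416, 28100), (496396, 42525, 729630),
    (1718857, 1716928, 1866152), (3474772, 808083, 62716998),
    (2915209609, 181488384, 21109212112560)]

/-- Local conditions with correction vectors. -/
def mainConditions : List (LocalCondition × ℕ) :=
  [(.sign, 17), (.two, 276), (.first 7, 256), (.second 7, 128), (.second 31, 155),
      (.first 139, 272), (.second 139, 2075), (.second 643, 2067)]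

/-- The functionals dual to the generators and the points of order two. -/
def mainDual : Fin 8 → ℕ :=
  ![40960, 4160, 17952, 16448, 57952, 13344, 32, 41024]

/-- The classes of the generators and the points of order two. -/
def mainVec : Fin 8 → ℕ :=
  ![29392, 47104, 44288, 17040, 44928, 43008, 43699, 21840]

theorem rankSixCheck_main : rankSixCheck 11229594411 [2, 3, 7, 31, 139, 193, 643]
    mainConditions mainReps mainDual mainVec = true := by
  decide +kernel

/-- The six generators and the points of order two. -/
def mainStart : List ChainEntry :=
  [⟨0, -3, 1, 0⟩, ⟨0, 1, 1, 0⟩, ⟨0, 0, 1, 0⟩,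
    ⟨32, (mainReps 5).1, (mainReps 5).2.1, (mainReps 5).2.2⟩,
    ⟨16, (mainReps 4).1, (mainReps 4).2.1, (mainReps 4).2.2⟩,
    ⟨8, (mainReps 3).1, (mainReps 3).2.1, (mainReps 3).2.2⟩,
    ⟨4, (mainReps 2).1, (mainReps 2).2.1, (mainReps 2).2.2⟩,
    ⟨2, (mainReps 1).1, (mainReps 1).2.1, (mainReps 1).2.2⟩,
    ⟨1, (mainReps 0).1, (mainReps 0).2.1, (mainReps 0).2.2⟩]

/-- Further points in the subgroup generated by the six generators and the torsion. -/
def mainSteps : List (ℕ × ℕ × Bool × ChainEntry) :=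
  -- A step that keeps the mask of one operand translates by a two-torsion point and changes only
  -- the representative.
  [(8, 1, false, ⟨1, 5404, 1929, -190⟩), (6, 1, false, ⟨8, -5787, 6869641, 22393824⟩),
    (10, 9, true, ⟨3, 521389, 426337, 1840520⟩), (10, 9, false, ⟨6, 1493284, 661647, -15953210⟩),
    (12, 9, false, ⟨9, 24870169, 8312061, -3896363048⟩),
    (12, 0, false, ⟨11, 32265097, 1453869, 2171203416⟩),
    (0, 7, false, ⟨11, 9156676, 7702807, 542800854⟩),
    (15, 13, false, ⟨5, 66113161, 3822025, 10427844880⟩),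
    (14, 13, false, ⟨12, 143578876, 108222409, 151353808762⟩),
    (17, 5, false, ⟨7, 1226600113, 1209439729, -3317539395280⟩),
    (0, 10, false, ⟨7, -12870288, 1213729825, -2488154546460⟩),
    (18, 15, true, ⟨18, 2671040092, 42825729, 8657301022474⟩),
    (17, 16, true, ⟨24, 2238961348, 955447423, -35330984509730⟩),
    (21, 6, false, ⟨10, 9521992171, 1232253867, -338374507239184⟩),
    (0, 15, false, ⟨10, 3304688443, 2072434576, -84593626809796⟩),
    (23, 18, true, ⟨33, 9147356341, 6268047241, 641030337222520⟩),
    (0, 16, false, ⟨33, -2159481825, 6987874516, 480772752916890⟩),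
    (25, 5, false, ⟨19, 17968917793, 3073704481, 1411361276205536⟩),
    (0, 19, false, ⟨19, 6797507809, 3723803328, 352840319051384⟩),
    (25, 23, false, ⟨20, 11554427353, 7451896752, -1032799823155308⟩),
    (28, 7, true, ⟨25, 38530541083, 268985883, -1178609514621440⟩),
    (0, 23, false, ⟨25, -806957649, 38530541083, 3535828543864320⟩),
    (30, 26, false, ⟨17, 55633241689, 237745561, 1917396690857968⟩),
    (0, 25, false, ⟨17, -713236683, 55633241689, -5752190072573904⟩),
    (31, 15, true, ⟨14, 50858616508, 13133389201, 14231455360841934⟩),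
    (32, 28, true, ⟨34, 126419358025, 930950832, -13035920664586580⟩),
    (0, 28, false, ⟨34, -2792852496, 126419358025, 39107761993759740⟩),
    (33, 20, true, ⟨15, 189675057289, 74918135488, 245319072425281944⟩),
    (36, 8, true, ⟨21, 1986495743761, 99320730709, -8703208918420574072⟩),
    (0, 30, false, ⟨21, 571114483972, 471793753263, -2175802229605143518⟩),
    (36, 8, false, ⟨29, -1156396181193, 2619683166631, -82630352998238008920⟩),
    (0, 31, false, ⟨29, 944019836956, 558554443225, -6885862749853167410⟩),
    (23, 15, true, ⟨45, -1629845881104, 1935910317937, -64697562526974264204⟩),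
    (0, 33, false, ⟨45, 3565756199041, 1392628357569, -86263416702632352272⟩),
    (40, 0, false, ⟨41, 4916797603153, 450985994517, 74356024596278454248⟩),
    (0, 37, false, ⟨41, -1352957983551, 4916797603153, -223068073788835362744⟩),
    (43, 14, true, ⟨27, -1125680347683, 5914340833825, -263357957294317118160⟩),
    (0, 39, false, ⟨27, 5914340833825, 375226782561, 87785985764772372720⟩),
    (44, 11, false, ⟨38, -1552906782063, 3472701604300, -146272584266383378830⟩),
    (0, 40, false, ⟨38, -8865198030837, 5025608386363, -585090337065533515320⟩),
    (46, 28, true, ⟨22, 7145997981241, 184827590832, -79402259770902708044⟩),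
    (45, 44, true, ⟨48, 10671423201628, 491506871697, -240315438240068956422⟩),
    (50, 0, true, ⟨49, 42298282786369, 4311765037441, 5837450436010575314992⟩),
    (51, 11, true, ⟨28, 58186185672169, 2097499355625, -6269379257111686193600⟩),
    (0, 45, false, ⟨28, 16119670934761, 14022171579136, -1567344814277921548400⟩),
    (52, 0, true, ⟨30, 24639425036875, 22723018553872, 2977857476486464872300⟩),
    (0, 48, false, ⟨30, -68169055661616, 24639425036875, -8933572429459394616900⟩),
    (53, 30, false, ⟨37, -46217525965200, 37124638866049, -28804698126685478425980⟩),
    (0, 50, false, ⟨37, 37124638866049, 15405841988400, 9601566042228492808660⟩),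
    (56, 36, true, ⟨26, 67034010004900, 61821873970423, -22038137734275883427790⟩),
    (58, 10, false, ⟨39, -199907248988736, 72919070688289, -81705479446375569698760⟩),
    (0, 53, false, ⟨39, 72919070688289, 66635749662912, 27235159815458523232920⟩),
    (59, 18, true, ⟨47, 442396102520923, 395882852003931, -1087414332159312441581824⟩),
    (61, 26, false, ⟨35, -520993620927777, 823927898666575, 10014574733652905759348280⟩),
    (0, 54, false, ⟨35, 336230379898588, 162565839589329, 834547894471075479945690⟩),
    (61, 58, false, ⟨36, 858266514146596, 276103252216071, -4551873671519560537959390⟩),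
    (62, 13, true, ⟨53, 2626831673076859, 1599919239271, 1607975672336144101481992⟩),
    (0, 58, false, ⟨53, 657907857698668, 656307938459397, 401993918084036025370498⟩),
    (66, 22, false, ⟨40, -2122681276800192, 925242021459091, 18657847289620199093626536⟩),
    (0, 61, false, ⟨40, 925242021459091, 707560425600064, -6219282429873399697875512⟩),
    (68, 26, true, ⟨44, 2043964237197148, 7055807331337, -2324275437675258334203378⟩),
    (69, 20, false, ⟨23, 4306577411756539, 2350148013707623, 141512894611942025183906984⟩),
    (0, 62, false, ⟨23, -1467322048536687, 2839255363219852, 106134670958956518887930238⟩),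
    (71, 16, false, ⟨31, -8266532781664593, 4791382900748575, -530374810164811976543628360⟩),
    (0, 66, false, ⟨31, 4791382900748575, 2755510927221531, 176791603388270658847876120⟩),
    (72, 29, false, ⟨43, -51492444873327, 13582252378849057, -185889619489019670305579448⟩),
    (74, 13, false, ⟨46, 11292373524382972, 6950157896906449, -987656173665534062352213726⟩),
    (71, 27, false, ⟨54, -7061086903295739, 35988219603705769, 9914487596692475012350132992⟩),
    (0, 68, false, ⟨54, 10762326626750377, 8408630992318464, 826207299724372917695844416⟩),
    (76, 26, false, ⟨51, 30089674992555049, 14475390990524713, -6672573821038989420427363616⟩),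
    (0, 71, false, ⟨51, 18378961991032297, 3903571000507584, -1668143455259747355106840904⟩),
    (76, 44, true, ⟨42, -65619649120618128, 22806156721805233, -5742989831116614918063115452⟩),
    (0, 74, false, ⟨42, 22806156721805233, 21873216373539376, 1914329943705538306021038484⟩),
    (78, 31, false, ⟨56, 29837158433672164, 24301315425907975, -6060041305005333746919754130⟩),
    (82, 16, true, ⟨52, 101868995463777529, 39906495108742201, -70501576234386743434264808688⟩),
    (0, 76, false, ⟨52, 55397120197501033, 15490625088758832, -17625394058596685858566202172⟩),
    (83, 34, true, ⟨50, 54790149754951156, 18476435126224227, -18995151738014573104368814754⟩),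
    (0, 79, false, ⟨50, -55429305378672681, 54790149754951156, 56985455214043719313106444262⟩),
    (83, 20, false, ⟨61, 285112422640998652, 489935368545625, 31853317004389862417549566550⟩),
    (0, 81, false, ⟨61, -1469806105636875, 285112422640998652, -95559951013169587252648699650⟩),
    (88, 11, false, ⟨55, 1003530511226961313, 99304884709188901, -3231617146752906347347431384456⟩),
    (0, 82, false, ⟨55, 325361291338632004, 226056406629443103, -807904286688226586836857846114⟩),
    (86, 46, false, ⟨57, -586005853448401875, 7363434830129711089, -256294976120514893315234848382400⟩),
    (0, 83, false, ⟨57, 1987360170894528241, 1792024886411727616, -21357914676709574442936237365200⟩),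
    (91, 10, false, ⟨58, 4273215531775844644, 1314600044893508527, 110279174305915131029516293023910⟩),
    (0, 86, false, ⟨58, 8217015666456370225, 2958615486882336117, 441116697223660524118065172095640⟩),
    (94, 0, true, ⟨59, 31989582503595568075, 31988937716335926544, -86708441995839262839594024968460⟩),
    (0, 89, false, ⟨59, -95966813149007779632, 31989582503595568075, 260125325987517788518782074905380⟩),
    (96, 8, false, ⟨60, -301788082810270721025, 274774791169476190123, 1491554122779214966103668035118357920⟩),
    (0, 90, false, ⟨60, -130634072674539462336, 144140718494936727787, 372888530694803741525917008779589480⟩),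
    (94, 37, false, ⟨63, 702113307047233528807, 161740158271580003331, 2547204370447623038731147619549876440⟩),
    (97, 5, false, ⟨62, 11938732375225316925625, 9625302724895407322553, -982970328343429973888077433508656759200⟩),
    (0, 93, false, ⟨62, 10203660137477884723321, 578357412582477400768, -245742582085857493472019358377164189800⟩),
    (101, 84, true, ⟨13, 12068467, 9388083, -1043087312⟩)]

/-- The search data for representatives of all classes. -/
def mainSearch : List (ℕ × ℕ × SearchData) :=
  -- Each item gives a position in the final list, a height bound B of about the cube root of 41472
  -- times the height of that entry, and the search for it.
  [(93, 11873, ⟨1351, 1929, 139, 31, 0, 0, 0⟩), (101, 70121, ⟨89377, 651, 1, 193, 0, 0, 0⟩),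
    (91, 323605, ⟨4309, 193, 3, 4501, 0, 0, 1⟩), (100, 218586, ⟨124099, 21, 31, 139, 0, 0, 3⟩),
    (90, 527697, ⟨1, 13503, 831637, 1, 0, 26, 0⟩),
    (92, 1804048, ⟨-643, 1, -217, 80481, 3, 0, 27⟩),
    (98, 834902, ⟨868693, 3, 1, 4309, 0, 0, 13⟩), (0, 2571576, ⟨643, 3, 41881, 139, 1, 0, 17⟩),
    (89, 3247451, ⟨1, 8312061, 7, 193, 0, 42, 0⟩), (87, 2214451, ⟨1, 7, 17949, 89377, 1, 0, 11⟩),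
    (86, 5678336, ⟨1, 1, 579, 19394809, 3, 0, 37⟩),
    (85, 13223192, ⟨1351, 1, 3, 2770687, 3, 0, 45⟩),
    (83, 56803991, ⟨-89377, 217, -193, 3, 0, 0, 4⟩),
    (82, 66652564, ⟨7, 1929, 26827, 31, 1, 0, 1⟩),
    (97, 70909599, ⟨17249761, 651, 1, 1, 0, 0, 2⟩),
    (81, 68503885, ⟨193, 7, 93, 89377, 3, 0, 26⟩),
    (79, 99574160, ⟨30163, 1, 3, 124099, 0, 0, 75⟩),
    (77, 184384913, ⟨-193, 4501, -4309, 3, 1, 1, 1⟩),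
    (75, 153848569, ⟨1, 58184427, 1, 193, 0, 111, 0⟩),
    (74, 231742446, ⟨217, 51749283, 1, 1, 0, 8, 0⟩),
    (72, 569530055, ⟨-1, 643, -30163, 579, 1, 0, 4⟩),
    (70, 727538957, ⟨-3, 1, -89377, 41881, 1, 0, 124⟩),
    (69, 504926546, ⟨7, 1, 51749283, 31, 1, 0, 113⟩),
    (67, 1257548319, ⟨-19394809, 1, -1, 579, 0, 0, 143⟩),
    (66, 1298684218, ⟨1, 30163, 1929, 193, 0, 189, 0⟩),
    (64, 3454392528, ⟨193, 13503, 4309, 1, 1, 3, 1⟩),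
    (62, 4231628763, ⟨1351, 1, 268131, 31, 1, 0, 193⟩),
    (60, 9160077116, ⟨1, 1929, 30163, 193, 1, 1, 5⟩),
    (58, 14555331189, ⟨-31, 89377, -1, 4053, 0, 62, 0⟩),
    (56, 11365629486, ⟨193, 1929, 139, 217, 0, 23, 5⟩),
    (54, 18567998119, ⟨-93, 26827, -643, 7, 1, 15, 1⟩),
    (53, 12850415169, ⟨19394809, 3, 1, 193, 0, 0, 147⟩),
    (52, 16813247192, ⟨7, 372297, 139, 31, 0, 136, 0⟩),
    (51, 42453229747, ⟨1, 1, 58184427, 193, 1, 0, 344⟩),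
    (49, 32784973795, ⟨1, 5821459, 1929, 1, 0, 425, 0⟩),
    (47, 64493445703, ⟨-651, 139, -124099, 1, 2, 19, 1⟩),
    (45, 44257309373, ⟨41881, 268131, 1, 1, 0, 2, 0⟩),
    (44, 87147934126, ⟨1, 7, 1604227773, 1, 1, 0, 156⟩),
    (42, 91773932294, ⟨19394809, 3, 193, 1, 0, 0, 241⟩),
    (41, 302262675222, ⟨643, 579, 217, 139, 0, 29, 23⟩),
    (39, 199803710658, ⟨7, 1929, 139, 5983, 3, 12, 11⟩),
    (38, 342091401840, ⟨1, 2606079, 4309, 1, 0, 764, 0⟩),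
    (36, 415132422118, ⟨643, 4053, 31, 139, 0, 31, 9⟩),
    (34, 460715483581, ⟨5821459, 1, 3, 643, 0, 0, 626⟩),
    (33, 557492501455, ⟨7, 193, 268131, 31, 1, 1, 47⟩),
    (31, 1029851413613, ⟨-7, 643, -139, 17949, 3, 10, 30⟩),
    (29, 1237857482864, ⟨2770687, 579, 1, 7, 0, 0, 33⟩),
    (28, 2841890252697, ⟨-2770687, 193, -1, 21, 0, 0, 71⟩),
    (27, 2243903890254, ⟨7, 1, 3, 534742591, 3, 0, 929⟩),
    (25, 2386992590194, ⟨217, 268131, 193, 1, 0, 84, 1⟩),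
    (23, 2514818946561, ⟨89377, 651, 193, 1, 0, 4, 37⟩),
    (21, 4328452759681, ⟨217, 139, 372297, 1, 1, 2, 92⟩),
    (20, 4797148997567, ⟨1, 1351, 8312061, 1, 1, 0, 30⟩),
    (18, 5396130833380, ⟨3743198137, 3, 1, 1, 0, 0, 668⟩),
    (16, 7941821786734, ⟨-1, 4501, -831637, 3, 1, 1, 19⟩),
    (14, 21625730550554, ⟨-579, 7, -2770687, 1, 2, 89, 1⟩),
    (12, 22068703110602, ⟨1, 13503, 4309, 193, 1, 35, 14⟩),
    (10, 82589327120506, ⟨41881, 139, 1929, 1, 2, 14, 73⟩),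
    (8, 157261010483010, ⟨17249761, 93, 7, 1, 0, 0, 279⟩),
    (6, 798570776376045, ⟨-3, 30163, -643, 193, 1, 225, 23⟩),
    (4, 1487701716245017, ⟨-651, 26827, -643, 1, 0, 243, 28⟩),
    (3, 2872384433832201, ⟨5983, 268131, 1, 7, 0, 94, 10⟩),
    (1, 16335944905657956, ⟨1, 30163, 372297, 1, 1, 19, 49⟩)]
/-- The chain of points is correct, every search is successful and all classes are covered. -/
def mainCheck : Bool :=
  match runChain 11229594411 mainStart mainSteps with
  | none => false
  | some l => (mainSearch.all fun r => match l[r.1]? with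
      | none => false
      | some E => E.searchCheck 11229594411 r.2.2 r.2.1) &&
    (List.range 64).all fun m => m == 0 || mainSearch.any fun r => match l[r.1]? with
      | none => false
      | some E => E.mask == m

theorem mainCheck_eq_true : mainCheck = true := by
  decide +kernel

/-! ### Generation modulo torsion and conclusion. -/

theorem exists_valid_entry {G : AddSubgroup (piThirdCurve 11229594411).toAffine.Point}
    {v : Fin 6 → (piThirdCurve 11229594411).toAffine.Point}
    (h : ∀ E ∈ mainStart, E.Valid G v) {m : ℕ} (hm : m < 64) (hm0 : m ≠ 0) :
    ∃ (E : ChainEntry) (S : SearchData) (B : ℕ), E.Valid G v ∧ E.mask = m ∧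
      E.searchCheck 11229594411 S B = true := by
  have hc := mainCheck_eq_true
  rw [mainCheck] at hc
  split at hc
  · exact absurd hc (by decide)
  · rename_i l hl
    have hval := valid_of_runChain (by norm_num) h hl
    simp only [Bool.and_eq_true, List.all_eq_true, List.mem_range, Bool.or_eq_true, beq_iff_eq,
      List.any_eq_true] at hc
    obtain ⟨r, hr, hmask⟩ := (hc.2 m hm).resolve_left hm0
    have hs := hc.1 r hr
    split at hmask
    · exact absurd hmask (by decide)
    · rename_i E hE
      rw [hE] at hs
      exact ⟨E, r.2.2, r.2.1, hval E (List.mem_of_getElem? hE), by simpa using hmask, hs⟩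

/-- A lower bound for the height of points that are not two-torsion. -/
theorem four_mul_le_ptHeight_sq (hn : Squarefree n) {P : (piThirdCurve n).toAffine.Point}
    (hP : 2 • P ≠ 0) : 4 * (n : ℤ) ≤ ptHeight P ^ 2 := by
  cases P with
  | zero => exact absurd (by rw [← Point.zero_def]; simp) hP
  | some x y h =>
    obtain ⟨z, hr, -⟩ := exists_isIntRep hn h (ordinate_ne_zero h hP)
    have hq : ptHeight (Point.some x y h) = (x / n).num ^ 2 + 3 * ((x / n).den : ℤ) ^ 2 := rfl
    rw [hq]
    generalize (x / n).num = u at *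
    generalize ((x / n).den : ℤ) = w at *
    have h1 : 1 ≤ z ^ 2 := by have := sq_pos_of_ne_zero hr.ne; omega
    have h2 : (n : ℤ) ≤ n * z ^ 2 := le_mul_of_one_le_right (by positivity) h1
    have h3 := hr.eq
    -- The square is (u² + 3w²)² − 4uw(u − w)(u + 3w), and the product of the four factors is n z² ≥
    -- n.
    nlinarith [sq_nonneg (u ^ 2 - 2 * u * w - 3 * w ^ 2)]

theorem exists_mask : ∀ c : Fin 6 → ZMod 2, ∃ m : Fin 64, ∀ k : Fin 6,
    (c k).val = ((m : ℕ).testBit k).toNat := by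
  decide +kernel

theorem mainReps_isIntRep (k : Fin 6) :
    IsIntRep 11229594411 (mainReps k).1 (mainReps k).2.1 (mainReps k).2.2 := by
  refine isIntRep_of_repCheck ?_
  revert k
  decide +kernel

/-- The six generators. -/
noncomputable def mainPoint (k : Fin 6) : (piThirdCurve 11229594411).toAffine.Point :=
  (mainReps_isIntRep k).point (by norm_num)

theorem mainCertificate : RankSixCertificate 11229594411 [2, 3, 7, 31, 139, 193, 643]
    mainConditions (genDataList 11229594411 mainReps mainDual mainVec) mainPoint :=
  rankSixCertificate_of_check isBadPrimes_11229594411 rankSixCheck_main mainReps_isIntRep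

/-- The six points generate the group modulo torsion. -/
theorem span_mainPoint_sup_torsion :
    Submodule.span ℤ (Set.range mainPoint) ⊔
      Submodule.torsion ℤ (piThirdCurve 11229594411).toAffine.Point = ⊤ := by
  set N := Submodule.span ℤ (Set.range mainPoint) ⊔
      Submodule.torsion ℤ (piThirdCurve 11229594411).toAffine.Point
  have hsq := isBadPrimes_11229594411.squarefree
  have hn0 : (11229594411 : ℕ) ≠ 0 := by norm_num
  have hT : ∀ T : (piThirdCurve 11229594411).toAffine.Point, 2 • T = 0 → T ∈ N.toAddSubgroup :=
    fun T hT => Submodule.mem_sup_right (mem_torsion_of_two_nsmul hT)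
  have hgen : ∀ k, mainPoint k ∈ N.toAddSubgroup := fun k =>
    Submodule.mem_sup_left (Submodule.subset_span (Set.mem_range_self k))
  have htors : ∀ (u : ℤ), (piThirdCurve 11229594411).toAffine.Nonsingular
      (((11229594411 : ℕ) * u : ℤ) / (1 : ℤ) : ℚ)
      (((11229594411 : ℕ) ^ 2 * 0 : ℤ) / (1 ^ 2 : ℤ) : ℚ) →
      ChainEntry.Valid N.toAddSubgroup mainPoint ⟨0, u, 1, 0⟩ := by
    intro u h
    have h2 : 2 • Point.some _ _ h = 0 := by
      have hy : (((11229594411 : ℕ) ^ 2 * 0 : ℤ) / (1 ^ 2 : ℤ) : ℚ) = 0 := by norm_num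
      revert h
      rw [hy]
      exact fun h => two_nsmul_some h
    exact ⟨one_ne_zero, h, .of_torsion (hT _ h2) h2⟩
  have hstart : ∀ E ∈ mainStart, E.Valid N.toAddSubgroup mainPoint := by
    have hg : ∀ k : Fin 6, ChainEntry.Valid N.toAddSubgroup mainPoint
        ⟨2 ^ (k : ℕ), (mainReps k).1, (mainReps k).2.1, (mainReps k).2.2⟩ := fun k =>
      ⟨(mainReps_isIntRep k).ne_w, (mainReps_isIntRep k).nonsingular hn0,
        .of_generator k (hgen k)⟩
    have ht : ∀ u : ℤ, u * (u - 1) * (u + 3) = 0 →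
        ChainEntry.Valid N.toAddSubgroup mainPoint ⟨0, u, 1, 0⟩ := fun u hu =>
      htors u ((piThirdCurve_nonsingular_iff hn0).mpr (by
        have : (u : ℚ) * (u - 1) * (u + 3) = 0 := by exact_mod_cast hu
        push_cast
        linear_combination -(11229594411 : ℚ) ^ 3 * this))
    simp only [mainStart, List.forall_mem_cons, List.not_mem_nil, false_imp_iff, implies_true,
      and_true]
    exact ⟨ht _ (by norm_num), ht _ (by norm_num), ht _ (by norm_num), hg 5, hg 4, hg 3, hg 2,
      hg 1, hg 0⟩
  have htop := eq_top_of_reps hsq (by norm_num) N.toAddSubgroup hT fun Q => by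
    obtain ⟨c, T, R, hT2, hQ⟩ := mainCertificate.exists_eq_sum Q
    obtain ⟨⟨m, hm⟩, hc⟩ := exists_mask c
    have hQ' : Q = ∑ k : Fin 6, (m.testBit k).toNat • mainPoint k + T + 2 • R := by
      rw [hQ]; simp only [hc]
    by_cases hm0 : m = 0
    · subst hm0
      -- The trivial class is represented by 0 and needs no search: every point outside the
      -- two-torsion satisfies H² ≥ 4n, far above what 41472 < H³ requires.
      refine ⟨0, zero_mem _, ⟨T, R, hT2, by simpa using hQ'⟩, fun Q' R' h2 _ => ?_⟩
      have h4 := four_mul_le_ptHeight_sq hsq h2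
      have h1 := one_le_ptHeight Q'
      rw [ptHeight_zero]
      push_cast at h4
      nlinarith
    · obtain ⟨E, S, B, ⟨hw, h, hG, T', R', hT', hE⟩, hmask, hs⟩ := exists_valid_entry hstart hm hm0
      refine ⟨_, hG, ⟨T - T', R - R', by rw [nsmul_sub, hT2, hT', sub_zero], ?_⟩,
        fun Q' R' h2 hQ'' => ChainEntry.lt_ptHeight hsq (by norm_num) (by norm_num) hs hQ'' h2⟩
      rw [hE, hQ', hmask, nsmul_sub]
      abel
  ext P
  simp only [Submodule.mem_top, iff_true]
  have : P ∈ N.toAddSubgroup := by rw [htop]; trivial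
  exact this

theorem mainReps_coords (i : Fin 6) :
    genX i = (((11229594411 : ℕ) * (mainReps i).1 : ℤ) / ((mainReps i).2.1 : ℤ) : ℚ) ∧
    genY i = (((11229594411 : ℕ) ^ 2 * (mainReps i).2.2 : ℤ) / ((mainReps i).2.1 ^ 2 : ℤ) : ℚ) := by
  fin_cases i <;> constructor <;> norm_num [genX, genY, mainReps, Matrix.vecHead, Matrix.vecTail]

theorem genX_genY_nonsingular (i : Fin 6) :
    (piThirdCurve 11229594411).toAffine.Nonsingular (genX i) (genY i) := by
  rw [(mainReps_coords i).1, (mainReps_coords i).2]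
  exact (mainReps_isIntRep i).nonsingular (by norm_num)

theorem some_genX_genY : (fun i : Fin 6 => (Point.some (genX i) (genY i) (genX_genY_nonsingular i) :
    (piThirdCurve 11229594411).toAffine.Point)) = mainPoint := by
  funext i
  rw [mainPoint, IsIntRep.point, Point.some.injEq]
  exact mainReps_coords i

theorem mainTheorem3 :
    (Squarefree (11229594411 : ℕ) ∧
      piThirdCurve 11229594411 = ⟨0, 22459188822, 0, -378311371906687310763, 0⟩ ∧
      mordellWeilRank (piThirdCurve 11229594411) = 6 ∧
      ∃ h : ∀ i : Fin 6, (piThirdCurve 11229594411).toAffine.Nonsingular (genX i) (genY i),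
        LinearIndependent ℤ (fun i : Fin 6 =>
          (WeierstrassCurve.Affine.Point.some (genX i) (genY i) (h i) :
            (piThirdCurve 11229594411).toAffine.Point)) ∧
        Submodule.span ℤ (Set.range (fun i : Fin 6 =>
            (WeierstrassCurve.Affine.Point.some (genX i) (genY i) (h i) :
              (piThirdCurve 11229594411).toAffine.Point))) ⊔
          Submodule.torsion ℤ (piThirdCurve 11229594411).toAffine.Point = ⊤) ∧
    ∀ n ∈ otherRankSix, Squarefree n ∧ mordellWeilRank (piThirdCurve n) = 6 := by
  refine ⟨⟨isBadPrimes_11229594411.squarefree, ?_, mainCertificate.mordellWeilRank_eq,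
    genX_genY_nonsingular, ?_, ?_⟩, ?_⟩
  · simp only [piThirdCurve, thetaCurve, WeierstrassCurve.mk.injEq]
    norm_num
  · rw [some_genX_genY]
    exact mainCertificate.linearIndependent
  · rw [some_genX_genY]
    exact span_mainPoint_sup_torsion
  · simp only [otherRankSix, List.forall_mem_cons, List.not_mem_nil, false_imp_iff, implies_true,
      and_true]
    exact ⟨mordellWeilRank_167514827545, mordellWeilRank_198606002595,
      mordellWeilRank_271314827665, mordellWeilRank_3302971161265, mordellWeilRank_3492293850595,
      mordellWeilRank_6634009064865, mordellWeilRank_40582123000419,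
      mordellWeilRank_45563330326345⟩
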